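/- Let $y_n$ be the number of unlabelled rooted trees with $n$ vertices, $y(x)=\sum_{n\ge1}y_nx^n$, and let $\rho$ be the radius of convergence of this series. For some $\eta>0$ the function $y$ has an analytic continuation, again denoted by $y$, to the slit disc $\{x\in\mathbb C: |x|<\rho+\eta,\ \arg(x-\rho)\ne0\}$, and there is a constant $b>0$ with $y(x)=1-b\sqrt{\rho-x}+O(\rho-x)$ as $x\to\rho$ in this domain. Define $$y_0(x,u)=u\,y(x),\qquad y_{k+1}(x,u)=x\exp\Big(\sum_{i\ge1}\frac{y_k(x^i,u^i)}{i}\Big)\quad(k\ge0),\qquad w_k(x,u)=y_k(x,u)-y(x).$$ (Here $y_k$ is the generating function of the trees in which the vertices on level $k$ are marked by $u$.) For $\kappa\ge 0$ and $x,\tau\in\mathbb C$ put $$\Psi_\kappa(x,\tau)=\frac{\tau\sqrt{-x}\,\exp(-\kappa\sqrt{-2x})}{\sqrt{-x}\,\exp(\kappa\sqrt{-2x})-\tau\sqrt2\,\sinh(\kappa\sqrt{-2x})}.$$ All square roots and arguments are principal. **Theorem.** Let $\theta>0$, $t\in\mathbb R$ and $C,K\in\mathbb R$ be fixed, and suppose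 that $$(*)\qquad \sqrt{-s}-\tfrac{itb\sqrt\rho}{4}\big(1-\exp(-\kappa b\sqrt{-\rho s})\big)\neq0\quad\text{for all }0\le\kappa\le K\text{ and all } s\neq 0\text{ with }|\arg s|\ge\theta .$$ Condition $(*)$ holds for all $t$ and $K$ if $\theta\ge\pi/4$, and for every $\theta>0$ if $|t|\,K\,b^2\rho<4$. Put $x=\rho\left(1+\frac sn\right)$, $u=e^{it/\sqrt n}$ and $k=\lfloor\kappa\sqrt n\rfloor$. Then, as $n\to\infty$ and $k\to\infty$, $$w_k(x,u)\sim\frac{b^2\rho}{2\sqrt n}\cdot\frac{it\sqrt{-s}\,\exp(-\kappa b\sqrt{-\rho s})}{\sqrt{-s}-\frac{itb\sqrt\rho}{4}\big(1-\exp(-\kappa b\sqrt{-\rho s})\big)}=\frac{b\sqrt{2\rho}}{\sqrt n}\,\Psi_{\kappa b\sqrt\rho/(2\sqrt2)}\Big(s,\frac{itb\sqrt\rho}{2\sqrt2}\Big),$$ uniformly for $0\le\kappa\le K$ and $s\neq 0$ with $|\arg s|\ge\theta$, $|s|\le C\log^2n$. That is, for every $\varepsilon>0$ there is an $N$ such that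 for all $n\ge N$, all $\kappa\in[0,K]$ with $k\ge N$ and all such $s$, the difference between $w_k(x,u)$ and the middle expression is at most $\varepsilon$ times the modulus of the middle expression, and the displayed equality holds. -/

import Mathlib

namespace PolyaTrees

/-- Finite rooted trees: a root together with a list of subtrees. The order of the list is
forgotten below, where trees are taken up to isomorphism. -/
inductive RTree : Type
  | node : List RTree → RTree

mutual
/-- Number of vertices of a rooted tree. -/
def RTree.size : RTree → ℕ
  | .node l => 1 + RTree.sizeList l
/-- Total number of vertices of a list of rooted trees. -/
def RTree.sizeList : List RTree → ℕ
  | [] => 0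
  | a :: l => RTree.size a + RTree.sizeList l
end

/-- Isomorphism of rooted trees: some reordering of the subtrees at the root of the first tree is
termwise isomorphic to the list of subtrees at the root of the second one. -/
inductive RTree.Iso : RTree → RTree → Prop
  | node {l m r : List RTree} :
      l.Perm m → List.Forall₂ RTree.Iso m r → RTree.Iso (.node l) (.node r)

/-- The unlabelled rooted trees (Pólya trees) with `n` vertices: isomorphism classes of rooted
trees with `n` vertices. -/
def UnlabelledTree (n : ℕ) : Type :=
  Quot fun S T : {T : RTree // T.size = n} => RTree.Iso S.1 T.1

/-- The number `y_n` of unlabelled rooted trees with `n` vertices. -/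
noncomputable def treeCount (n : ℕ) : ℕ := Nat.card (UnlabelledTree n)

/-- The power series `y(x) = ∑ y_n x ^ n` (note that `y_0 = 0`). -/
noncomputable def ySeries (x : ℂ) : ℂ := ∑' n : ℕ, (treeCount n : ℂ) * x ^ n

/-- The radius of convergence of the power series `y`. -/
noncomputable def rho : ℝ :=
  (FormalMultilinearSeries.ofScalars ℂ fun n : ℕ => (treeCount n : ℂ)).radius.toReal

/-- The disc of radius `ρ + η` about `0`, slit along the real half-line `[ρ, ∞)`
(`Complex.arg 0 = 0`, so that the point `ρ` itself is removed). -/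
def slitDisc (η : ℝ) : Set ℂ :=
  {x | ‖x‖ < rho + η ∧ Complex.arg (x - (rho : ℂ)) ≠ 0}

/-- `Y` is the analytic continuation of the power series `y` to the slit disc. As the slit disc
is connected, such a `Y` is unique on it. -/
def IsContinuation (η : ℝ) (Y : ℂ → ℂ) : Prop :=
  AnalyticOnNhd ℂ Y (slitDisc η) ∧ ∀ x : ℂ, ‖x‖ < rho → Y x = ySeries x

/-- The functions `y_k(x, u)` marking the vertices on level `k`, where `Y` is (the continuation
of) `y`: `y_0(x, u) = u y(x)` and
`y_{k+1}(x, u) = x exp (∑_{i ≥ 1} y_k(x ^ i, u ^ i) / i)`. -/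
noncomputable def yLevel (Y : ℂ → ℂ) : ℕ → ℂ → ℂ → ℂ
  | 0, x, u => u * Y x
  | k + 1, x, u =>
      x * Complex.exp (∑' i : ℕ, yLevel Y k (x ^ (i + 1)) (u ^ (i + 1)) / ((i : ℂ) + 1))

/-- `w_k(x, u) = y_k(x, u) - y(x)`. -/
noncomputable def wLevel (Y : ℂ → ℂ) (k : ℕ) (x u : ℂ) : ℂ := yLevel Y k x u - Y x

/-- The principal branch of the complex square root. -/
noncomputable def csqrt (z : ℂ) : ℂ := z ^ (1 / 2 : ℂ)

/-- `Ψ_κ(x, τ) = τ √(-x) exp(-κ √(-2x)) / (√(-x) exp(κ √(-2x)) - τ √2 sinh(κ √(-2x)))`. -/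
noncomputable def Psi (κ : ℝ) (x τ : ℂ) : ℂ :=
  τ * csqrt (-x) * Complex.exp (-(κ * csqrt (-2 * x))) /
    (csqrt (-x) * Complex.exp (κ * csqrt (-2 * x))
      - τ * (√2 : ℝ) * Complex.sinh (κ * csqrt (-2 * x)))

/-- The denominator
`√(-s) - (i t b √ρ / 4) (1 - exp(-κ b √(-ρ s)))` of the limiting expression. -/
noncomputable def locDen (b t κ : ℝ) (s : ℂ) : ℂ :=
  csqrt (-s) - Complex.I * t * b * (√rho : ℝ) / 4 *
    (1 - Complex.exp (-(κ * b * csqrt (-(rho * s)))))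

/-- The limiting expression
`(b² ρ / (2 √n)) · i t √(-s) exp(-κ b √(-ρ s)) / (√(-s) - (i t b √ρ / 4) (1 - exp(-κ b √(-ρ s))))`.
-/
noncomputable def locRep (b t κ : ℝ) (n : ℕ) (s : ℂ) : ℂ :=
  (b : ℂ) ^ 2 * rho / (2 * (√(n : ℝ) : ℝ)) *
    (Complex.I * t * csqrt (-s) * Complex.exp (-(κ * b * csqrt (-(rho * s)))) / locDen b t κ s)

/-- The limiting expression has no pole for `κ ∈ [0, K]` and `|arg s| ≥ θ`. -/
def PoleFree (b θ t K : ℝ) : Prop :=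
  ∀ κ : ℝ, 0 ≤ κ → κ ≤ K → ∀ s : ℂ, θ ≤ |Complex.arg s| → locDen b t κ s ≠ 0

end PolyaTrees

namespace PolyaTrees

/-! ### Isomorphism classes of rooted trees -/

-- A tree is a root with a multiset of trees, hence y = x exp(∑ y(x^i)/i). With h(x) = ∑_{i≥2}
-- y(x^i)/i and Φ = x e^h this reads y e^{-y} = Φ. Since ρ ≤ 1/e, the function Φ is analytic for |x|
-- < √(ρ/2), a radius larger than ρ, so the singularity of y comes only from the branch point w = 1
-- of the inverse of w e^{-w}. Indeed Φ(ρ) = 1/e, as y would otherwise continue past ρ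
-- (`rho_mul_exp_hReal`), and |Φ| < 1/e elsewhere on |x| ≤ ρ (`norm_Phi_lt`). Inverting the
-- quadratic behaviour at w = 1 gives the continuation and the square root expansion, with b² =
-- 2(1/ρ + h'(ρ)) (`exists_continuation`).
--
-- The level functions satisfy w_{k+1} = y (exp(w_k + S_k) - 1) with S_k = ∑_{i≥2} w_k(x^i, u^i)/i
-- (`wLevel_succ`). The arguments x^i lie well inside the disc of convergence, so S_k = O(|u - 1|
-- λ^k) with λ < 1; yet ∑ S_k has the same order as w_0 and cannot be dropped. The smoothed levels
-- v_k = w_k + ∑_{m≥k} S_m obey v_{k+1} = y (exp(v_k) - 1) up to summable second order errors. As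
-- 1/(e^v - 1) = 1/v - 1/2 + O(v), the quotient y^k/v_k drops by about y^k/2 in each step, and so
-- y^k/v_k ≈ 1/v_0 - (1 - y^k)/(2(1 - y)) (`reciprocal_recursion`).
--
-- The initial value is v_0 ≈ (u - 1)(1 + ρ h'(ρ)) = (u - 1) b²ρ/2. The sum of all perturbations is
-- found from the fact that marking every level marks every vertex: ∑_k ∂y_k/∂u = x y' at u = 1
-- (`levelDerivSum_eq_mul_deriv`, `tendsto_perturb_div`). With z = √(-s), c = b√ρ and y ≈ 1 - cz/√n,
-- the quotient y^k/v_k becomes √n · `limRecip` and y^k becomes exp(-κcz). When k → ∞, the tail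
-- ∑_{m≥k} S_m is negligible against y^k/√n, so w_k ~ v_k (`tendsto_level_ratio`).
--
-- Condition (*) and a compactness argument keep `limRecip` away from zero
-- (`exists_le_norm_limRecip`). The limit is proved along arbitrary filters, and uniformity follows
-- by contradiction. A pole would solve ζ = iT(1 - e^{-ζ}) with Re ζ > 0, which is excluded in a
-- narrow enough sector or for small |T|.

mutual
/-- A prefix-free code of rooted trees by words of length `2 * size`. -/
def RTree.code : RTree → List Bool
  | .node l => true :: RTree.codeList l
/-- The code of a list of rooted trees, a word of length `2 * sizeList + 1`. -/
def RTree.codeList : List RTree → List Bool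
  | [] => [false]
  | a :: l => RTree.code a ++ RTree.codeList l
end

mutual
theorem RTree.length_code : ∀ T : RTree, T.code.length = 2 * T.size
  | .node l => by
    simp only [RTree.code, RTree.size, List.length_cons, RTree.length_codeList l]; ring
theorem RTree.length_codeList : ∀ l : List RTree,
    (RTree.codeList l).length = 2 * RTree.sizeList l + 1
  | [] => by simp [RTree.codeList, RTree.sizeList]
  | a :: l => by
    simp only [RTree.codeList, RTree.sizeList, List.length_append, RTree.length_code a,
      RTree.length_codeList l]; ring
end

mutual
-- Injectivity alone does not pass through concatenation; allowing arbitrary tails makes the mutual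
-- induction close.
theorem RTree.code_append_inj : ∀ (S T : RTree) (r r' : List Bool),
    S.code ++ r = T.code ++ r' → S = T ∧ r = r'
  | .node l, .node m, r, r', h => by
    simp only [RTree.code, List.cons_append, List.cons.injEq, true_and] at h
    obtain ⟨h1, h2⟩ := RTree.codeList_append_inj l m r r' h
    exact ⟨by rw [h1], h2⟩
theorem RTree.codeList_append_inj : ∀ (l m : List RTree) (r r' : List Bool),
    RTree.codeList l ++ r = RTree.codeList m ++ r' → l = m ∧ r = r'
  | [], [], r, r', h => by simpa [RTree.codeList] using h
  | [], .node b :: m, r, r', h => by simp [RTree.codeList, RTree.code] at h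
  | .node a :: l, [], r, r', h => by simp [RTree.codeList, RTree.code] at h
  | a :: l, b :: m, r, r', h => by
    simp only [RTree.codeList, List.append_assoc] at h
    obtain ⟨h1, h2⟩ := RTree.code_append_inj a b _ _ h
    obtain ⟨h3, h4⟩ := RTree.codeList_append_inj l m _ _ h2
    exact ⟨by rw [h1, h3], h4⟩
end

theorem RTree.code_injective : Function.Injective RTree.code := fun S T h =>
  (RTree.code_append_inj S T [] [] (by simpa using h)).1

theorem RTree.Iso.refl : ∀ T : RTree, RTree.Iso T T
  | .node l => .node (List.Perm.refl l) (List.forall₂_same.2 fun a _ => RTree.Iso.refl a)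

theorem RTree.sizeList_eq (l : List RTree) : RTree.sizeList l = (l.map RTree.size).sum := by
  induction l with
  | nil => rfl
  | cons a l ih => simp [RTree.sizeList, ih]

theorem RTree.Iso.size_eq : ∀ {S T : RTree}, RTree.Iso S T → S.size = T.size
  | .node l, .node r, h => by
    cases h with
    | @node _ m _ hp hf =>
      -- Membership in `l` is recorded before the induction on `hf`, so that the recursive calls are
      -- visibly made on subtrees.
      have key : ∀ a ∈ m, ∀ b, RTree.Iso a b → a.size = b.size := fun a ha b hab =>
        have : a ∈ l := hp.mem_iff.2 ha
        RTree.Iso.size_eq hab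
      simp only [RTree.size, RTree.sizeList_eq, (hp.map RTree.size).sum_eq]
      congr 1
      clear hp
      induction hf with
      | nil => rfl
      | cons hab _ ih =>
        simp only [List.map_cons, List.sum_cons]
        rw [key _ (by simp) _ hab, ih fun a ha => key a (by simp [ha])]
  termination_by S => sizeOf S

/-- Isomorphism classes of rooted trees of any size. -/
abbrev TreeClass : Type := Quot RTree.Iso

/-- The number of vertices of an isomorphism class of rooted trees. -/
def TreeClass.size : TreeClass → ℕ := Quot.lift RTree.size fun _ _ h => h.size_eq

/-- The multiset of the subtrees at the root. -/
def TreeClass.children : TreeClass → Multiset TreeClass :=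
  Quot.lift (fun T => match T with | .node l => ((l.map (Quot.mk RTree.Iso) : List TreeClass) :
      Multiset TreeClass)) <| by
    rintro _ _ ⟨hp, hf⟩
    refine (Multiset.coe_eq_coe.2 (hp.map _)).trans (congrArg _ ?_)
    clear hp
    induction hf with
    | nil => rfl
    | cons hab _ ih => rw [List.map_cons, List.map_cons, Quot.sound hab, ih]

/-- Equality of classes only gives a chain of isomorphisms, so the children are replaced one at a
time along such a chain; the prefix `p` holds the children already treated. -/
theorem mk_node_congr {l m : List RTree}
    (h : l.map (Quot.mk RTree.Iso) = m.map (Quot.mk RTree.Iso)) :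
    Quot.mk RTree.Iso (.node l) = Quot.mk RTree.Iso (.node m) := by
  suffices H : ∀ p : List RTree,
      Quot.mk RTree.Iso (.node (p ++ l)) = Quot.mk RTree.Iso (.node (p ++ m)) from H []
  induction l generalizing m with
  | nil =>
    obtain rfl : m = [] := by simpa using h.symm
    exact fun _ => rfl
  | cons a l ih =>
    obtain _ | ⟨b, m⟩ := m
    · simp at h
    simp only [List.map_cons, List.cons.injEq] at h
    intro p
    have h1 : Quot.mk RTree.Iso (.node (p ++ a :: l)) = Quot.mk RTree.Iso (.node (p ++ b :: l)) := by
      have := Quot.eqvGen_exact h.1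
      induction this with
      | rel x y hxy =>
        refine Quot.sound (.node (List.Perm.refl _) ?_)
        exact List.rel_append (List.forall₂_same.2 fun a _ => RTree.Iso.refl a)
          (.cons hxy (List.forall₂_same.2 fun a _ => RTree.Iso.refl a))
      | refl x => rfl
      | symm x y hxy ih' => exact (ih' ⟨(Quot.eqvGen_sound hxy), h.2⟩).symm
      | trans x y z hxy hyz ih1 ih2 =>
        exact (ih1 ⟨(Quot.eqvGen_sound hxy), h.2⟩).trans (ih2 ⟨(Quot.eqvGen_sound hyz), h.2⟩)
    rw [h1]
    simpa using ih h.2 (p ++ [b])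

theorem map_mk_map_out (l : List TreeClass) :
    (l.map Quot.out).map (Quot.mk RTree.Iso) = l := by
  simp [List.map_map, Function.comp_def, Quot.out_eq]

theorem TreeClass.children_injective : Function.Injective TreeClass.children := by
  rintro ⟨⟨l⟩⟩ ⟨⟨m⟩⟩ h
  have h' : (l.map (Quot.mk RTree.Iso)).Perm (m.map (Quot.mk RTree.Iso)) :=
    Multiset.coe_eq_coe.1 h
  calc Quot.mk RTree.Iso (.node l)
      = Quot.mk RTree.Iso (.node ((l.map (Quot.mk RTree.Iso)).map Quot.out)) :=
        mk_node_congr (map_mk_map_out _).symm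
    _ = Quot.mk RTree.Iso (.node ((m.map (Quot.mk RTree.Iso)).map Quot.out)) :=
        Quot.sound (.node (h'.map _) (List.forall₂_same.2 fun a _ => RTree.Iso.refl a))
    _ = Quot.mk RTree.Iso (.node m) := mk_node_congr (map_mk_map_out _)

theorem TreeClass.children_surjective : Function.Surjective TreeClass.children := by
  rintro ⟨l⟩
  exact ⟨Quot.mk _ (.node (l.map Quot.out)), congrArg _ (map_mk_map_out l)⟩

/-- A rooted tree is determined up to isomorphism by the multiset of its root subtrees. -/
noncomputable def TreeClass.equivMultiset : TreeClass ≃ Multiset TreeClass :=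
  Equiv.ofBijective _ ⟨TreeClass.children_injective, TreeClass.children_surjective⟩

theorem TreeClass.size_eq (τ : TreeClass) : τ.size = 1 + (τ.children.map TreeClass.size).sum := by
  obtain ⟨⟨l⟩⟩ := τ
  change RTree.size (.node l) =
    1 + (((l.map (Quot.mk RTree.Iso) : List TreeClass) : Multiset TreeClass).map
      TreeClass.size).sum
  rw [Multiset.map_coe, Multiset.sum_coe, List.map_map, RTree.size, RTree.sizeList_eq]
  rfl

theorem TreeClass.size_pos (τ : TreeClass) : 0 < τ.size := by rw [TreeClass.size_eq]; omega

/-- The unlabelled trees with `n` vertices are the isomorphism classes of size `n`. -/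
theorem bijective_unlabelledTree (n : ℕ) : Function.Bijective
    (Quot.lift (fun T => ⟨Quot.mk _ T.1, T.2⟩) (fun _ _ h => Subtype.ext (Quot.sound h)) :
      UnlabelledTree n → {τ : TreeClass // τ.size = n}) := by
  constructor
  · rintro ⟨S, hS⟩ ⟨T, hT⟩ h
    have h' := Quot.eqvGen_exact (congrArg Subtype.val h)
    -- Isomorphism preserves the size, so a chain between two trees of size `n` never leaves the
    -- trees of size `n` and also identifies them in the smaller quotient.
    have key : ∀ {S T : RTree}, Relation.EqvGen RTree.Iso S T → S.size = T.size ∧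
        ∀ hS hT, (Quot.mk _ ⟨S, hS⟩ : UnlabelledTree n) = Quot.mk _ ⟨T, hT⟩ := by
      intro S T h
      induction h with
      | rel x y hxy => exact ⟨hxy.size_eq, fun _ _ => Quot.sound hxy⟩
      | refl x => exact ⟨rfl, fun _ _ => rfl⟩
      | symm x y _ ih => exact ⟨ih.1.symm, fun h1 h2 => (ih.2 h2 h1).symm⟩
      | trans x y z _ _ ih1 ih2 =>
        exact ⟨ih1.1.trans ih2.1, fun h1 h2 => (ih1.2 h1 (ih1.1.symm.trans h1)).trans (ih2.2 _ h2)⟩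
    exact (key h').2 hS hT
  · rintro ⟨⟨T⟩, hT⟩
    exact ⟨Quot.mk _ ⟨T, hT⟩, rfl⟩

/-- Codes of trees with `n` vertices are binary words of length 2n. The crude bound serves to show ρ
> 0. -/
theorem finite_and_card_le (n : ℕ) : Finite (UnlabelledTree n) ∧ treeCount n ≤ 4 ^ n := by
  let f : {T : RTree // T.size = n} → List.Vector Bool (2 * n) :=
    fun T => ⟨T.1.code, by rw [RTree.length_code, T.2]⟩
  have hf : Function.Injective f := fun S T h =>
    Subtype.ext (RTree.code_injective (congrArg Subtype.val h))
  have hfin : Finite {T : RTree // T.size = n} := Finite.of_injective f hf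
  have hfin' : Finite (UnlabelledTree n) := Finite.of_surjective (Quot.mk _ : {T : RTree // T.size = n} → UnlabelledTree n)
      Quot.mk_surjective
  refine ⟨hfin', ?_⟩
  calc treeCount n ≤ Nat.card {T : RTree // T.size = n} :=
        Nat.card_le_card_of_surjective (Quot.mk _ : _ → UnlabelledTree n) Quot.mk_surjective
    _ ≤ Nat.card (List.Vector Bool (2 * n)) := Nat.card_le_card_of_injective f hf
    _ = 4 ^ n := by
      rw [Nat.card_eq_fintype_card, card_vector, Fintype.card_bool, pow_mul]; norm_num

theorem treeCount_le (n : ℕ) : treeCount n ≤ 4 ^ n := (finite_and_card_le n).2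

theorem finite_classes (n : ℕ) : Finite {τ : TreeClass // τ.size = n} :=
  have : Finite (UnlabelledTree n) := (finite_and_card_le n).1
  Finite.of_surjective (α := UnlabelledTree n) _ (bijective_unlabelledTree n).2

theorem card_classes (n : ℕ) : Nat.card {τ : TreeClass // τ.size = n} = treeCount n :=
  (Nat.card_eq_of_bijective _ (bijective_unlabelledTree n)).symm

theorem treeCount_zero : treeCount 0 = 0 := by
  rw [← card_classes, Nat.card_eq_zero]
  exact Or.inl ⟨fun τ => (τ.1.size_pos).ne' τ.2⟩

theorem treeCount_one_pos : 0 < treeCount 1 := by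
  rw [← card_classes]
  have := finite_classes 1
  have : Nonempty {τ : TreeClass // τ.size = 1} :=
    ⟨⟨Quot.mk _ (.node []), by simp [TreeClass.size, RTree.size, RTree.sizeList]⟩⟩
  exact Nat.card_pos

/-! ### Sums over multisets -/

section Multisets

variable {ι : Type*}

/-- A multiset over `insert a F` either avoids `a` or arises from another such multiset by adding
one copy of `a`. The sum G therefore satisfies G = G_F + f(a) G. -/
theorem tsum_multiset_finset [DecidableEq ι] {f : ι → ℂ} (hf : ∀ i, ‖f i‖ < 1)
    (hs : Summable fun m : Multiset ι => (m.map f).prod) (F : Finset ι) :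
    ∑' m : {m : Multiset ι | ∀ i ∈ m, i ∈ F}, (m.1.map f).prod = ∏ i ∈ F, (1 - f i)⁻¹ := by
  induction F using Finset.induction_on with
  | empty =>
    have : {m : Multiset ι | ∀ i ∈ m, i ∈ (∅ : Finset ι)} = {0} := by
      ext m
      simp [Multiset.eq_zero_iff_forall_notMem]
    rw [this, tsum_singleton (0 : Multiset ι) fun m => (m.map f).prod]
    simp
  | insert a F ha ih =>
    set A := {m : Multiset ι | ∀ i ∈ m, i ∈ F}
    set B := {m : Multiset ι | ∀ i ∈ m, i ∈ insert a F} with hB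
    have hBA : B = A ∪ Multiset.cons a '' B := by
      ext m
      constructor
      · intro hm
        by_cases ham : a ∈ m
        · obtain ⟨m', rfl⟩ := Multiset.exists_cons_of_mem ham
          exact Or.inr ⟨m', fun i hi => hm i (Multiset.mem_cons_of_mem hi), rfl⟩
        · refine Or.inl fun i hi => ?_
          rcases Finset.mem_insert.1 (hm i hi) with rfl | h
          · exact absurd hi ham
          · exact h
      · rintro (hm | ⟨m', hm', rfl⟩) i hi
        · exact Finset.mem_insert_of_mem (hm i hi)
        · rcases Multiset.mem_cons.1 hi with rfl | h
          · exact Finset.mem_insert_self _ _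
          · exact hm' i h
    have hd : Disjoint A (Multiset.cons a '' B) := by
      rw [Set.disjoint_left]
      rintro _ hm ⟨m', _, rfl⟩
      exact ha (hm a (Multiset.mem_cons_self a m'))
    have h1 : ∑' m : B, (m.1.map f).prod
        = ∑' m : A, (m.1.map f).prod + f a * ∑' m : B, (m.1.map f).prod := by
      conv_lhs => rw [hBA]
      rw [Summable.tsum_union_disjoint (f := fun m : Multiset ι => (m.map f).prod) hd
        (hs.subtype _) (hs.subtype _), tsum_image (fun m : Multiset ι => (m.map f).prod)
        (fun m _ m' _ h => (Multiset.cons_inj_right a).1 h), ← tsum_mul_left]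
      simp
    have hne : 1 - f a ≠ 0 := fun h => by
      have := hf a
      rw [← sub_eq_zero.1 h] at this
      simp at this
    rw [Finset.prod_insert ha, ← ih]
    field_simp
    linear_combination h1

/-- Euler product: the left side is the limit of ∏ (1 - f i)⁻¹ over finite sets. Expanding the
logarithms and exchanging the two summations, justified by the uniform bound `r` < 1, gives the
exponential. -/
theorem tsum_multiset_prod {f : ι → ℂ} {r : ℝ} (hr : r < 1) (hf : ∀ i, ‖f i‖ ≤ r)
    (hsf : Summable fun i => ‖f i‖)
    (hs : Summable fun m : Multiset ι => ‖(m.map f).prod‖) :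
    ∑' m : Multiset ι, (m.map f).prod
      = Complex.exp (∑' k : ℕ, (∑' i, f i ^ (k + 1)) / ((k : ℂ) + 1)) := by
  classical
  have hf1 : ∀ i, ‖f i‖ < 1 := fun i => (hf i).trans_lt hr
  rcases isEmpty_or_nonempty ι with hι | ⟨⟨i0⟩⟩
  · have : ∀ m : Multiset ι, m ≠ 0 → (m.map f).prod = 0 := fun m hm =>
      (hm (Multiset.eq_zero_of_forall_notMem fun a => isEmptyElim a)).elim
    rw [tsum_eq_single 0 this]
    simp
  have hr0 : 0 ≤ r := (norm_nonneg _).trans (hf i0)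
  have hlim1 : Filter.Tendsto (fun F : Finset ι =>
      ∑' m : {m : Multiset ι | ∀ i ∈ m, i ∈ F}, (m.1.map f).prod) Filter.atTop
      (nhds (∑' m : Multiset ι, (m.map f).prod)) := by
    simp_rw [tsum_subtype {m : Multiset ι | ∀ i ∈ m, i ∈ _} fun m : Multiset ι => (m.map f).prod]
    refine tendsto_tsum_of_dominated_convergence hs (fun m => ?_) (Filter.Eventually.of_forall
      fun F m => norm_indicator_le_norm_self _ _)
    refine tendsto_const_nhds.congr' ?_
    filter_upwards [Filter.eventually_ge_atTop m.toFinset] with F hF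
    rw [Set.indicator_of_mem]
    exact fun i hi => hF (Multiset.mem_toFinset.2 hi)
  have hsum2 : Summable fun p : ι × ℕ => f p.1 ^ (p.2 + 1) / ((p.2 : ℂ) + 1) := by
    refine Summable.of_norm_bounded (hsf.mul_of_nonneg (summable_geometric_of_lt_one hr0 hr)
      (fun _ => norm_nonneg _) (fun _ => pow_nonneg hr0 _)) ?_
    rintro ⟨i, k⟩
    rw [norm_div, norm_pow, pow_succ']
    have : (1 : ℝ) ≤ ‖((k : ℂ) + 1)‖ := by
      have : ((k : ℂ) + 1) = ((k + 1 : ℕ) : ℂ) := by push_cast; ring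
      rw [this, Complex.norm_natCast]
      exact_mod_cast Nat.succ_pos k
    calc ‖f i‖ * ‖f i‖ ^ k / ‖((k : ℂ) + 1)‖ ≤ ‖f i‖ * ‖f i‖ ^ k := div_le_self (by positivity) this
      _ ≤ ‖f i‖ * r ^ k := by gcongr; exact hf i
  have hlog : ∀ i, HasSum (fun k : ℕ => f i ^ (k + 1) / ((k : ℂ) + 1)) (-Complex.log (1 - f i)) :=
    fun i => by
      have := (hasSum_nat_add_iff' 1).2 (Complex.hasSum_taylorSeries_neg_log (hf1 i))
      simpa using this
  have hlim2 : Filter.Tendsto (fun F : Finset ι => ∏ i ∈ F, (1 - f i)⁻¹) Filter.atTop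
      (nhds (Complex.exp (∑' k : ℕ, (∑' i, f i ^ (k + 1)) / ((k : ℂ) + 1)))) := by
    have h1 : HasSum (fun i => -Complex.log (1 - f i))
        (∑' p : ι × ℕ, f p.1 ^ (p.2 + 1) / ((p.2 : ℂ) + 1)) :=
      hsum2.hasSum.prod_fiberwise hlog
    have h2 : ∑' p : ι × ℕ, f p.1 ^ (p.2 + 1) / ((p.2 : ℂ) + 1)
        = ∑' k : ℕ, (∑' i, f i ^ (k + 1)) / ((k : ℂ) + 1) := by
      refine hsum2.tsum_prod.trans ((Summable.tsum_comm
        (f := fun i (k : ℕ) => f i ^ (k + 1) / ((k : ℂ) + 1)) hsum2).symm.trans ?_)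
      exact tsum_congr fun k => tsum_div_const
    rw [h2] at h1
    refine ((Complex.continuous_exp.tendsto _).comp h1).congr fun F => ?_
    simp only [Function.comp_apply, Complex.exp_sum]
    refine Finset.prod_congr rfl fun i _ => ?_
    rw [Complex.exp_neg, Complex.exp_log]
    intro h
    have := hf1 i
    rw [← sub_eq_zero.1 h] at this
    simp at this
  refine tendsto_nhds_unique hlim1 (hlim2.congr fun F => ?_)
  exact (tsum_multiset_finset hf1 hs.of_norm F).symm

end Multisets

/-! ### The functional equation of the generating function -/

theorem sum_fiber (n : ℕ) (x : ℂ) :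
    ∑' τ : {τ : TreeClass // τ.size = n}, x ^ τ.1.size = (treeCount n : ℂ) * x ^ n := by
  have := finite_classes n
  have := Fintype.ofFinite {τ : TreeClass // τ.size = n}
  rw [tsum_fintype, Finset.sum_congr rfl (fun τ _ => by rw [τ.2]), Finset.sum_const,
    Finset.card_univ, ← Nat.card_eq_fintype_card, card_classes, nsmul_eq_mul]

theorem summable_classes {x : ℂ} (hx : Summable fun n : ℕ => (treeCount n : ℝ) * ‖x‖ ^ n) :
    Summable fun τ : TreeClass => ‖x ^ τ.size‖ := by
  rw [← (Equiv.sigmaFiberEquiv TreeClass.size).summable_iff]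
  refine (summable_sigma_of_nonneg fun _ => norm_nonneg _).2 ?_
  refine ⟨fun n => ?_, hx.congr fun n => ?_⟩
  · have := finite_classes n
    exact Summable.of_finite
  · have := sum_fiber n (‖x‖ : ℂ)
    simp only [Equiv.sigmaFiberEquiv_apply, norm_pow]
    exact_mod_cast this.symm

theorem ySeries_eq_tsum_classes {x : ℂ}
    (hx : Summable fun n : ℕ => (treeCount n : ℝ) * ‖x‖ ^ n) :
    ySeries x = ∑' τ : TreeClass, x ^ τ.size := by
  have h := ((Equiv.sigmaFiberEquiv TreeClass.size).summable_iff).2 (summable_classes hx).of_norm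
  have hfib : ∀ n, Summable fun τ : {τ : TreeClass // τ.size = n} =>
      ((fun τ : TreeClass => x ^ τ.size) ∘ Equiv.sigmaFiberEquiv TreeClass.size) ⟨n, τ⟩ := fun n => by
    have := finite_classes n
    exact Summable.of_finite
  rw [← (Equiv.sigmaFiberEquiv TreeClass.size).tsum_eq]
  exact (tsum_congr fun n => (sum_fiber n x).symm).trans (h.tsum_sigma' hfib).symm

/-- Pólya's equation. The weight x^size of a tree is x times the product of the weights of its root
subtrees, so y(x)/x is a sum over multisets of trees. The division by x is why x = 0 is treated
apart. -/
theorem ySeries_eq_of_summable {x : ℂ} (hx1 : ‖x‖ < 1)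
    (hx : Summable fun n : ℕ => (treeCount n : ℝ) * ‖x‖ ^ n) :
    ySeries x = x * Complex.exp (∑' i : ℕ, ySeries (x ^ (i + 1)) / ((i : ℂ) + 1)) := by
  rcases eq_or_ne x 0 with rfl | h0
  · rw [zero_mul, ySeries, tsum_eq_single 0]
    · simp [treeCount_zero]
    · intro n hn; simp [hn]
  have hpow : ∀ i : ℕ, Summable fun n : ℕ => (treeCount n : ℝ) * ‖x ^ (i + 1)‖ ^ n := fun i => by
    refine hx.of_nonneg_of_le (fun n => by positivity) fun n => ?_
    gcongr
    rw [norm_pow]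
    exact pow_le_of_le_one (norm_nonneg _) hx1.le (Nat.succ_ne_zero _)
  have hprod : ∀ τ : TreeClass,
      x ^ τ.size = x * (((TreeClass.equivMultiset τ).map fun σ : TreeClass => x ^ σ.size).prod) :=
    fun τ => by
      have : ∀ m : Multiset TreeClass, x ^ (m.map TreeClass.size).sum
          = (m.map fun σ : TreeClass => x ^ σ.size).prod := fun m => by
        induction m using Multiset.induction_on with
        | empty => simp
        | cons a m ih => simp [pow_add, ih]
      rw [TreeClass.size_eq, pow_add, pow_one, this]
      rfl
  have hs := summable_classes hx
  have hs' : Summable fun m : Multiset TreeClass =>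
      ‖((m.map fun σ : TreeClass => x ^ σ.size).prod)‖ := by
    rw [← TreeClass.equivMultiset.summable_iff]
    refine (hs.mul_left ‖x‖⁻¹).congr fun τ => ?_
    rw [hprod τ, norm_mul, inv_mul_cancel_left₀ (norm_ne_zero_iff.2 h0)]
    rfl
  have hle : ∀ τ : TreeClass, ‖x ^ τ.size‖ ≤ ‖x‖ := fun τ => by
    rw [norm_pow]
    exact pow_le_of_le_one (norm_nonneg _) hx1.le τ.size_pos.ne'
  rw [ySeries_eq_tsum_classes hx, tsum_congr hprod, tsum_mul_left,
    TreeClass.equivMultiset.tsum_eq (fun m => (m.map fun σ : TreeClass => x ^ σ.size).prod),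
    tsum_multiset_prod hx1 hle hs hs']
  refine congrArg (fun z => x * Complex.exp z) (tsum_congr fun i => ?_)
  rw [ySeries_eq_tsum_classes (hpow i)]
  congr 1
  exact tsum_congr fun τ => by rw [← pow_mul, ← pow_mul, mul_comm]

/-! ### The generating function in its disc of convergence -/

/-- The series `y` converges at `r`. -/
def Conv (r : ℝ) : Prop := Summable fun n : ℕ => (treeCount n : ℝ) * r ^ n

/-- The generating function `y` on the real axis. -/
noncomputable def yReal (r : ℝ) : ℝ := ∑' n : ℕ, (treeCount n : ℝ) * r ^ n

theorem Conv.mono {r s : ℝ} (hs : Conv s) (hr : 0 ≤ r) (hrs : r ≤ s) : Conv r :=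
  Summable.of_nonneg_of_le (fun n => by positivity) (fun n => by gcongr) hs

theorem yReal_nonneg {r : ℝ} (hr : 0 ≤ r) : 0 ≤ yReal r := tsum_nonneg fun n => by positivity

theorem yReal_mono {r s : ℝ} (hs : Conv s) (hr : 0 ≤ r) (hrs : r ≤ s) : yReal r ≤ yReal s :=
  (hs.mono hr hrs).tsum_le_tsum (fun n => by gcongr) hs

/-- There is no constant term, so y(r)/r is nondecreasing. -/
theorem yReal_le_mul {r s : ℝ} (hs : Conv s) (hs0 : 0 < s) (hr : 0 ≤ r) (hrs : r ≤ s) :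
    yReal r ≤ r / s * yReal s := by
  rw [yReal, yReal, ← tsum_mul_left]
  refine (hs.mono hr hrs).tsum_le_tsum (fun n => ?_) (hs.mul_left _)
  rcases n with _ | n
  · simp [treeCount_zero]
  · have : r / s * ((treeCount (n + 1) : ℝ) * s ^ (n + 1)) = treeCount (n + 1) * (s ^ n * r) := by
      field_simp; ring
    rw [this, pow_succ]
    gcongr

theorem norm_ySeries_term (n : ℕ) (x : ℂ) :
    ‖(treeCount n : ℂ) * x ^ n‖ = (treeCount n : ℝ) * ‖x‖ ^ n := by simp

theorem Conv.summable {x : ℂ} (hx : Conv ‖x‖) : Summable fun n : ℕ => (treeCount n : ℂ) * x ^ n :=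
  Summable.of_norm (hx.congr fun n => (norm_ySeries_term n x).symm)

theorem norm_ySeries_le {x : ℂ} (hx : Conv ‖x‖) : ‖ySeries x‖ ≤ yReal ‖x‖ :=
  tsum_of_norm_bounded hx.hasSum fun n => (norm_ySeries_term n x).le

theorem ySeries_ofReal (r : ℝ) : ySeries r = yReal r := by
  rw [ySeries, yReal, Complex.ofReal_tsum]
  exact tsum_congr fun n => by push_cast; rfl

/-- The sum `∑_{i ≥ 2} y(x ^ i) / i`. -/
noncomputable def hSeries (x : ℂ) : ℂ := ∑' i : ℕ, ySeries (x ^ (i + 2)) / ((i : ℂ) + 2)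

/-- The sum `∑_{i ≥ 2} y(x ^ i) / i` on the real axis. -/
noncomputable def hReal (r : ℝ) : ℝ := ∑' i : ℕ, yReal (r ^ (i + 2)) / ((i : ℝ) + 2)

/-- The function `x exp (∑_{i ≥ 2} y(x ^ i) / i)`, which is equal to `y exp (-y)`. -/
noncomputable def Phi (x : ℂ) : ℂ := x * Complex.exp (hSeries x)

theorem norm_natCast_add_two (i : ℕ) : ‖(i : ℂ) + 2‖ = (i : ℝ) + 2 := by
  rw [show (i : ℂ) + 2 = ((i + 2 : ℕ) : ℂ) by push_cast; ring, Complex.norm_natCast]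
  push_cast; ring

theorem norm_natCast_add_one (i : ℕ) : ‖(i : ℂ) + 1‖ = (i : ℝ) + 1 := by
  rw [show (i : ℂ) + 1 = ((i + 1 : ℕ) : ℂ) by push_cast; ring, Complex.norm_natCast]
  push_cast; ring

theorem conv_pow_add_two {r : ℝ} (h0 : 0 ≤ r) (h1 : r ≤ 1) (h : Conv (r ^ 2)) (i : ℕ) :
    Conv (r ^ (i + 2)) :=
  h.mono (by positivity) (pow_le_pow_of_le_one h0 h1 (by omega))

theorem yReal_pow_add_two_le {r : ℝ} (h0 : 0 ≤ r) (h1 : r ≤ 1) (h : Conv (r ^ 2)) (i : ℕ) :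
    yReal (r ^ (i + 2)) ≤ r ^ i * yReal (r ^ 2) := by
  rcases h0.eq_or_lt with rfl | h0'
  · rw [zero_pow (by omega)]
    have : yReal 0 = 0 := by
      rw [yReal, tsum_eq_single 0]
      · simp [treeCount_zero]
      · intro n hn; simp [hn]
    simp [this]
  have := yReal_le_mul h (by positivity) (by positivity : 0 ≤ r ^ (i + 2))
    (pow_le_pow_of_le_one h0 h1 (by omega))
  rwa [pow_add, mul_div_assoc, div_self (by positivity), mul_one, ← pow_add] at this

theorem summable_hReal {r : ℝ} (h0 : 0 ≤ r) (h1 : r < 1) (h : Conv (r ^ 2)) :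
    Summable fun i : ℕ => yReal (r ^ (i + 2)) / ((i : ℝ) + 2) := by
  refine Summable.of_nonneg_of_le (fun i => div_nonneg (yReal_nonneg (by positivity))
    (by positivity)) (fun i => ?_) ((summable_geometric_of_lt_one h0 h1).mul_right (yReal (r ^ 2)))
  exact (div_le_self (yReal_nonneg (by positivity))
    (by have : (0 : ℝ) ≤ i := by positivity
        linarith)).trans (yReal_pow_add_two_le h0 h1.le h i)

theorem norm_hSeries_term_le {x : ℂ} (h1 : ‖x‖ ≤ 1) (h : Conv (‖x‖ ^ 2)) (i : ℕ) :
    ‖ySeries (x ^ (i + 2)) / ((i : ℂ) + 2)‖ ≤ yReal (‖x‖ ^ (i + 2)) / ((i : ℝ) + 2) := by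
  rw [norm_div, norm_natCast_add_two, ← norm_pow]
  gcongr
  refine norm_ySeries_le ?_
  rw [norm_pow]
  exact conv_pow_add_two (norm_nonneg _) h1 h i

theorem summable_hSeries {x : ℂ} (h1 : ‖x‖ < 1) (h : Conv (‖x‖ ^ 2)) :
    Summable fun i : ℕ => ySeries (x ^ (i + 2)) / ((i : ℂ) + 2) :=
  Summable.of_norm_bounded (summable_hReal (norm_nonneg _) h1 h)
    (norm_hSeries_term_le h1.le h)

theorem norm_hSeries_le {x : ℂ} (h1 : ‖x‖ < 1) (h : Conv (‖x‖ ^ 2)) : ‖hSeries x‖ ≤ hReal ‖x‖ :=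
  tsum_of_norm_bounded (summable_hReal (norm_nonneg _) h1 h).hasSum
    (norm_hSeries_term_le h1.le h)

theorem hSeries_ofReal (r : ℝ) : hSeries r = hReal r := by
  rw [hSeries, hReal, Complex.ofReal_tsum]
  exact tsum_congr fun n => by rw [← Complex.ofReal_pow, ySeries_ofReal]; push_cast; rfl

theorem hReal_nonneg {r : ℝ} (h0 : 0 ≤ r) : 0 ≤ hReal r :=
  tsum_nonneg fun i => div_nonneg (yReal_nonneg (by positivity)) (by positivity)

theorem hReal_mono {r s : ℝ} (h0 : 0 ≤ r) (hrs : r ≤ s) (h1 : s < 1) (h : Conv (s ^ 2)) :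
    hReal r ≤ hReal s := by
  have hr : Conv (r ^ 2) := h.mono (by positivity) (by gcongr)
  refine (summable_hReal h0 (hrs.trans_lt h1) hr).tsum_le_tsum (fun i => ?_)
    (summable_hReal (h0.trans hrs) h1 h)
  gcongr
  exact yReal_mono (conv_pow_add_two (h0.trans hrs) h1.le h i) (by positivity) (by gcongr)

theorem norm_Phi_le {x : ℂ} (h1 : ‖x‖ < 1) (h : Conv (‖x‖ ^ 2)) :
    ‖Phi x‖ ≤ ‖x‖ * Real.exp (hReal ‖x‖) := by
  rw [Phi, norm_mul, Complex.norm_exp]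
  gcongr
  exact (Complex.re_le_norm _).trans (norm_hSeries_le h1 h)

theorem Phi_ofReal (r : ℝ) : Phi r = ((r * Real.exp (hReal r) : ℝ) : ℂ) := by
  rw [Phi, hSeries_ofReal]; push_cast; rfl

theorem Conv.sq {r : ℝ} (h : Conv r) (h0 : 0 ≤ r) (h1 : r ≤ 1) : Conv (r ^ 2) :=
  h.mono (by positivity) (by nlinarith)

theorem ySeries_eq_exp {x : ℂ} (h1 : ‖x‖ < 1) (h : Conv ‖x‖) :
    ySeries x = x * Complex.exp (ySeries x + hSeries x) := by
  conv_lhs => rw [ySeries_eq_of_summable h1 h]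
  have hs := summable_hSeries h1 (h.sq (norm_nonneg _) h1.le)
  congr 2
  rw [Summable.tsum_eq_zero_add]
  · simp only [zero_add, pow_one, Nat.cast_zero, div_one]
    congr 1
    exact tsum_congr fun i => by push_cast; ring_nf
  · rw [← summable_nat_add_iff 1]
    exact hs.congr fun i => by push_cast; ring_nf

theorem ySeries_mul_exp_neg {x : ℂ} (h1 : ‖x‖ < 1) (h : Conv ‖x‖) :
    ySeries x * Complex.exp (-ySeries x) = Phi x := by
  conv_lhs => enter [1]; rw [ySeries_eq_exp h1 h]
  rw [Phi, mul_assoc, ← Complex.exp_add]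
  ring_nf

theorem yReal_mul_exp_neg {r : ℝ} (h0 : 0 ≤ r) (h1 : r < 1) (h : Conv r) :
    yReal r * Real.exp (-yReal r) = r * Real.exp (hReal r) := by
  have hn : ‖(r : ℂ)‖ = r := by simp [abs_of_nonneg h0]
  have := ySeries_mul_exp_neg (x := r) (by rwa [hn]) (by rwa [hn])
  rw [Phi_ofReal, ySeries_ofReal] at this
  exact_mod_cast this

theorem mul_exp_neg_le (w : ℝ) : w * Real.exp (-w) ≤ Real.exp (-1) := by
  have h := Real.add_one_le_exp (w - 1)
  have : Real.exp (-1) = Real.exp (w - 1) * Real.exp (-w) := by rw [← Real.exp_add]; ring_nf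
  rw [this]
  gcongr
  linarith

/-- Here r e^{h(r)} is a value of w e^{-w}, whose maximum is 1/e. This bounds the radius of
convergence from above without any knowledge of the coefficients. -/
theorem Conv.mul_exp_hReal_le {r : ℝ} (h : Conv r) (h0 : 0 ≤ r) (h1 : r < 1) :
    r * Real.exp (hReal r) ≤ Real.exp (-1) := by
  rw [← yReal_mul_exp_neg h0 h1 h]
  exact mul_exp_neg_le _

theorem Conv.le_exp_neg_one {r : ℝ} (h : Conv r) (h0 : 0 ≤ r) (h1 : r < 1) : r ≤ Real.exp (-1) :=
  (le_mul_of_one_le_right h0 (Real.one_le_exp (hReal_nonneg h0))).trans (h.mul_exp_hReal_le h0 h1)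

-- The radius of convergence and the values of y up to ρ.

/-- The power series `y`. -/
noncomputable def yFMS : FormalMultilinearSeries ℂ ℂ ℂ :=
  FormalMultilinearSeries.ofScalars ℂ fun n : ℕ => (treeCount n : ℂ)

theorem norm_yFMS (n : ℕ) : ‖yFMS n‖ = treeCount n := by
  rw [yFMS, FormalMultilinearSeries.ofScalars_norm]
  simp

theorem conv_of_lt_radius {r : ℝ} (h0 : 0 ≤ r) (h : ENNReal.ofReal r < yFMS.radius) : Conv r := by
  have := yFMS.summable_norm_mul_pow (r := r.toNNReal) h
  simpa only [norm_yFMS, Conv, Real.coe_toNNReal r h0] using this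

theorem Conv.le_radius {r : ℝ} (h : Conv r) (h0 : 0 ≤ r) : ENNReal.ofReal r ≤ yFMS.radius := by
  refine yFMS.le_radius_of_summable (r := r.toNNReal) ?_
  simpa only [norm_yFMS, Conv, Real.coe_toNNReal r h0] using h

theorem radius_le_exp_neg_one : yFMS.radius ≤ ENNReal.ofReal (Real.exp (-1)) := by
  by_contra! hlt
  have he : Real.exp (-1) < 1 := by simp
  obtain ⟨r, hr1, hr2⟩ := ENNReal.lt_iff_exists_nnreal_btwn.1 (lt_min hlt (show
    ENNReal.ofReal (Real.exp (-1)) < ENNReal.ofReal 1 by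
      rw [ENNReal.ofReal_lt_ofReal_iff one_pos]; exact he))
  have hr : (r : ENNReal) = ENNReal.ofReal r := by simp
  rw [hr] at hr1 hr2
  rw [ENNReal.ofReal_lt_ofReal_iff_of_nonneg (Real.exp_pos _).le] at hr1
  have h2 : (r : ℝ) < 1 := by
    have := hr2.trans_le (min_le_right _ _)
    exact (ENNReal.ofReal_lt_ofReal_iff one_pos).1 this
  exact absurd ((conv_of_lt_radius r.2 (hr2.trans_le (min_le_left _ _))).le_exp_neg_one r.2 h2)
    (not_le.2 hr1)

theorem ofReal_rho : ENNReal.ofReal rho = yFMS.radius :=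
  ENNReal.ofReal_toReal (ne_top_of_le_ne_top ENNReal.ofReal_ne_top radius_le_exp_neg_one)

theorem conv_of_lt_rho {r : ℝ} (h0 : 0 ≤ r) (h : r < rho) : Conv r :=
  conv_of_lt_radius h0 (by rwa [← ofReal_rho, ENNReal.ofReal_lt_ofReal_iff (h0.trans_lt h)])

theorem rho_nonneg : 0 ≤ rho := ENNReal.toReal_nonneg

theorem Conv.le_rho {r : ℝ} (h : Conv r) (h0 : 0 ≤ r) : r ≤ rho := by
  have := h.le_radius h0
  rwa [← ofReal_rho, ENNReal.ofReal_le_ofReal_iff rho_nonneg] at this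

theorem rho_pos : 0 < rho := by
  refine (by norm_num : (0 : ℝ) < 1 / 8).trans_le (Conv.le_rho ?_ (by norm_num))
  refine Summable.of_nonneg_of_le (fun n => by positivity) (fun n => ?_)
    (summable_geometric_of_lt_one (r := 1 / 2) (by norm_num) (by norm_num))
  have : (treeCount n : ℝ) ≤ 4 ^ n := by exact_mod_cast treeCount_le n
  calc (treeCount n : ℝ) * (1 / 8) ^ n ≤ 4 ^ n * (1 / 8) ^ n := by gcongr
    _ = (1 / 2) ^ n := by rw [← mul_pow]; norm_num

theorem rho_le_exp_neg_one : rho ≤ Real.exp (-1) := by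
  rw [← ENNReal.ofReal_le_ofReal_iff (Real.exp_pos _).le, ofReal_rho]
  exact radius_le_exp_neg_one

theorem rho_lt : rho < 2 / 5 := by
  refine rho_le_exp_neg_one.trans_lt ?_
  rw [Real.exp_neg, inv_lt_comm₀ (Real.exp_pos _) (by norm_num)]
  exact lt_trans (by norm_num) Real.exp_one_gt_d9

theorem mul_exp_hReal_lt {r s : ℝ} (h0 : 0 ≤ r) (hrs : r < s) (h1 : s < 1) (h : Conv (s ^ 2)) :
    r * Real.exp (hReal r) < s * Real.exp (hReal s) :=
  mul_lt_mul hrs (Real.exp_le_exp.2 (hReal_mono h0 hrs.le h1 h)) (Real.exp_pos _) (h0.trans hrs.le)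

theorem continuousOn_yReal {s : ℝ} (hs : Conv s) : ContinuousOn yReal (Set.Icc 0 s) := by
  refine continuousOn_tsum (fun n => by fun_prop) hs fun n r hr => ?_
  rw [Real.norm_of_nonneg (by have := hr.1; positivity)]
  have h1 := hr.1
  have h2 := hr.2
  gcongr

theorem yReal_zero : yReal 0 = 0 := by
  rw [yReal, tsum_eq_single 0]
  · simp [treeCount_zero]
  · intro n hn; simp [hn]

theorem rho_lt_one : rho < 1 := rho_lt.trans (by norm_num)

/-- If y took the value 1 at some x < ρ, then x e^{h(x)} would already equal 1/e, and the strictly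
increasing function r e^{h(r)} would exceed its bound 1/e slightly to the right of x. -/
theorem yReal_lt_one {r : ℝ} (h0 : 0 ≤ r) (hr : r < rho) : yReal r < 1 := by
  by_contra! hlt
  have hc := continuousOn_yReal (conv_of_lt_rho h0 hr)
  obtain ⟨x, ⟨hx0, hxr⟩, hx⟩ := intermediate_value_Icc h0 hc
    (show (1 : ℝ) ∈ Set.Icc (yReal 0) (yReal r) by rw [yReal_zero]; exact ⟨zero_le_one, hlt⟩)
  obtain ⟨s, hxs, hs⟩ := exists_between (hxr.trans_lt hr)
  have hs0 := hx0.trans hxs.le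
  have hs1 := hs.trans rho_lt_one
  have hcs := conv_of_lt_rho hs0 hs
  have h1 := yReal_mul_exp_neg hx0 (hxs.trans hs1) (conv_of_lt_rho hx0 (hxr.trans_lt hr))
  have h2 := mul_exp_hReal_lt hx0 hxs hs1 (hcs.sq hs0 hs1.le)
  have h3 := hcs.mul_exp_hReal_le hs0 hs1
  rw [← h1, hx, one_mul] at h2
  linarith

/-- The partial sums are at most 1 to the left of ρ, and they are continuous, so the bound persists
at ρ. -/
theorem conv_rho_and : Conv rho ∧ yReal rho ≤ 1 := by
  have key : ∀ N, ∑ n ∈ Finset.range N, (treeCount n : ℝ) * rho ^ n ≤ 1 := fun N => by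
    have hc : Continuous fun r : ℝ => ∑ n ∈ Finset.range N, (treeCount n : ℝ) * r ^ n := by
      fun_prop
    refine le_of_tendsto ((hc.tendsto rho).mono_left (nhdsWithin_le_nhds (s := Set.Iio rho))) ?_
    filter_upwards [Ioo_mem_nhdsLT rho_pos] with r hr
    exact ((conv_of_lt_rho hr.1.le hr.2).sum_le_tsum _ fun n _ => by
      have := hr.1.le; positivity).trans (yReal_lt_one hr.1.le hr.2).le
  have h0 : ∀ n, 0 ≤ (treeCount n : ℝ) * rho ^ n := fun n => by have := rho_pos; positivity
  exact ⟨summable_of_sum_range_le h0 key, Real.tsum_le_of_sum_range_le h0 key⟩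

theorem conv_rho : Conv rho := conv_rho_and.1

theorem yReal_le_div_rho {r : ℝ} (h0 : 0 ≤ r) (h : r ≤ rho) : yReal r ≤ r / rho :=
  (yReal_le_mul conv_rho rho_pos h0 h).trans
    (mul_le_of_le_one_right (div_nonneg h0 rho_nonneg) conv_rho_and.2)

theorem hasFPowerSeries_ySeries :
    HasFPowerSeriesOnBall ySeries yFMS 0 (ENNReal.ofReal rho) := by
  have h : yFMS.sum = ySeries := by
    funext x
    rw [FormalMultilinearSeries.sum, ySeries]
    exact tsum_congr fun n => by simp [yFMS, mul_comm]
  rw [ofReal_rho, ← h]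
  exact yFMS.hasFPowerSeriesOnBall (by rw [← ofReal_rho]; simpa using rho_pos)

theorem differentiableOn_ySeries : DifferentiableOn ℂ ySeries (Metric.ball 0 rho) := by
  have := hasFPowerSeries_ySeries.differentiableOn
  rwa [Metric.eball_ofReal] at this

-- Analyticity of h and Φ in a disc larger than |x| ≤ ρ.

/-- The series `∑_{i ≥ 2} y(x ^ i) / i` is considered for `|x| < √(ρ / 2)`. -/
noncomputable def rhoOne : ℝ := √(rho / 2)

theorem rhoOne_sq : rhoOne ^ 2 = rho / 2 := Real.sq_sqrt (by have := rho_pos; positivity)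

theorem rhoOne_pos : 0 < rhoOne := Real.sqrt_pos.2 (by have := rho_pos; positivity)

/-- This is ρ² < ρ/2, that is ρ < 1/2. -/
theorem rho_lt_rhoOne : rho < rhoOne :=
  Real.lt_sqrt_of_sq_lt (by nlinarith [rho_pos, rho_lt])

theorem rhoOne_lt_one : rhoOne < 1 := by
  have := rhoOne_sq
  nlinarith [rhoOne_pos, rho_lt]

theorem sq_lt_rho {r : ℝ} (h0 : 0 ≤ r) (h : r ≤ rhoOne) : r ^ 2 < rho := by
  have := rhoOne_sq
  have : r ^ 2 ≤ rhoOne ^ 2 := by gcongr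
  linarith [rho_pos]

theorem conv_sq {r : ℝ} (h0 : 0 ≤ r) (h : r ≤ rhoOne) : Conv (r ^ 2) :=
  conv_of_lt_rho (by positivity) (sq_lt_rho h0 h)

theorem norm_pow_add_two_lt {x : ℂ} (hx : ‖x‖ ≤ rhoOne) (i : ℕ) : ‖x ^ (i + 2)‖ < rho := by
  rw [norm_pow]
  exact (pow_le_pow_of_le_one (norm_nonneg _) (hx.trans rhoOne_lt_one.le) (by omega)).trans_lt
    (sq_lt_rho (norm_nonneg _) hx)

theorem differentiableAt_ySeries {x : ℂ} (hx : ‖x‖ < rho) : DifferentiableAt ℂ ySeries x :=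
  (differentiableOn_ySeries x (by simpa using hx)).differentiableAt
    (Metric.isOpen_ball.mem_nhds (by simpa using hx))

theorem hasDerivAt_hSeries_term {x : ℂ} (hx : ‖x‖ < rhoOne) (i : ℕ) :
    HasDerivAt (fun x => ySeries (x ^ (i + 2)) / ((i : ℂ) + 2))
      (x ^ (i + 1) * deriv ySeries (x ^ (i + 2))) x := by
  have h1 := (differentiableAt_ySeries (norm_pow_add_two_lt hx.le i)).hasDerivAt
  have h2 := (h1.comp x (hasDerivAt_pow (i + 2) x)).div_const ((i : ℂ) + 2)
  have h3 : (i : ℂ) + 2 ≠ 0 := by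
    rw [← norm_ne_zero_iff, norm_natCast_add_two]; positivity
  convert! h2 using 1
  field_simp
  push_cast
  ring

theorem differentiableOn_hSeries : DifferentiableOn ℂ hSeries (Metric.ball 0 rhoOne) := by
  refine Complex.differentiableOn_tsum_of_summable_norm
    (summable_hReal rhoOne_pos.le rhoOne_lt_one (conv_sq rhoOne_pos.le le_rfl))
    (fun i x hx => (hasDerivAt_hSeries_term (by simpa using hx)
      i).differentiableAt.differentiableWithinAt) Metric.isOpen_ball fun i x hx => ?_
  have hx : ‖x‖ < rhoOne := by simpa using hx
  refine (norm_hSeries_term_le (hx.trans rhoOne_lt_one).le (conv_sq (norm_nonneg _) hx.le) i).trans ?_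
  gcongr
  exact yReal_mono (conv_pow_add_two rhoOne_pos.le rhoOne_lt_one.le (conv_sq rhoOne_pos.le le_rfl)
    i) (by positivity) (by gcongr)

theorem hasSum_deriv_hSeries {x : ℂ} (hx : ‖x‖ < rhoOne) :
    HasSum (fun i : ℕ => x ^ (i + 1) * deriv ySeries (x ^ (i + 2))) (deriv hSeries x) := by
  have := Complex.hasSum_deriv_of_summable_norm
    (F := fun (i : ℕ) x => ySeries (x ^ (i + 2)) / ((i : ℂ) + 2))
    (summable_hReal rhoOne_pos.le rhoOne_lt_one (conv_sq rhoOne_pos.le le_rfl))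
    (fun i x hx => (hasDerivAt_hSeries_term (by simpa using hx)
      i).differentiableAt.differentiableWithinAt) (Metric.isOpen_ball (x := (0 : ℂ)) (ε := rhoOne))
    (fun i x hx => by
      have hx : ‖x‖ < rhoOne := by simpa using hx
      refine (norm_hSeries_term_le (hx.trans rhoOne_lt_one).le (conv_sq (norm_nonneg _) hx.le)
        i).trans ?_
      gcongr
      exact yReal_mono (conv_pow_add_two rhoOne_pos.le rhoOne_lt_one.le
        (conv_sq rhoOne_pos.le le_rfl) i) (by positivity) (by gcongr)) (z := x) (by simpa using hx)
  simp only [(hasDerivAt_hSeries_term hx _).deriv] at this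
  exact this

theorem differentiableOn_Phi : DifferentiableOn ℂ Phi (Metric.ball 0 rhoOne) :=
  differentiableOn_id.mul differentiableOn_hSeries.cexp

open Filter Topology Asymptotics

/-! ### The solution of `w exp (-w) = z` in the unit disc -/

theorem norm_exp_sub_exp_le {a b : ℂ} {M : ℝ} (ha : a.re ≤ M) (hb : b.re ≤ M) :
    ‖Complex.exp a - Complex.exp b‖ ≤ Real.exp M * ‖a - b‖ := by
  have hconv : Convex ℝ {z : ℂ | z.re ≤ M} := convex_halfSpace_re_le M
  refine hconv.norm_image_sub_le_of_norm_deriv_le (𝕜 := ℂ) (f := Complex.exp)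
    (fun z _ => Complex.differentiableAt_exp) (fun z hz => ?_) hb ha
  rw [Complex.deriv_exp, Complex.norm_exp]
  exact Real.exp_le_exp.2 hz

theorem eq_mul_exp {w z : ℂ} (h : w * Complex.exp (-w) = z) : w = z * Complex.exp w := by
  rw [← h, mul_assoc, ← Complex.exp_add]; simp

/-- Both numbers are fixed points of w ↦ z e^w. If Re b ≤ Re a, the mean value inequality gives |a -
b| ≤ |z| e^{Re a} |a - b| = |a| |a - b|, and |a| < 1. -/
theorem eq_of_mul_exp_neg_eq {a b : ℂ} (ha : ‖a‖ < 1) (hb : ‖b‖ < 1)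
    (h : a * Complex.exp (-a) = b * Complex.exp (-b)) : a = b := by
  wlog hre : b.re ≤ a.re generalizing a b
  · exact (this hb ha h.symm (le_of_not_ge hre)).symm
  set z := b * Complex.exp (-b)
  have h1 : a - b = z * (Complex.exp a - Complex.exp b) := by
    rw [mul_sub, ← eq_mul_exp h, ← eq_mul_exp (rfl : b * Complex.exp (-b) = z)]
  have h2 : ‖z‖ * Real.exp a.re = ‖a‖ := by
    rw [← Complex.norm_exp, ← norm_mul, ← eq_mul_exp h]
  have h3 : ‖a - b‖ ≤ ‖a‖ * ‖a - b‖ := by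
    conv_lhs => rw [h1, norm_mul]
    rw [← h2, mul_assoc]
    gcongr
    exact norm_exp_sub_exp_le le_rfl hre
  have h4 : ‖a - b‖ = 0 := by nlinarith [norm_nonneg (a - b)]
  exact sub_eq_zero.1 (norm_eq_zero.1 h4)

/-- The map w ↦ z e^w sends the closed unit disc into itself and is a contraction there with
constant e|z| < 1. -/
theorem exists_mul_exp_neg_eq {z : ℂ} (hz : ‖z‖ < Real.exp (-1)) :
    ∃ w : ℂ, ‖w‖ < 1 ∧ w * Complex.exp (-w) = z := by
  have hz' : ‖z‖ * Real.exp 1 < 1 := by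
    calc ‖z‖ * Real.exp 1 < Real.exp (-1) * Real.exp 1 := by gcongr
      _ = 1 := by rw [← Real.exp_add]; simp
  have hle : ∀ w : ℂ, ‖w‖ ≤ 1 → ‖z * Complex.exp w‖ ≤ ‖z‖ * Real.exp 1 := fun w hw => by
    rw [norm_mul, Complex.norm_exp]
    gcongr
    exact (Complex.re_le_norm w).trans hw
  let s : Set ℂ := Metric.closedBall 0 1
  have hmaps : Set.MapsTo (fun w => z * Complex.exp w) s s := fun w hw => by
    have hw : ‖w‖ ≤ 1 := by simpa [s] using hw
    simpa [s] using (by simpa using (hle w hw).trans hz'.le : ‖z * Complex.exp w‖ ≤ 1)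
  let K : NNReal := ⟨‖z‖ * Real.exp 1, by positivity⟩
  have hc : ContractingWith K (hmaps.restrict _ s s) := by
    refine ⟨by exact_mod_cast hz', LipschitzWith.of_dist_le_mul ?_⟩
    rintro ⟨a, ha⟩ ⟨b, hb⟩
    have ha : ‖a‖ ≤ 1 := by simpa [s] using ha
    have hb : ‖b‖ ≤ 1 := by simpa [s] using hb
    simp only [Subtype.dist_eq, Set.MapsTo.val_restrict_apply, dist_eq_norm, ← mul_sub, norm_mul]
    change _ ≤ ‖z‖ * Real.exp 1 * _
    rw [mul_assoc]
    gcongr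
    exact norm_exp_sub_exp_le ((Complex.re_le_norm a).trans ha) ((Complex.re_le_norm b).trans hb)
  obtain ⟨w, hws, hw, -⟩ := hc.exists_fixedPoint' (Metric.isClosed_closedBall.isComplete) hmaps
    (x := 0) (by simp [s]) (edist_ne_top _ _)
  have hws : ‖w‖ ≤ 1 := by simpa [s] using hws
  have hw : z * Complex.exp w = w := hw
  refine ⟨w, ?_, ?_⟩
  · rw [← hw]
    exact (hle w hws).trans_lt hz'
  · conv_lhs => enter [1]; rw [← hw]
    rw [mul_assoc, ← Complex.exp_add]; simp

/-- The solution `w` of `w exp (-w) = z` in the unit disc, for `|z| < 1 / e`. -/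
noncomputable def treeFun (z : ℂ) : ℂ :=
  open Classical in
  if h : ‖z‖ < Real.exp (-1) then (exists_mul_exp_neg_eq h).choose else 0

theorem norm_treeFun {z : ℂ} (hz : ‖z‖ < Real.exp (-1)) : ‖treeFun z‖ < 1 := by
  rw [treeFun, dif_pos hz]
  exact (exists_mul_exp_neg_eq hz).choose_spec.1

theorem treeFun_spec {z : ℂ} (hz : ‖z‖ < Real.exp (-1)) :
    treeFun z * Complex.exp (-treeFun z) = z := by
  rw [treeFun, dif_pos hz]
  exact (exists_mul_exp_neg_eq hz).choose_spec.2

theorem treeFun_eq {w z : ℂ} (hz : ‖z‖ < Real.exp (-1)) (hw : ‖w‖ < 1)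
    (h : w * Complex.exp (-w) = z) : treeFun z = w :=
  eq_of_mul_exp_neg_eq (norm_treeFun hz) hw ((treeFun_spec hz).trans h.symm)

theorem continuousAt_treeFun {z : ℂ} (hz : ‖z‖ < Real.exp (-1)) : ContinuousAt treeFun z := by
  have hz' : ‖z‖ * Real.exp 1 < 1 := by
    calc ‖z‖ * Real.exp 1 < Real.exp (-1) * Real.exp 1 := by gcongr
      _ = 1 := by rw [← Real.exp_add]; simp
  set q := ‖z‖ * Real.exp 1
  have hlip : ∀ᶠ a in 𝓝 z, dist (treeFun a) (treeFun z)
      ≤ Real.exp 1 / (1 - q) * dist a z := by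
    filter_upwards [(continuous_norm.tendsto z).eventually_lt_const hz] with a ha
    rw [dist_eq_norm, dist_eq_norm, div_mul_eq_mul_div, le_div_iff₀ (by linarith)]
    have h1 := eq_mul_exp (treeFun_spec ha)
    have h2 := eq_mul_exp (treeFun_spec hz)
    have h3 : treeFun a - treeFun z = (a - z) * Complex.exp (treeFun a)
        + z * (Complex.exp (treeFun a) - Complex.exp (treeFun z)) := by
      conv_lhs => rw [h1, h2]
      ring
    have r1 := (Complex.re_le_norm _).trans (norm_treeFun ha).le
    have r2 := (Complex.re_le_norm _).trans (norm_treeFun hz).le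
    have h4 : ‖treeFun a - treeFun z‖ ≤ ‖a - z‖ * Real.exp 1
        + ‖z‖ * (Real.exp 1 * ‖treeFun a - treeFun z‖) := by
      conv_lhs => rw [h3]
      refine (norm_add_le _ _).trans ?_
      rw [norm_mul, norm_mul, Complex.norm_exp]
      gcongr
      exact norm_exp_sub_exp_le r1 r2
    simp only [q]
    linarith
  refine tendsto_iff_dist_tendsto_zero.2 (squeeze_zero' (Eventually.of_forall fun _ => dist_nonneg)
    hlip ?_)
  have : Tendsto (fun a => Real.exp 1 / (1 - q) * dist a z) (𝓝 z)
      (𝓝 (Real.exp 1 / (1 - q) * dist z z)) := (by fun_prop : Continuous fun a =>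
        Real.exp 1 / (1 - q) * dist a z).tendsto z
  simpa using this

theorem hasDerivAt_mul_exp_neg (w : ℂ) :
    HasDerivAt (fun w : ℂ => w * Complex.exp (-w)) ((1 - w) * Complex.exp (-w)) w := by
  convert! (hasDerivAt_id w).mul ((hasDerivAt_id w).neg.cexp) using 1
  simp; ring

theorem differentiableAt_treeFun {z : ℂ} (hz : ‖z‖ < Real.exp (-1)) :
    DifferentiableAt ℂ treeFun z := by
  refine (HasDerivAt.of_local_left_inverse (continuousAt_treeFun hz)
    (hasDerivAt_mul_exp_neg (treeFun z)) ?_ ?_).differentiableAt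
  · refine mul_ne_zero (fun h => ?_) (Complex.exp_ne_zero _)
    have := norm_treeFun hz
    rw [← sub_eq_zero.1 h] at this
    simp at this
  · filter_upwards [(continuous_norm.tendsto z).eventually_lt_const hz] with a ha
    exact treeFun_spec ha

/-! ### The value of `y` at `ρ` -/

theorem differentiableAt_Phi {x : ℂ} (hx : ‖x‖ < rhoOne) : DifferentiableAt ℂ Phi x :=
  (differentiableOn_Phi x (by simpa using hx)).differentiableAt
    (Metric.isOpen_ball.mem_nhds (by simpa using hx))

theorem norm_Phi_lt_of_lt {x : ℂ} (hx : ‖x‖ < rho) : ‖Phi x‖ < Real.exp (-1) := by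
  have h1 := norm_Phi_le (hx.trans rho_lt_one) (conv_sq (norm_nonneg x) (hx.trans rho_lt_rhoOne).le)
  obtain ⟨s, hs1, hs2⟩ := exists_between hx
  have hs0 := (norm_nonneg x).trans hs1.le
  have h2 := mul_exp_hReal_lt (norm_nonneg x) hs1 (hs2.trans rho_lt_one)
    (conv_sq hs0 (hs2.trans rho_lt_rhoOne).le)
  exact h1.trans_lt (h2.trans_le
    ((conv_of_lt_rho hs0 hs2).mul_exp_hReal_le hs0 (hs2.trans rho_lt_one)))

theorem norm_ySeries_lt_one {x : ℂ} (hx : ‖x‖ < rho) : ‖ySeries x‖ < 1 :=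
  (norm_ySeries_le (conv_of_lt_rho (norm_nonneg x) hx)).trans_lt (yReal_lt_one (norm_nonneg x) hx)

theorem treeFun_Phi {x : ℂ} (hx : ‖x‖ < rho) : treeFun (Phi x) = ySeries x :=
  treeFun_eq (norm_Phi_lt_of_lt hx) (norm_ySeries_lt_one hx)
    (ySeries_mul_exp_neg (hx.trans rho_lt_one) (conv_of_lt_rho (norm_nonneg x) hx))

/-- If the value were below 1/e, then |Φ| < 1/e would hold on a disc of some radius s > ρ, because
|Φ(x)| is at most its majorant at |x|. There `treeFun` ∘ Φ is analytic and extends y, so the power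
series of y would have radius at least s. -/
theorem rho_mul_exp_hReal : rho * Real.exp (hReal rho) = Real.exp (-1) := by
  refine le_antisymm (conv_rho.mul_exp_hReal_le rho_nonneg rho_lt_one) ?_
  by_contra! hlt
  have hnorm : ‖(rho : ℂ)‖ = rho := by simp [abs_of_nonneg rho_nonneg]
  have hcont : ContinuousAt (fun r : ℝ => ‖Phi r‖) rho :=
    ((differentiableAt_Phi (x := (rho : ℂ)) (by rw [hnorm]; exact rho_lt_rhoOne)).continuousAt.comp
      Complex.continuous_ofReal.continuousAt).norm
  have hval : ∀ r : ℝ, 0 ≤ r → ‖Phi r‖ = r * Real.exp (hReal r) := fun r hr => by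
    rw [Phi_ofReal, Complex.norm_real, Real.norm_of_nonneg (by positivity)]
  have hev : ∀ᶠ r : ℝ in 𝓝[>] rho, ‖Phi r‖ < Real.exp (-1) :=
    (hcont.tendsto.eventually_lt_const (show ‖Phi rho‖ < Real.exp (-1) by
      rwa [hval _ rho_nonneg])).filter_mono nhdsWithin_le_nhds
  obtain ⟨s, hs, hs1, hs2⟩ := (hev.and (Ioo_mem_nhdsGT rho_lt_rhoOne)).exists
  have hs0 : 0 < s := rho_pos.trans hs1
  rw [hval s hs0.le] at hs
  have hlt : ∀ x : ℂ, ‖x‖ ≤ s → ‖Phi x‖ < Real.exp (-1) := fun x hx => by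
    refine (norm_Phi_le (hx.trans_lt (hs2.trans rhoOne_lt_one))
      (conv_sq (norm_nonneg _) (hx.trans hs2.le))).trans_lt (lt_of_le_of_lt ?_ hs)
    gcongr
    exact hReal_mono (norm_nonneg _) hx (hs2.trans rhoOne_lt_one) (conv_sq hs0.le hs2.le)
  have hd : DifferentiableOn ℂ (fun x => treeFun (Phi x)) (Metric.closedBall 0 s) := fun x hx => by
    have hx : ‖x‖ ≤ s := by simpa using hx
    exact ((differentiableAt_treeFun (hlt x hx)).comp x
      (differentiableAt_Phi (hx.trans_lt hs2))).differentiableWithinAt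
  have hp := DifferentiableOn.hasFPowerSeriesOnBall (R := ⟨s, hs0.le⟩) hd hs0
  have heq : (fun x => treeFun (Phi x)) =ᶠ[𝓝 0] ySeries := by
    filter_upwards [Metric.ball_mem_nhds (0 : ℂ) rho_pos] with x hx
    exact treeFun_Phi (by simpa using hx)
  have h3 := (hp.hasFPowerSeriesAt.congr heq).eq_formalMultilinearSeries
    hasFPowerSeries_ySeries.hasFPowerSeriesAt
  have h4 := hp.r_le
  rw [h3, ← ofReal_rho] at h4
  have h5 : ENNReal.ofReal s ≤ ENNReal.ofReal rho := by
    rwa [ENNReal.ofReal_eq_coe_nnreal hs0.le]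
  rw [ENNReal.ofReal_le_ofReal_iff rho_nonneg] at h5
  linarith

/-- The linear term alone makes the inequality strict, since y_1 > 0. -/
theorem re_ySeries_lt {x : ℂ} (hx : Conv ‖x‖) (h : x ≠ (‖x‖ : ℂ)) : (ySeries x).re < yReal ‖x‖ := by
  rw [ySeries, Complex.re_tsum hx.summable]
  refine Summable.tsum_lt_tsum (i := 1) (fun n => ?_) ?_ (Complex.reCLM.summable hx.summable) hx
  · exact (Complex.re_le_norm _).trans (norm_ySeries_term n x).le
  · have h1 : x.re < ‖x‖ := lt_of_le_of_ne (Complex.re_le_norm x) fun h2 => h <| by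
      have := Complex.re_eq_norm.1 h2
      exact Complex.eq_coe_norm_of_nonneg this
    have h3 : (0 : ℝ) < treeCount 1 := by exact_mod_cast treeCount_one_pos
    simpa using mul_lt_mul_of_pos_left h1 h3

/-- On the circle |x| = ρ, Re h(x) can reach h(ρ) only if every power x^i with i ≥ 2 is a positive
real; then x² = ρ² and x³ = ρ³ give x = ρ. -/
theorem norm_Phi_lt {x : ℂ} (hx : ‖x‖ ≤ rho) (hne : x ≠ rho) : ‖Phi x‖ < Real.exp (-1) := by
  rcases hx.lt_or_eq with h | h
  · exact norm_Phi_lt_of_lt h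
  have hx1 : ‖x‖ < 1 := hx.trans_lt rho_lt_one
  have hc := conv_sq (norm_nonneg x) (hx.trans rho_lt_rhoOne.le)
  have hs := summable_hSeries hx1 hc
  have hsR := summable_hReal (norm_nonneg x) hx1 hc
  rw [Phi, norm_mul, Complex.norm_exp, ← rho_mul_exp_hReal, ← h]
  refine mul_lt_mul_of_pos_left (Real.exp_lt_exp.2 ?_) (h ▸ rho_pos)
  obtain ⟨i, hi⟩ : ∃ i : ℕ, x ^ (i + 2) ≠ (‖x ^ (i + 2)‖ : ℂ) := by
    by_contra! hall
    have h2 := hall 0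
    have h3 := hall 1
    simp only [norm_pow, h] at h2 h3
    push_cast at h2 h3
    have h4 : (rho : ℂ) ≠ 0 := by exact_mod_cast rho_pos.ne'
    apply hne
    have h5 : x * rho ^ 2 = rho * rho ^ 2 := by
      rw [← h2]
      linear_combination h3 - rho * h2
    exact mul_right_cancel₀ (pow_ne_zero 2 h4) h5
  rw [hSeries, Complex.re_tsum hs]
  refine Summable.tsum_lt_tsum (i := i) (fun n => ?_) ?_ (Complex.reCLM.summable hs) hsR
  · exact (Complex.re_le_norm _).trans (norm_hSeries_term_le hx1.le hc n)
  · have h6 : (ySeries (x ^ (i + 2)) / ((i : ℂ) + 2)).re = (ySeries (x ^ (i + 2))).re / (i + 2) := by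
      rw [show (i : ℂ) + 2 = ((i + 2 : ℝ) : ℂ) by push_cast; ring, Complex.div_ofReal_re]
    rw [h6, ← norm_pow]
    gcongr
    refine re_ySeries_lt ?_ hi
    rw [norm_pow]
    exact conv_pow_add_two (norm_nonneg x) hx1.le hc i

/-! ### The complex square root -/

theorem csqrt_sq (z : ℂ) : csqrt z ^ 2 = z := by
  rw [csqrt, ← Complex.cpow_nat_mul]; simp

theorem csqrt_zero : csqrt 0 = 0 := by simp [csqrt]

theorem csqrt_ne_zero {z : ℂ} (h : z ≠ 0) : csqrt z ≠ 0 := fun h0 => h <| by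
  rw [← csqrt_sq z, h0]; simp

theorem norm_csqrt_sq (z : ℂ) : ‖csqrt z‖ ^ 2 = ‖z‖ := by rw [← norm_pow, csqrt_sq]

theorem norm_csqrt (z : ℂ) : ‖csqrt z‖ = √‖z‖ := by
  rw [← norm_csqrt_sq z, Real.sqrt_sq (norm_nonneg _)]

theorem csqrt_eq_exp {z : ℂ} (hz : z ≠ 0) :
    csqrt z = (√‖z‖ : ℝ) * Complex.exp ((z.arg / 2 : ℝ) * Complex.I) := by
  have h : (√‖z‖ : ℝ) = Real.exp (Real.log ‖z‖ / 2) := by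
    rw [← Real.log_sqrt (norm_nonneg z), Real.exp_log (Real.sqrt_pos.2 (norm_pos_iff.2 hz))]
  rw [csqrt, Complex.cpow_def_of_ne_zero hz, h, Complex.ofReal_exp, ← Complex.exp_add, Complex.log]
  congr 1
  push_cast
  ring

theorem re_csqrt (z : ℂ) : (csqrt z).re = √‖z‖ * Real.cos (z.arg / 2) := by
  rcases eq_or_ne z 0 with rfl | hz
  · simp [csqrt_zero]
  rw [csqrt_eq_exp hz, Complex.re_ofReal_mul, Complex.exp_ofReal_mul_I_re]

theorem re_csqrt_nonneg (z : ℂ) : 0 ≤ (csqrt z).re := by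
  rw [re_csqrt]
  refine mul_nonneg (Real.sqrt_nonneg _) (Real.cos_nonneg_of_mem_Icc ⟨?_, ?_⟩)
  · linarith [Complex.neg_pi_lt_arg z]
  · linarith [Complex.arg_le_pi z]

theorem csqrt_ofReal_mul {a : ℝ} (ha : 0 ≤ a) (z : ℂ) : csqrt (a * z) = (√a : ℝ) * csqrt z := by
  rcases ha.eq_or_lt with rfl | ha
  · simp [csqrt_zero]
  rcases eq_or_ne z 0 with rfl | hz
  · simp [csqrt_zero]
  rw [csqrt_eq_exp hz, csqrt_eq_exp (mul_ne_zero (by exact_mod_cast ha.ne') hz),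
    Complex.arg_real_mul z ha, norm_mul, Complex.norm_real, Real.norm_of_nonneg ha.le,
    Real.sqrt_mul ha.le]
  push_cast
  ring

theorem csqrt_ofReal_sq {a : ℝ} (ha : 0 ≤ a) : csqrt ((a : ℂ) ^ 2) = a := by
  have h1 : csqrt 1 = 1 := by simp [csqrt]
  have := csqrt_ofReal_mul (sq_nonneg a) 1
  rw [mul_one, h1, Real.sqrt_sq ha, mul_one] at this
  simpa using this

theorem differentiableAt_csqrt {z : ℂ} (hz : z ∈ Complex.slitPlane) :
    DifferentiableAt ℂ csqrt z :=
  differentiableAt_id.cpow (differentiableAt_const _) hz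

theorem tendsto_csqrt_zero : Tendsto csqrt (𝓝 0) (𝓝 0) := by
  rw [tendsto_zero_iff_norm_tendsto_zero]
  simp_rw [norm_csqrt]
  have : Continuous fun z : ℂ => √‖z‖ := by fun_prop
  simpa using this.tendsto 0

/-! ### The branch point of the inverse of `w exp (-w)` -/

theorem isBigO_sub_linear {f : ℂ → ℂ} {a : ℂ} (hf : ∀ᶠ z in 𝓝 a, DifferentiableAt ℂ f z) :
    (fun z => f z - f a - deriv f a * (z - a)) =O[𝓝 a] fun z => (z - a) ^ 2 := by
  obtain ⟨U, hU, hUo, haU⟩ := eventually_nhds_iff.1 hf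
  have hd : DifferentiableOn ℂ (dslope f a) U := (Complex.differentiableOn_dslope
    (hUo.mem_nhds haU)).2 fun z hz => (hU z hz).differentiableWithinAt
  have h1 := ((hd a haU).differentiableAt (hUo.mem_nhds haU)).isBigO_sub
  refine ((isBigO_refl (fun z => z - a) (𝓝 a)).mul h1).congr (fun z => ?_) fun z => by ring
  rw [mul_sub, ← smul_eq_mul, sub_smul_dslope, dslope_same]
  ring

/-- The function 1 - (1 - v)e^v has derivative v e^v, hence a double zero at 0, and two divided
differences produce an entire cofactor. -/
theorem exists_sq_factor : ∃ g : ℂ → ℂ, Differentiable ℂ g ∧ g 0 = 1 ∧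
    ∀ v, (1 - v) * Complex.exp v = 1 - v ^ 2 * g v / 2 := by
  let K : ℂ → ℂ := fun v => 1 - (1 - v) * Complex.exp v
  have hK : ∀ v, HasDerivAt K (v * Complex.exp v) v := fun v => by
    convert! (((hasDerivAt_id v).const_sub 1).mul (Complex.hasDerivAt_exp v)).const_sub 1 using 1
    simp; ring
  have hKd : Differentiable ℂ K := fun v => (hK v).differentiableAt
  have h1 : Differentiable ℂ (dslope K 0) := by
    rw [← differentiableOn_univ]
    exact (Complex.differentiableOn_dslope univ_mem).2 hKd.differentiableOn
  have h2 : Differentiable ℂ (dslope (dslope K 0) 0) := by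
    rw [← differentiableOn_univ]
    exact (Complex.differentiableOn_dslope univ_mem).2 h1.differentiableOn
  have h10 : dslope K 0 0 = 0 := by rw [dslope_same, (hK 0).deriv]; simp
  have e1 : ∀ v, K v = v * dslope K 0 v := fun v => by
    have := sub_smul_dslope K 0 v
    simp only [sub_zero, smul_eq_mul] at this
    rw [this]; simp [K]
  have e2 : ∀ v, dslope K 0 v = v * dslope (dslope K 0) 0 v := fun v => by
    have := sub_smul_dslope (dslope K 0) 0 v
    simp only [sub_zero, smul_eq_mul, h10] at this
    exact this.symm
  -- Dividing K' = v e^v by v gives this identity away from 0; continuity extends it to 0, where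
  -- both summands agree and therefore equal 1/2.
  have h3 : ∀ v : ℂ, v ≠ 0 → dslope (dslope K 0) 0 v + deriv (dslope K 0) v = Complex.exp v :=
    fun v hv => by
      have hd : HasDerivAt K (1 * dslope K 0 v + v * deriv (dslope K 0) v) v :=
        ((hasDerivAt_id v).mul (h1 v).hasDerivAt).congr_of_eventuallyEq
          (Eventually.of_forall e1)
      have := hd.unique (hK v)
      rw [e2 v] at this
      apply mul_left_cancel₀ hv
      linear_combination this
  have h4 : Continuous fun v => dslope (dslope K 0) 0 v + deriv (dslope K 0) v :=
    h2.continuous.add (h1.contDiff (n := 1)).continuous_deriv_one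
  have h5 : (fun v => dslope (dslope K 0) 0 v + deriv (dslope K 0) v) = Complex.exp := by
    refine h4.ext_on (dense_compl_singleton (0 : ℂ)) Complex.continuous_exp fun v hv => h3 v hv
  have h6 : 2 * dslope (dslope K 0) 0 0 = 1 := by
    have := congrFun h5 0
    simp only [Complex.exp_zero] at this
    rw [← dslope_same (dslope K 0) 0] at this
    linear_combination this
  refine ⟨fun v => 2 * dslope (dslope K 0) 0 v, h2.const_mul 2, h6, fun v => ?_⟩
  have h7 := e1 v
  rw [e2 v] at h7
  simp only [K] at h7
  linear_combination -h7

/-- With w = 1 - v one has w e^{-w} = e^{-1}(1 - v)e^v. The inverse V of v ↦ v√g(v) turns this into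
e^{-1}(1 - ζ²/2), which resolves the branch point w = 1. -/
theorem exists_local_inverse : ∃ V : ℂ → ℂ, V 0 = 0 ∧ deriv V 0 = 1 ∧
    (∀ᶠ ζ in 𝓝 0, DifferentiableAt ℂ V ζ) ∧
    ∀ᶠ ζ in 𝓝 0, (1 - V ζ) * Complex.exp (V ζ) = 1 - ζ ^ 2 / 2 := by
  obtain ⟨g, hg, hg0, hgv⟩ := exists_sq_factor
  let ψ : ℂ → ℂ := fun v => v * csqrt (g v)
  have hslit : ∀ᶠ v in 𝓝 0, g v ∈ Complex.slitPlane :=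
    (hg.continuous.tendsto 0).eventually_mem (Complex.isOpen_slitPlane.mem_nhds (by simp [hg0]))
  have hψd : ∀ᶠ v in 𝓝 0, DifferentiableAt ℂ ψ v := by
    filter_upwards [hslit] with v hv
    exact differentiableAt_id.mul ((differentiableAt_csqrt hv).comp v (hg v))
  have hψ' : HasDerivAt ψ 1 0 := by
    have := (hasDerivAt_id (0 : ℂ)).mul ((differentiableAt_csqrt (z := g 0)
      (by simp [hg0])).comp (0 : ℂ) (hg 0)).hasDerivAt
    convert! this using 1
    simp [hg0, csqrt]
  have han : AnalyticAt ℂ ψ 0 := Complex.analyticAt_iff_eventually_differentiableAt.2 hψd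
  have hcd : ContDiffAt ℂ 1 ψ 0 := han.contDiffAt
  have hF : HasFDerivAt ψ (ContinuousLinearEquiv.refl ℂ ℂ : ℂ →L[ℂ] ℂ) 0 := by
    convert! hψ'.hasFDerivAt using 1
    ext; simp
  have hψ0 : ψ 0 = 0 := by simp [ψ]
  let V := hcd.localInverse hF one_ne_zero
  have hV0 : V 0 = 0 := by
    have := hcd.localInverse_apply_image hF one_ne_zero
    rwa [hψ0] at this
  have hVc : ContDiffAt ℂ 1 V 0 := by
    have := hcd.to_localInverse hF one_ne_zero
    rwa [hψ0] at this
  have hstrict := hcd.hasStrictFDerivAt' hF one_ne_zero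
  have hright : ∀ᶠ ζ in 𝓝 0, ψ (V ζ) = ζ := by
    have := hstrict.eventually_right_inverse
    rwa [hψ0] at this
  have hVd : ∀ᶠ ζ in 𝓝 0, DifferentiableAt ℂ V ζ :=
    (hVc.eventually (by simp)).mono fun ζ h => h.differentiableAt one_ne_zero
  refine ⟨V, hV0, ?_, hVd, ?_⟩
  · have h1 : HasDerivAt V (deriv V 0) 0 := hVd.self_of_nhds.hasDerivAt
    have h2 : HasDerivAt (fun ζ => ψ (V ζ)) (1 * deriv V 0) 0 :=
      HasDerivAt.comp (h₂ := ψ) (0 : ℂ) (by rwa [hV0]) h1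
    have h3 := h2.unique ((hasDerivAt_id (0 : ℂ)).congr_of_eventuallyEq hright)
    simpa using h3
  · filter_upwards [hright] with ζ hζ
    rw [hgv]
    have : ζ ^ 2 = V ζ ^ 2 * g (V ζ) := by
      conv_lhs => rw [← hζ]
      simp only [ψ, mul_pow, csqrt_sq]
    rw [this]

/-! ### The continuation of `y` -/

/-- The derivative of `∑_{i ≥ 2} y(x ^ i) / i` at `ρ`. -/
noncomputable def hDeriv : ℝ := (deriv hSeries rho).re

theorem norm_rho : ‖(rho : ℂ)‖ = rho := by simp [abs_of_nonneg rho_nonneg]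

theorem differentiableAt_hSeries {x : ℂ} (hx : ‖x‖ < rhoOne) : DifferentiableAt ℂ hSeries x :=
  (differentiableOn_hSeries x (by simpa using hx)).differentiableAt
    (Metric.isOpen_ball.mem_nhds (by simpa using hx))

theorem hasDerivAt_hSeries_rho : HasDerivAt hSeries (deriv hSeries rho) rho :=
  (differentiableAt_hSeries (by rw [norm_rho]; exact rho_lt_rhoOne)).hasDerivAt

theorem deriv_hSeries_rho : deriv hSeries rho = hDeriv := by
  refine Complex.ext rfl ?_
  rw [Complex.ofReal_im]
  have h1 : HasDerivAt (fun r : ℝ => hSeries r) (deriv hSeries rho) rho :=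
    hasDerivAt_hSeries_rho.comp_ofReal
  have h2 := Complex.imCLM.hasFDerivAt.comp_hasDerivAt rho h1
  have h3 : (Complex.imCLM ∘ fun r : ℝ => hSeries r) = fun _ => (0 : ℝ) := by
    funext r
    simp [hSeries_ofReal]
  rw [h3] at h2
  simpa using h2.unique (hasDerivAt_const rho (0 : ℝ))

theorem hDeriv_nonneg : 0 ≤ hDeriv := by
  have h1 : HasDerivAt (fun r : ℝ => hSeries r) (deriv hSeries rho) rho :=
    hasDerivAt_hSeries_rho.comp_ofReal
  have h2 : HasDerivAt hReal hDeriv rho := by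
    have := Complex.reCLM.hasFDerivAt.comp_hasDerivAt rho h1
    convert! this using 1
    funext r
    simp [hSeries_ofReal]
  refine ge_of_tendsto ((hasDerivAt_iff_tendsto_slope.1 h2).mono_left
    (nhdsWithin_mono rho (s := Set.Ioi rho) fun r hr => ne_of_gt hr)) ?_
  filter_upwards [Ioo_mem_nhdsGT rho_lt_rhoOne] with r hr
  rw [slope_def_field]
  exact div_nonneg (sub_nonneg.2 (hReal_mono rho_nonneg hr.1.le (hr.2.trans rhoOne_lt_one)
    (conv_sq (rho_nonneg.trans hr.1.le) hr.2.le))) (sub_nonneg.2 hr.1.le)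

/-- The constant `b` in `y(x) = 1 - b √(ρ - x) + O(ρ - x)`. -/
noncomputable def bConst : ℝ := √(2 * (1 / rho + hDeriv))

theorem bConst_sq : bConst ^ 2 = 2 * (1 / rho + hDeriv) :=
  Real.sq_sqrt (by have := rho_pos; have := hDeriv_nonneg; positivity)

theorem bConst_pos : 0 < bConst :=
  Real.sqrt_pos.2 (by have := rho_pos; have := hDeriv_nonneg; positivity)

theorem Phi_rho : Phi rho = Real.exp (-1) := by
  rw [Phi_ofReal, rho_mul_exp_hReal]

/-- Φ'/Φ = 1/x + h', which is b²/2 at ρ, and Φ(ρ) = 1/e. This is where the constant b is fixed. -/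
theorem hasDerivAt_Phi_rho :
    HasDerivAt Phi ((bConst ^ 2 / 2 * Real.exp (-1) : ℝ) : ℂ) rho := by
  have h := (hasDerivAt_id (rho : ℂ)).mul hasDerivAt_hSeries_rho.cexp
  convert! h using 1
  have h1 : Complex.exp (hSeries rho) = ((Real.exp (-1) / rho : ℝ) : ℂ) := by
    rw [hSeries_ofReal, ← Complex.ofReal_exp, ← rho_mul_exp_hReal,
      mul_div_cancel_left₀ _ rho_pos.ne']
  rw [deriv_hSeries_rho, h1, bConst_sq]
  have : (rho : ℂ) ≠ 0 := by exact_mod_cast rho_pos.ne'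
  push_cast
  simp only [id]
  field_simp

theorem mem_slitPlane_sub_iff {x a : ℂ} :
    a - x ∈ Complex.slitPlane ↔ Complex.arg (x - a) ≠ 0 := by
  rw [Ne, Complex.arg_eq_zero_iff, Complex.mem_slitPlane_iff]
  simp only [Complex.sub_re, Complex.sub_im, not_and_or, not_le, sub_pos, sub_neg]
  refine or_congr Iff.rfl (not_congr ⟨fun h => by linarith, fun h => by linarith⟩)

/-- The local form of the continuation of `y` at `ρ`. -/
theorem exists_local_continuation : ∃ Z : ℂ → ℂ,
    (∀ᶠ x in 𝓝 (rho : ℂ), Z x * Complex.exp (-Z x) = Phi x) ∧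
    (∀ᶠ x in 𝓝 (rho : ℂ), (rho : ℂ) - x ∈ Complex.slitPlane → DifferentiableAt ℂ Z x) ∧
    (∀ᶠ x in 𝓝 (rho : ℂ), ‖Phi x‖ < Real.exp (-1) → (Z x).re ≤ 1) ∧
    (fun x => Z x - (1 - bConst * csqrt (rho - x))) =O[𝓝 (rho : ℂ)] fun x => (rho : ℂ) - x := by
  obtain ⟨V, hV0, hV', hVd, hV⟩ := exists_local_inverse
  have he : (Real.exp 1 : ℂ) * Real.exp (-1) = 1 := by
    rw [← Complex.ofReal_mul, ← Real.exp_add]; simp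
  -- Chosen so that Φ = e^{-1}(1 - A/2); the solution is then 1 - V(ζ) with ζ² = A.
  let A : ℂ → ℂ := fun x => 2 * (1 - Real.exp 1 * Phi x)
  have hA0 : A rho = 0 := by simp only [A, Phi_rho, he]; ring
  have hrho1 : ‖(rho : ℂ)‖ < rhoOne := by rw [norm_rho]; exact rho_lt_rhoOne
  have hball : ∀ᶠ x in 𝓝 (rho : ℂ), ‖x‖ < rhoOne :=
    (continuous_norm.tendsto _).eventually_lt_const hrho1
  have hAd : ∀ᶠ x in 𝓝 (rho : ℂ), DifferentiableAt ℂ A x := by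
    filter_upwards [hball] with x hx
    exact (((differentiableAt_Phi hx).const_mul _).const_sub 1).const_mul 2
  have hA' : deriv A rho = -(bConst : ℂ) ^ 2 := by
    have := (((hasDerivAt_Phi_rho.const_mul (Real.exp 1 : ℂ)).const_sub 1).const_mul 2).deriv
    rw [this]
    push_cast at he ⊢
    linear_combination -(bConst : ℂ) ^ 2 * he
  let B : ℂ → ℂ := fun x => -dslope A rho x
  have hAB : ∀ x, A x = (rho - x) * B x := fun x => by
    have := sub_smul_dslope A rho x
    rw [hA0, sub_zero, smul_eq_mul] at this
    rw [← this]; ring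
  have hB0 : B rho = (bConst : ℂ) ^ 2 := by simp only [B, dslope_same, hA', neg_neg]
  have hBd : ∀ᶠ x in 𝓝 (rho : ℂ), DifferentiableAt ℂ B x := by
    obtain ⟨U, hU, hUo, haU⟩ := eventually_nhds_iff.1 hAd
    have hd : DifferentiableOn ℂ (dslope A rho) U := (Complex.differentiableOn_dslope
      (hUo.mem_nhds haU)).2 fun z hz => (hU z hz).differentiableWithinAt
    filter_upwards [hUo.mem_nhds haU] with x hx
    exact ((hd x hx).differentiableAt (hUo.mem_nhds hx)).neg
  have hBslit : ∀ᶠ x in 𝓝 (rho : ℂ), B x ∈ Complex.slitPlane := by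
    refine hBd.self_of_nhds.continuousAt.eventually_mem (Complex.isOpen_slitPlane.mem_nhds ?_)
    rw [hB0, ← Complex.ofReal_pow]
    exact Complex.ofReal_mem_slitPlane.2 (by have := bConst_pos; positivity)
  have hCd : ∀ᶠ x in 𝓝 (rho : ℂ), DifferentiableAt ℂ (fun x => csqrt (B x)) x := by
    filter_upwards [hBd, hBslit] with x h1 h2
    exact (differentiableAt_csqrt h2).comp x h1
  have hC0 : csqrt (B rho) = bConst := by rw [hB0, csqrt_ofReal_sq bConst_pos.le]
  -- The root of A = (ρ - x)B is split into two factors: B stays near b² > 0, so only √(ρ - x) has a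
  -- cut, and it lies along the slit.
  let S : ℂ → ℂ := fun x => csqrt (rho - x) * csqrt (B x)
  have hSA : ∀ x, S x ^ 2 = A x := fun x => by
    simp only [S, mul_pow, csqrt_sq, hAB]
  have hα0 : Tendsto (fun x : ℂ => csqrt (rho - x)) (𝓝 (rho : ℂ)) (𝓝 0) := by
    refine tendsto_csqrt_zero.comp ?_
    have : Continuous fun x : ℂ => (rho : ℂ) - x := by fun_prop
    simpa using this.tendsto (rho : ℂ)
  have hS0 : Tendsto S (𝓝 (rho : ℂ)) (𝓝 0) := by
    simpa using hα0.mul hCd.self_of_nhds.continuousAt.tendsto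
  have hVS : (fun x => V (S x) - S x) =O[𝓝 (rho : ℂ)] fun x => (rho : ℂ) - x := by
    have h1 := (isBigO_sub_linear hVd).comp_tendsto hS0
    simp only [hV0, hV', Function.comp_def, sub_zero, one_mul, hSA, hAB] at h1
    refine h1.trans ?_
    have h2 : B =O[𝓝 (rho : ℂ)] fun _ => (1 : ℂ) :=
      hBd.self_of_nhds.continuousAt.tendsto.isBigO_one ℂ
    simpa using (isBigO_refl (fun x : ℂ => (rho : ℂ) - x) (𝓝 (rho : ℂ))).mul h2
  have hα1 : (fun x : ℂ => csqrt (rho - x)) =O[𝓝 (rho : ℂ)] fun _ => (1 : ℂ) := hα0.isBigO_one ℂ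
  have hS : (fun x => S x - bConst * csqrt (rho - x)) =O[𝓝 (rho : ℂ)] fun x => (rho : ℂ) - x := by
    have h1 := hCd.self_of_nhds.isBigO_sub
    rw [hC0] at h1
    have h2 := (hα1.mul h1).neg_right
    refine (h2.congr (fun x => ?_) fun x => ?_)
    · simp only [S]; ring
    · ring
  have hVb : (fun x => V (S x) - bConst * csqrt (rho - x)) =O[𝓝 (rho : ℂ)]
      fun x => (rho : ℂ) - x := (hVS.add hS).congr_left fun x => by ring
  have hlin : (fun x => A x - bConst ^ 2 * (rho - x)) =o[𝓝 (rho : ℂ)] fun x => (rho : ℂ) - x := by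
    have h1 := hasDerivAt_iff_isLittleO.1 hAd.self_of_nhds.hasDerivAt
    refine h1.neg_right.congr (fun x => ?_) fun x => by ring
    rw [hA0, hA', smul_eq_mul]; ring
  have hVo : (fun x => V (S x) - bConst * csqrt (rho - x)) =o[𝓝 (rho : ℂ)]
      fun x => csqrt (rho - x) := by
    refine hVb.trans_isLittleO ?_
    have h1 : (fun x : ℂ => csqrt (rho - x)) =o[𝓝 (rho : ℂ)] fun _ => (1 : ℂ) :=
      (isLittleO_one_iff ℂ).2 hα0
    refine (h1.mul_isBigO (isBigO_refl (fun x : ℂ => csqrt (rho - x)) _)).congr (fun x => ?_)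
      fun x => one_mul _
    rw [← sq, csqrt_sq]
  have hb := bConst_pos
  refine ⟨fun x => 1 - V (S x), ?_, ?_, ?_, ?_⟩
  · filter_upwards [hS0.eventually hV] with x hx
    have h1 : Complex.exp (-(1 - V (S x))) = Real.exp (-1) * Complex.exp (V (S x)) := by
      rw [Complex.ofReal_exp, ← Complex.exp_add]; push_cast; ring_nf
    rw [h1]
    rw [hSA] at hx
    simp only [A] at hx
    linear_combination (Real.exp (-1) : ℂ) * hx + Phi x * he
  · filter_upwards [hS0.eventually hVd, hCd] with x h1 h2 h3
    have h4 : DifferentiableAt ℂ (fun x : ℂ => csqrt (rho - x)) x :=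
      (differentiableAt_csqrt h3).comp x ((differentiableAt_id).const_sub _)
    exact (h1.comp x (h4.mul h2)).const_sub 1
  -- Where |Φ| < 1/e, Re A > 0. As A ≈ b²α², this forces |Im α| < √3 Re α, so |α| ≤ 2 Re α, and V(S)
  -- ≈ bα has nonnegative real part.
  · filter_upwards [hVo.bound (show 0 < bConst / 8 by positivity),
      hlin.bound (show 0 < bConst ^ 2 / 2 by positivity)] with x h1 h2 h3
    set α := csqrt (rho - x)
    have hα : α ^ 2 = rho - x := csqrt_sq _
    have hre : 0 < (A x).re := by
      have h4 : ‖(Real.exp 1 : ℂ) * Phi x‖ < 1 := by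
        rw [norm_mul, Complex.norm_real, Real.norm_of_nonneg (Real.exp_pos _).le]
        calc Real.exp 1 * ‖Phi x‖ < Real.exp 1 * Real.exp (-1) := by gcongr
          _ = 1 := by rw [← Real.exp_add]; simp
      have h5 := (Complex.re_le_norm _).trans_lt h4
      have h6 : (A x).re = 2 * (1 - ((Real.exp 1 : ℂ) * Phi x).re) := by
        simp only [A, show (2 : ℂ) = ((2 : ℝ) : ℂ) by simp, Complex.re_ofReal_mul, Complex.sub_re,
          Complex.one_re]
      rw [h6]; linarith
    rw [← hα] at h2
    have h7 := (Complex.re_le_norm _).trans h2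
    have h8 : (A x - (bConst : ℂ) ^ 2 * α ^ 2).re
        = (A x).re - bConst ^ 2 * (α.re ^ 2 - α.im ^ 2) := by
      rw [← Complex.ofReal_pow, Complex.sub_re, Complex.re_ofReal_mul]
      simp [sq]
    rw [h8, norm_pow, Complex.sq_norm, Complex.normSq_apply] at h7
    have h9 : α.im ^ 2 < 3 * α.re ^ 2 := by
      have hb2 : 0 < bConst ^ 2 := by positivity
      by_contra! hcon
      nlinarith [mul_le_mul_of_nonneg_left hcon hb2.le]
    have h13 := re_csqrt_nonneg ((rho : ℂ) - x)
    change 0 ≤ α.re at h13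
    have h10 : ‖α‖ ≤ 2 * α.re := by
      rw [← sq_le_sq₀ (norm_nonneg _) (by positivity), Complex.sq_norm, Complex.normSq_apply]
      nlinarith
    have h11 := (Complex.abs_re_le_norm _).trans h1
    rw [Complex.sub_re, Complex.re_ofReal_mul] at h11
    have h12 := (abs_le.1 h11).1
    simp only [Complex.sub_re, Complex.one_re, sub_le_self_iff]
    nlinarith
  · exact hVb.neg_left.congr_left fun x => by ring

theorem mem_slitDisc {η : ℝ} {x : ℂ} :
    x ∈ slitDisc η ↔ ‖x‖ < rho + η ∧ (rho : ℂ) - x ∈ Complex.slitPlane := by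
  rw [slitDisc, Set.mem_ofPred_eq, mem_slitPlane_sub_iff]

theorem isOpen_slitDisc (η : ℝ) : IsOpen (slitDisc η) := by
  have : slitDisc η = Metric.ball 0 (rho + η) ∩ (fun x : ℂ => (rho : ℂ) - x) ⁻¹'
      Complex.slitPlane := by
    ext x
    simp [mem_slitDisc]
  rw [this]
  exact Metric.isOpen_ball.inter (Complex.isOpen_slitPlane.preimage (by fun_prop))

/-- `treeFun` ∘ Φ works where |Φ| < 1/e and the local solution Z works near ρ. These two open sets
cover the compact disc |x| ≤ ρ, hence a disc of radius ρ + η. -/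
theorem exists_continuation : ∃ (η : ℝ) (Y : ℂ → ℂ), 0 < η ∧ rho + η ≤ rhoOne ∧
    IsContinuation η Y ∧ (∀ x ∈ slitDisc η, Y x * Complex.exp (-Y x) = Phi x) ∧
    (fun x : ℂ => Y x - (1 - (bConst : ℂ) * csqrt ((rho : ℂ) - x)))
      =O[𝓝[slitDisc η] (rho : ℂ)] fun x : ℂ => (rho : ℂ) - x := by
  classical
  obtain ⟨Z, hZ1, hZ2, hZ3, hZ4⟩ := exists_local_continuation
  obtain ⟨U, hU, hUo, hUr⟩ := eventually_nhds_iff.1 (hZ1.and (hZ2.and hZ3))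
  let W : Set ℂ := {x | ‖x‖ < rhoOne ∧ ‖Phi x‖ < Real.exp (-1)}
  have hWo : IsOpen W := by
    have : W = Metric.ball 0 rhoOne ∩ (fun x => ‖Phi x‖) ⁻¹' Set.Iio (Real.exp (-1)) := by
      ext x; simp [W]
    rw [this]
    exact differentiableOn_Phi.continuousOn.norm.isOpen_inter_preimage Metric.isOpen_ball isOpen_Iio
  have hcover : Metric.closedBall (0 : ℂ) rho ⊆ W ∪ U := fun x hx => by
    have hx : ‖x‖ ≤ rho := by simpa using hx
    rcases eq_or_ne x rho with rfl | hne
    · exact Or.inr hUr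
    · exact Or.inl ⟨hx.trans_lt rho_lt_rhoOne, norm_Phi_lt hx hne⟩
  obtain ⟨δ, hδ, hsub⟩ := (isCompact_closedBall (0 : ℂ) rho).exists_thickening_subset_open
    (hWo.union hUo) hcover
  rw [thickening_closedBall hδ rho_nonneg, add_comm] at hsub
  let Y : ℂ → ℂ := fun x => if ‖Phi x‖ < Real.exp (-1) then treeFun (Phi x) else Z x
  -- On the overlap |Z| = |Φ| e^{Re Z} < 1 because Re Z ≤ 1, so Z is the solution in the unit disc
  -- and the two pieces agree.
  have hYU : ∀ x ∈ U, Y x = Z x := fun x hx => by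
    obtain ⟨h1, -, h3⟩ := hU x hx
    by_cases hΦ : ‖Phi x‖ < Real.exp (-1)
    · simp only [Y, if_pos hΦ]
      refine treeFun_eq hΦ ?_ h1
      rw [eq_mul_exp h1, norm_mul, Complex.norm_exp]
      calc ‖Phi x‖ * Real.exp (Z x).re ≤ ‖Phi x‖ * Real.exp 1 := by gcongr; exact h3 hΦ
        _ < Real.exp (-1) * Real.exp 1 := by gcongr
        _ = 1 := by rw [← Real.exp_add]; simp
    · simp only [Y, if_neg hΦ]
  have hYW : ∀ x ∈ W, Y x = treeFun (Phi x) := fun x hx => if_pos hx.2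
  have hmem : ∀ x, ‖x‖ < rho + min δ (rhoOne - rho) → x ∈ W ∨ x ∈ U := fun x hx =>
    hsub (by simpa using hx.trans_le (by gcongr; exact min_le_left _ _))
  refine ⟨min δ (rhoOne - rho), Y, lt_min hδ (sub_pos.2 rho_lt_rhoOne), ?_, ⟨?_, ?_⟩, ?_, ?_⟩
  · linarith [min_le_right δ (rhoOne - rho)]
  · refine DifferentiableOn.analyticOnNhd (fun x hx => ?_) (isOpen_slitDisc _)
    refine DifferentiableAt.differentiableWithinAt ?_
    rw [mem_slitDisc] at hx
    rcases hmem x hx.1 with h | h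
    · have h1 : DifferentiableAt ℂ (fun x => treeFun (Phi x)) x :=
        (differentiableAt_treeFun h.2).comp x (differentiableAt_Phi h.1)
      exact h1.congr_of_eventuallyEq ((hWo.mem_nhds h |> fun h' => mem_of_superset h' hYW))
    · exact ((hU x h).2.1 hx.2).congr_of_eventuallyEq (mem_of_superset (hUo.mem_nhds h) hYU)
  · intro x hx
    simp only [Y, if_pos (norm_Phi_lt_of_lt hx)]
    exact treeFun_Phi hx
  · intro x hx
    rcases hmem x hx.1 with h | h
    · rw [hYW x h]; exact treeFun_spec h.2
    · rw [hYU x h]; exact (hU x h).1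
  · refine (hZ4.congr' ?_ EventuallyEq.rfl).mono nhdsWithin_le_nhds
    filter_upwards [hUo.mem_nhds hUr] with x hx
    rw [hYU x hx]

/-! ### The level functions inside the disc of convergence -/

/-- The contraction factor for the level functions in the disc of radius `ρ / 2`. -/
noncomputable def lam : ℝ := 1 / (2 - rho)

theorem lam_pos : 0 < lam := one_div_pos.2 (by linarith [rho_lt])

theorem lam_lt_one : lam < 1 := by
  rw [lam, div_lt_one (by linarith [rho_lt])]; linarith [rho_lt]

theorem hasSum_pow_succ {r : ℝ} (h0 : 0 ≤ r) (h1 : r < 1) :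
    HasSum (fun i : ℕ => r ^ (i + 1)) (r / (1 - r)) := by
  simpa [pow_succ', div_eq_mul_inv] using (hasSum_geometric_of_lt_one h0 h1).mul_left r

theorem half_rho_lt_one : rho / 2 < 1 := by linarith [rho_lt]

theorem half_rho_lt_rho : rho / 2 < rho := by linarith [rho_pos]

/-- With r = |x|, y(r) ≤ r/ρ and the geometric series sums to r/(1 - r). The resulting factor
(r/ρ)/(1 - r) increases in r and equals 1/(2 - ρ) = `lam` at r = ρ/2. -/
theorem yReal_mul_norm_tsum_le {x : ℂ} (hx : ‖x‖ ≤ rho / 2) {f : ℕ → ℂ} {M : ℝ}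
    (hf : ∀ i, ‖f i‖ ≤ M * ‖x‖ ^ (i + 1)) :
    Summable f ∧ yReal ‖x‖ * ‖∑' i, f i‖ ≤ M * lam * ‖x‖ := by
  have hx1 : ‖x‖ < 1 := hx.trans_lt half_rho_lt_one
  have hs := (hasSum_pow_succ (norm_nonneg x) hx1).mul_left M
  refine ⟨Summable.of_norm_bounded hs.summable hf, ?_⟩
  have h1 : ‖∑' i, f i‖ ≤ M * (‖x‖ / (1 - ‖x‖)) := tsum_of_norm_bounded hs hf
  have h2 := yReal_le_div_rho (norm_nonneg x) (hx.trans half_rho_lt_rho.le)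
  have h3 : ‖x‖ / rho * (1 / (1 - ‖x‖)) ≤ lam := by
    rw [lam, div_mul_div_comm, mul_one, div_le_div_iff₀ (mul_pos rho_pos (by linarith))
      (by linarith [rho_lt])]
    nlinarith [rho_pos, rho_lt]
  have h4 : 0 ≤ M * (‖x‖ / (1 - ‖x‖)) := (norm_nonneg _).trans h1
  calc yReal ‖x‖ * ‖∑' i, f i‖ ≤ ‖x‖ / rho * (M * (‖x‖ / (1 - ‖x‖))) :=
        mul_le_mul h2 h1 (norm_nonneg _) (div_nonneg (norm_nonneg _) rho_nonneg)
    _ = (M * ‖x‖) * (‖x‖ / rho * (1 / (1 - ‖x‖))) := by ring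
    _ ≤ (M * ‖x‖) * lam := by
        refine mul_le_mul_of_nonneg_left h3 ?_
        have h5 := (norm_nonneg _).trans (hf 0)
        simpa using h5
    _ = M * lam * ‖x‖ := by ring

/-- The sum `∑_{i ≥ 1} y(x ^ i) / i` on the real axis. -/
noncomputable def logReal (r : ℝ) : ℝ := ∑' i : ℕ, yReal (r ^ (i + 1)) / ((i : ℝ) + 1)

theorem pow_succ_lt_rho {r : ℝ} (h0 : 0 ≤ r) (h : r < rho) (i : ℕ) : r ^ (i + 1) < rho :=
  (pow_le_of_le_one h0 (h.trans rho_lt_one).le (Nat.succ_ne_zero i)).trans_lt h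

theorem norm_pow_succ_lt_rho {x : ℂ} (h : ‖x‖ < rho) (i : ℕ) : ‖x ^ (i + 1)‖ < rho := by
  rw [norm_pow]; exact pow_succ_lt_rho (norm_nonneg _) h i

theorem norm_pow_succ_le {x : ℂ} {r : ℝ} (h : ‖x‖ ≤ r) (hr : r ≤ 1) (i : ℕ) :
    ‖x ^ (i + 1)‖ ≤ r := by
  rw [norm_pow]
  exact (pow_le_of_le_one (norm_nonneg _) (h.trans hr) (Nat.succ_ne_zero i)).trans h

theorem summable_logReal {r : ℝ} (h0 : 0 ≤ r) (h : r < rho) :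
    Summable fun i : ℕ => yReal (r ^ (i + 1)) / ((i : ℝ) + 1) := by
  refine Summable.of_nonneg_of_le (fun i => div_nonneg (yReal_nonneg (by positivity))
    (by positivity)) (fun i => ?_)
    ((hasSum_pow_succ h0 (h.trans rho_lt_one)).summable.div_const rho)
  exact (div_le_self (yReal_nonneg (by positivity))
    (by have : (0 : ℝ) ≤ i := by positivity
        linarith)).trans (yReal_le_div_rho (by positivity) (pow_succ_lt_rho h0 h i).le)

theorem yReal_eq_exp {r : ℝ} (h0 : 0 ≤ r) (h : r < rho) : yReal r = r * Real.exp (logReal r) := by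
  have hn : ‖(r : ℂ)‖ = r := by simp [abs_of_nonneg h0]
  have h1 := ySeries_eq_of_summable (x := r) (by rw [hn]; exact h.trans rho_lt_one)
    (by rw [hn]; exact conv_of_lt_rho h0 h)
  have h2 : ∑' i : ℕ, ySeries ((r : ℂ) ^ (i + 1)) / ((i : ℂ) + 1) = logReal r := by
    rw [logReal, Complex.ofReal_tsum]
    exact tsum_congr fun n => by rw [← Complex.ofReal_pow, ySeries_ofReal]; push_cast; rfl
  rw [h2, ySeries_ofReal] at h1
  exact_mod_cast h1

section Levels

variable {Y : ℂ → ℂ}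

theorem norm_pow_le_one {u : ℂ} (hu : ‖u‖ ≤ 1) (i : ℕ) : ‖u ^ i‖ ≤ 1 := by
  rw [norm_pow]; exact pow_le_one₀ (norm_nonneg _) hu

theorem norm_pow_sub_one_le {u : ℂ} (hu : ‖u‖ ≤ 1) (i : ℕ) : ‖u ^ i - 1‖ ≤ i * ‖u - 1‖ := by
  rw [← mul_geom_sum u i, norm_mul, mul_comm]
  refine mul_le_mul_of_nonneg_right ?_ (norm_nonneg _)
  exact (norm_sum_le _ _).trans ((Finset.sum_le_sum fun j _ => norm_pow_le_one hu j).trans (by simp))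

theorem norm_yLevel_le (hY : ∀ x : ℂ, ‖x‖ < rho → Y x = ySeries x) (k : ℕ) {x u : ℂ}
    (hx : ‖x‖ < rho) (hu : ‖u‖ ≤ 1) : ‖yLevel Y k x u‖ ≤ yReal ‖x‖ := by
  induction k generalizing x u with
  | zero =>
    rw [yLevel, hY x hx, norm_mul]
    exact (mul_le_of_le_one_left (norm_nonneg _) hu).trans
      (norm_ySeries_le (conv_of_lt_rho (norm_nonneg _) hx))
  | succ k ih =>
    rw [yLevel, norm_mul, Complex.norm_exp, yReal_eq_exp (norm_nonneg _) hx]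
    gcongr
    refine (Complex.re_le_norm _).trans (tsum_of_norm_bounded
      (summable_logReal (norm_nonneg _) hx).hasSum fun i => ?_)
    rw [norm_div, norm_natCast_add_one, ← norm_pow]
    gcongr
    exact ih (norm_pow_succ_lt_rho hx i) (norm_pow_le_one hu _)

theorem norm_level_term_le (hY : ∀ x : ℂ, ‖x‖ < rho → Y x = ySeries x) (k : ℕ) {x u : ℂ}
    (hx : ‖x‖ < rho) (hu : ‖u‖ ≤ 1) (i : ℕ) :
    ‖yLevel Y k (x ^ (i + 1)) (u ^ (i + 1)) / ((i : ℂ) + 1)‖ ≤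
      yReal (‖x‖ ^ (i + 1)) / ((i : ℝ) + 1) := by
  rw [norm_div, norm_natCast_add_one, ← norm_pow]
  gcongr
  exact norm_yLevel_le hY k (norm_pow_succ_lt_rho hx i) (norm_pow_le_one hu _)

theorem norm_ySeries_pow_term_le {x : ℂ} (hx : ‖x‖ < rho) (i : ℕ) :
    ‖ySeries (x ^ (i + 1)) / ((i : ℂ) + 1)‖ ≤ yReal (‖x‖ ^ (i + 1)) / ((i : ℝ) + 1) := by
  rw [norm_div, norm_natCast_add_one, ← norm_pow]
  gcongr
  exact norm_ySeries_le (conv_of_lt_rho (norm_nonneg _) (norm_pow_succ_lt_rho hx i))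

/-- The exponents in the recursion for `y_k` and `y` differ by the sum of the `w_k(x ^ i, u ^ i)`. -/
theorem exponent_sub (hY : ∀ x : ℂ, ‖x‖ < rho → Y x = ySeries x) (k : ℕ) {x u : ℂ}
    (hx : ‖x‖ < rho) (hu : ‖u‖ ≤ 1) :
    ∑' i : ℕ, yLevel Y k (x ^ (i + 1)) (u ^ (i + 1)) / ((i : ℂ) + 1)
      - ∑' i : ℕ, ySeries (x ^ (i + 1)) / ((i : ℂ) + 1)
      = ∑' i : ℕ, wLevel Y k (x ^ (i + 1)) (u ^ (i + 1)) / ((i : ℂ) + 1) := by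
  have hs := summable_logReal (norm_nonneg x) hx
  rw [← Summable.tsum_sub (Summable.of_norm_bounded hs (norm_level_term_le hY k hx hu))
    (Summable.of_norm_bounded hs (norm_ySeries_pow_term_le hx))]
  refine tsum_congr fun i => ?_
  rw [wLevel, hY _ (norm_pow_succ_lt_rho hx i), sub_div]

theorem wLevel_succ_eq (hY : ∀ x : ℂ, ‖x‖ < rho → Y x = ySeries x) (k : ℕ) {x u : ℂ}
    (hx : ‖x‖ < rho) (hu : ‖u‖ ≤ 1) :
    wLevel Y (k + 1) x u = ySeries x * (Complex.exp
      (∑' i : ℕ, wLevel Y k (x ^ (i + 1)) (u ^ (i + 1)) / ((i : ℂ) + 1)) - 1) := by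
  have h1 := ySeries_eq_of_summable (hx.trans rho_lt_one) (conv_of_lt_rho (norm_nonneg x) hx)
  rw [wLevel, hY x hx, yLevel, ← exponent_sub hY k hx hu]
  set a := ∑' i : ℕ, yLevel Y k (x ^ (i + 1)) (u ^ (i + 1)) / ((i : ℂ) + 1)
  set a' := ∑' i : ℕ, ySeries (x ^ (i + 1)) / ((i : ℂ) + 1)
  have h2 : ySeries x * Complex.exp (a - a') = x * Complex.exp a := by
    rw [h1, mul_assoc, ← Complex.exp_add, add_sub_cancel]
  linear_combination -h2

/-- Each level gains a factor `lam`: the factor i in |u^i - 1| ≤ i|u - 1| cancels the division by i.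
The radius ρ/2 suffices, since the bound is needed only at x^i with i ≥ 2 and |x| ≤ `rhoOne`. -/
theorem norm_wLevel_le (hY : ∀ x : ℂ, ‖x‖ < rho → Y x = ySeries x) (k : ℕ) {x u : ℂ}
    (hx : ‖x‖ ≤ rho / 2) (hu : ‖u‖ ≤ 1) :
    ‖wLevel Y k x u‖ ≤ ‖x‖ / rho * ‖u - 1‖ * lam ^ k := by
  have hρ := rho_pos
  induction k generalizing x u with
  | zero =>
    have hx' := hx.trans_lt half_rho_lt_rho
    have h1 : wLevel Y 0 x u = ySeries x * (u - 1) := by rw [wLevel, yLevel, hY x hx']; ring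
    rw [h1, norm_mul, pow_zero, mul_one]
    gcongr
    exact (norm_ySeries_le (conv_of_lt_rho (norm_nonneg _) hx')).trans
      (yReal_le_div_rho (norm_nonneg _) hx'.le)
  | succ k ih =>
    have hx' := hx.trans_lt half_rho_lt_rho
    have h1 := ySeries_eq_of_summable (hx'.trans rho_lt_one) (conv_of_lt_rho (norm_nonneg x) hx')
    have hs := summable_logReal (norm_nonneg x) hx'
    have hre : ∀ {f : ℕ → ℂ}, (∀ i, ‖f i‖ ≤ yReal (‖x‖ ^ (i + 1)) / ((i : ℝ) + 1)) →
        (∑' i, f i).re ≤ logReal ‖x‖ := fun hf =>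
      (Complex.re_le_norm _).trans (tsum_of_norm_bounded hs.hasSum hf)
    have hterm : ∀ i : ℕ, ‖wLevel Y k (x ^ (i + 1)) (u ^ (i + 1)) / ((i : ℂ) + 1)‖
        ≤ ‖u - 1‖ * lam ^ k / rho * ‖x‖ ^ (i + 1) := fun i => by
      have h2 := ih (norm_pow_succ_le hx half_rho_lt_one.le i) (norm_pow_le_one hu (i + 1))
      have h3 := norm_pow_sub_one_le hu (i + 1)
      push_cast at h3
      rw [norm_div, norm_natCast_add_one, div_le_iff₀ (by positivity)]
      refine h2.trans ?_
      rw [norm_pow]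
      have h4 : 0 ≤ ‖x‖ ^ (i + 1) / rho := by positivity
      have h5 := pow_nonneg lam_pos.le k
      calc ‖x‖ ^ (i + 1) / rho * ‖u ^ (i + 1) - 1‖ * lam ^ k
          ≤ ‖x‖ ^ (i + 1) / rho * (((i : ℝ) + 1) * ‖u - 1‖) * lam ^ k := by gcongr
        _ = _ := by ring
    rw [wLevel, hY x hx', yLevel, h1, ← mul_sub, norm_mul]
    have h6 := norm_exp_sub_exp_le (hre (norm_level_term_le hY k hx' hu))
      (hre (norm_ySeries_pow_term_le hx'))
    rw [exponent_sub hY k hx' hu] at h6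
    have h7 := (yReal_mul_norm_tsum_le hx hterm).2
    rw [yReal_eq_exp (norm_nonneg _) hx', mul_assoc] at h7
    calc _ ≤ ‖x‖ * _ := mul_le_mul_of_nonneg_left h6 (norm_nonneg _)
      _ ≤ _ := h7
      _ = _ := by rw [pow_succ]; ring

/-! ### The derivative with respect to `u` at `u = 1` -/

/-- The derivative of `y_k(x, u)` with respect to `u` at `u = 1`. -/
noncomputable def levelDeriv : ℕ → ℂ → ℂ
  | 0, x => ySeries x
  | k + 1, x => ySeries x * ∑' i : ℕ, levelDeriv k (x ^ (i + 1))

theorem norm_levelDeriv_le (k : ℕ) {x : ℂ} (hx : ‖x‖ ≤ rho / 2) :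
    ‖levelDeriv k x‖ ≤ lam ^ k / rho * ‖x‖ := by
  have hx' := hx.trans_lt half_rho_lt_rho
  have hy := norm_ySeries_le (conv_of_lt_rho (norm_nonneg _) hx')
  induction k generalizing x with
  | zero =>
    rw [levelDeriv, pow_zero, div_mul_eq_mul_div, one_mul]
    exact hy.trans (yReal_le_div_rho (norm_nonneg _) hx'.le)
  | succ k ih =>
    rw [levelDeriv, norm_mul]
    have hterm : ∀ i : ℕ, ‖levelDeriv k (x ^ (i + 1))‖ ≤ lam ^ k / rho * ‖x‖ ^ (i + 1) :=
      fun i => by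
        have h1 := norm_pow_succ_le hx half_rho_lt_one.le i
        rw [← norm_pow]
        exact ih h1 (h1.trans_lt half_rho_lt_rho) (norm_ySeries_le (conv_of_lt_rho (norm_nonneg _)
          (h1.trans_lt half_rho_lt_rho)))
    calc _ ≤ yReal ‖x‖ * ‖∑' i : ℕ, levelDeriv k (x ^ (i + 1))‖ := by gcongr
      _ ≤ _ := (yReal_mul_norm_tsum_le hx hterm).2
      _ = _ := by rw [pow_succ]; ring

theorem pow_ne_one_near (i : ℕ) : ∀ᶠ u : ℂ in 𝓝[≠] 1, u ^ (i + 1) ≠ 1 :=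
  (hasDerivAt_pow (i + 1) (1 : ℂ)).eventually_ne (by simp; norm_cast)

theorem tendsto_pow_slope (i : ℕ) :
    Tendsto (fun u : ℂ => (u ^ (i + 1) - 1) / (((i : ℂ) + 1) * (u - 1))) (𝓝[≠] 1) (𝓝 1) := by
  have h1 := hasDerivAt_iff_tendsto_slope.1 (hasDerivAt_pow (i + 1) (1 : ℂ))
  have h2 : (i : ℂ) + 1 ≠ 0 := by norm_cast
  have h3 := h1.div_const ((i : ℂ) + 1)
  simp only [slope_fun_def_field] at h3
  convert! h3 using 2
  · simp; field_simp
  · simp [h2]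

theorem tendsto_exp_sub_one_div {ι : Type} {l : Filter ι} {E D : ι → ℂ} {G : ℂ}
    (hE : Tendsto E l (𝓝 0)) (hED : Tendsto (fun j => E j / D j) l (𝓝 G)) :
    Tendsto (fun j => (Complex.exp (E j) - 1) / D j) l (𝓝 G) := by
  have h1 : Continuous (dslope Complex.exp 0) := by
    rw [← continuousOn_univ]
    exact (continuousOn_dslope univ_mem).2 ⟨Complex.continuous_exp.continuousOn,
      Complex.differentiableAt_exp⟩
  have h2 := (h1.tendsto 0).comp hE
  rw [dslope_same, Complex.deriv_exp, Complex.exp_zero] at h2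
  have h3 := hED.mul h2
  rw [mul_one] at h3
  refine h3.congr fun j => ?_
  have := sub_smul_dslope Complex.exp 0 (E j)
  simp only [sub_zero, smul_eq_mul, Complex.exp_zero] at this
  rw [Function.comp_apply, ← this]; ring

/-- Stated along moving points X and U because both arguments vary with n. The quotients (u^i -
1)/(i(u - 1)) → 1 absorb the powers of u, and `norm_wLevel_le` dominates the series. -/
theorem tendsto_wLevel_div (hY : ∀ x : ℂ, ‖x‖ < rho → Y x = ySeries x) {ι : Type} {l : Filter ι}
    (k : ℕ) {X U : ι → ℂ} {a : ℂ} (ha : ‖a‖ < rho / 2) (hX : Tendsto X l (𝓝 a))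
    (hU : Tendsto U l (𝓝[≠] 1)) (hU1 : ∀ᶠ j in l, ‖U j‖ ≤ 1) :
    Tendsto (fun j => wLevel Y k (X j) (U j) / (U j - 1)) l (𝓝 (levelDeriv k a)) := by
  have hρ := rho_pos
  have hUne : ∀ᶠ j in l, U j - 1 ≠ 0 := by
    filter_upwards [hU.eventually self_mem_nhdsWithin] with j hj
    exact sub_ne_zero.2 hj
  have hX' : ∀ {a : ℂ} {X : ι → ℂ}, ‖a‖ < rho / 2 → Tendsto X l (𝓝 a) →
      ∀ᶠ j in l, ‖X j‖ < rho / 2 := fun ha hX =>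
    hX.norm.eventually_lt_const ha
  have hy : ∀ {a : ℂ} {X : ι → ℂ}, ‖a‖ < rho / 2 → Tendsto X l (𝓝 a) →
      Tendsto (fun j => ySeries (X j)) l (𝓝 (ySeries a)) := fun ha hX =>
    (differentiableAt_ySeries (ha.trans half_rho_lt_rho)).continuousAt.tendsto.comp hX
  induction k generalizing X U a with
  | zero =>
    refine (hy ha hX).congr' ?_
    filter_upwards [hUne, hX' ha hX] with j h1 h2
    rw [wLevel, yLevel, hY _ (h2.trans half_rho_lt_rho)]
    field_simp
  | succ k ih =>
    have hlim : Tendsto (fun j => (∑' i : ℕ, wLevel Y k (X j ^ (i + 1)) (U j ^ (i + 1)) /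
        ((i : ℂ) + 1)) / (U j - 1)) l (𝓝 (∑' i : ℕ, levelDeriv k (a ^ (i + 1)))) := by
      simp_rw [← tsum_div_const]
      refine tendsto_tsum_of_dominated_convergence
        (bound := fun i => lam ^ k / rho * (rho / 2) ^ (i + 1))
        ((hasSum_pow_succ (by positivity) half_rho_lt_one).summable.mul_left _) (fun i => ?_) ?_
      · have h1 : Tendsto (fun j => U j ^ (i + 1)) l (𝓝[≠] 1) := by
          refine tendsto_nhdsWithin_iff.2 ⟨?_, hU.eventually (pow_ne_one_near i)⟩
          simpa using (hU.mono_right nhdsWithin_le_nhds).pow (i + 1)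
        have h2 : ‖a ^ (i + 1)‖ < rho / 2 := by
          rw [norm_pow]
          exact (pow_le_of_le_one (norm_nonneg _) (ha.le.trans half_rho_lt_one.le)
            (Nat.succ_ne_zero i)).trans_lt ha
        have h3 := ih h2 (hX.pow (i + 1)) h1 (hU1.mono fun j hj => norm_pow_le_one hj _)
          (h1.eventually self_mem_nhdsWithin |>.mono fun j hj => sub_ne_zero.2 hj)
        have h4 := h3.mul ((tendsto_pow_slope i).comp hU)
        rw [mul_one] at h4
        refine h4.congr' ?_
        filter_upwards [h1.eventually self_mem_nhdsWithin] with j hj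
        have : U j ^ (i + 1) - 1 ≠ 0 := sub_ne_zero.2 hj
        simp only [Function.comp_apply]
        field_simp
      · filter_upwards [hU1, hX' ha hX, hUne] with j h1 h2 h3 i
        have h4 := norm_wLevel_le hY k (norm_pow_succ_le h2.le half_rho_lt_one.le i)
          (norm_pow_le_one h1 (i + 1))
        have h5 := norm_pow_sub_one_le h1 (i + 1)
        push_cast at h5
        rw [norm_div, norm_div, norm_natCast_add_one, div_div,
          div_le_iff₀ (mul_pos (by positivity) (norm_pos_iff.2 h3))]
        refine h4.trans ?_
        rw [norm_pow]
        have h6 := pow_nonneg lam_pos.le k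
        calc ‖X j‖ ^ (i + 1) / rho * ‖U j ^ (i + 1) - 1‖ * lam ^ k
            ≤ (rho / 2) ^ (i + 1) / rho * (((i : ℝ) + 1) * ‖U j - 1‖) * lam ^ k := by gcongr
          _ = _ := by ring
    have hE : Tendsto (fun j => ∑' i : ℕ, wLevel Y k (X j ^ (i + 1)) (U j ^ (i + 1)) /
        ((i : ℂ) + 1)) l (𝓝 0) := by
      have h1 : Tendsto (fun j => U j - 1) l (𝓝 0) := by
        simpa using (hU.mono_right nhdsWithin_le_nhds).sub_const 1
      have h2 := hlim.mul h1
      rw [mul_zero] at h2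
      refine h2.congr' ?_
      filter_upwards [hUne] with j hj
      field_simp
    rw [levelDeriv]
    refine ((hy ha hX).mul (tendsto_exp_sub_one_div hE hlim)).congr' ?_
    filter_upwards [hU1, hX' ha hX] with j h1 h2
    rw [wLevel_succ_eq hY k (h2.trans half_rho_lt_rho) h1]
    ring

end Levels

theorem summable_lam : Summable fun k : ℕ => lam ^ k :=
  summable_geometric_of_lt_one lam_pos.le lam_lt_one

/-- The sum of the derivatives over all levels. -/
noncomputable def levelDerivSum (x : ℂ) : ℂ := ∑' k : ℕ, levelDeriv k x

theorem summable_levelDeriv {x : ℂ} (hx : ‖x‖ ≤ rho / 2) : Summable fun k => levelDeriv k x :=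
  Summable.of_norm_bounded ((summable_lam.div_const rho).mul_right ‖x‖)
    fun k => norm_levelDeriv_le k hx

theorem norm_levelDerivSum_le {x : ℂ} (hx : ‖x‖ ≤ rho / 2) :
    ‖levelDerivSum x‖ ≤ (∑' k : ℕ, lam ^ k / rho) * ‖x‖ := by
  rw [← tsum_mul_right]
  exact tsum_of_norm_bounded ((summable_lam.div_const rho).mul_right ‖x‖).hasSum
    fun k => norm_levelDeriv_le k hx

theorem summable_levelDeriv_prod {f : ℕ → ℂ} {r : ℝ} (h0 : 0 ≤ r) (h1 : r < 1)
    (hf : ∀ i, ‖f i‖ ≤ r ^ i) (hf' : ∀ i, ‖f i‖ ≤ rho / 2) :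
    Summable fun p : ℕ × ℕ => levelDeriv p.1 (f p.2) := by
  refine Summable.of_norm_bounded ((summable_lam.div_const rho).mul_of_nonneg
    (summable_geometric_of_lt_one h0 h1) (fun k => div_nonneg (pow_nonneg lam_pos.le k) rho_nonneg)
    fun i => pow_nonneg h0 i) fun p => ?_
  refine (norm_levelDeriv_le p.1 (hf' p.2)).trans ?_
  have := div_nonneg (pow_nonneg lam_pos.le p.1) rho_nonneg
  gcongr
  exact hf p.2

theorem levelDerivSum_eq {x : ℂ} (hx : ‖x‖ ≤ rho / 2) :
    levelDerivSum x = ySeries x + ySeries x * ∑' i : ℕ, levelDerivSum (x ^ (i + 1)) := by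
  have hx1 : ‖x‖ < 1 := hx.trans_lt half_rho_lt_one
  rw [levelDerivSum, (summable_levelDeriv hx).tsum_eq_zero_add]
  congr 1
  simp_rw [levelDeriv, levelDerivSum]
  rw [tsum_mul_left, Summable.tsum_comm (f := fun (k i : ℕ) => levelDeriv k (x ^ (i + 1)))]
  refine summable_levelDeriv_prod (f := fun i => x ^ (i + 1)) (norm_nonneg x) hx1
    (fun i => ?_) fun i => norm_pow_succ_le hx half_rho_lt_one.le i
  rw [norm_pow]
  exact pow_le_pow_of_le_one (norm_nonneg _) hx1.le (Nat.le_succ i)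

theorem differentiableAt_deriv_ySeries {x : ℂ} (hx : ‖x‖ < rho) :
    DifferentiableAt ℂ (deriv ySeries) x :=
  ((differentiableOn_ySeries.deriv Metric.isOpen_ball) x (by simpa using hx)).differentiableAt
    (Metric.isOpen_ball.mem_nhds (by simpa using hx))

theorem exists_norm_deriv_ySeries_le :
    ∃ M, 0 ≤ M ∧ ∀ x : ℂ, ‖x‖ ≤ rho / 2 → ‖deriv ySeries x‖ ≤ M := by
  obtain ⟨M, hM⟩ := (isCompact_closedBall (0 : ℂ) (rho / 2)).exists_bound_of_continuousOn
    (f := deriv ySeries) fun x hx => (differentiableAt_deriv_ySeries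
      ((by simpa using hx : ‖x‖ ≤ rho / 2).trans_lt half_rho_lt_rho)).continuousAt.continuousWithinAt
  exact ⟨M, (norm_nonneg _).trans (hM 0 (Metric.mem_closedBall_self (by linarith [rho_pos]))),
    fun x hx => hM x (by simpa using hx)⟩

theorem mul_deriv_ySeries_eq {x : ℂ} (hx : ‖x‖ ≤ rho / 2) :
    x * deriv ySeries x
      = ySeries x + ySeries x * ∑' i : ℕ, x ^ (i + 1) * deriv ySeries (x ^ (i + 1)) := by
  have hx' := hx.trans_lt half_rho_lt_rho
  have hx1 := hx'.trans rho_lt_rhoOne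
  have hd := (differentiableAt_ySeries hx').hasDerivAt
  have hh := (differentiableAt_hSeries hx1).hasDerivAt
  have h1 := (hasDerivAt_id x).mul (hd.add hh).cexp
  have h2 : ySeries =ᶠ[𝓝 x] fun x => id x * Complex.exp (ySeries x + hSeries x) := by
    filter_upwards [(continuous_norm.tendsto x).eventually_lt_const hx'] with z hz
    exact ySeries_eq_exp (hz.trans rho_lt_one) (conv_of_lt_rho (norm_nonneg _) hz)
  have h3 := hd.unique (h1.congr_of_eventuallyEq h2)
  have h4 := ySeries_eq_exp (hx'.trans rho_lt_one) (conv_of_lt_rho (norm_nonneg _) hx')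
  have h5 := (hasSum_deriv_hSeries hx1).mul_left x
  have h6 : HasSum (fun i : ℕ => x ^ (i + 1) * deriv ySeries (x ^ (i + 1)))
      (x * deriv hSeries x + x * deriv ySeries x) := by
    refine (hasSum_nat_add_iff' 1).1 ?_
    simp only [Finset.range_one, Finset.sum_singleton, zero_add, pow_one, add_sub_cancel_right]
    refine h5.congr_fun fun i => ?_
    ring
  rw [h6.tsum_eq]
  simp only [id, Pi.add_apply] at h3
  linear_combination x * h3 - (1 + x * (deriv hSeries x + deriv ySeries x)) * h4

/-- Marking all levels marks all vertices. Analytically, both sides solve F(x) = y(x) + y(x) ∑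
F(x^i), and iterating the difference contracts it by `lam` each time. -/
theorem levelDerivSum_eq_mul_deriv {x : ℂ} (hx : ‖x‖ ≤ rho / 2) :
    levelDerivSum x = x * deriv ySeries x := by
  obtain ⟨M, hM0, hM⟩ := exists_norm_deriv_ySeries_le
  set C := (∑' k : ℕ, lam ^ k / rho) + M
  have key : ∀ (n : ℕ) {x : ℂ}, ‖x‖ ≤ rho / 2 →
      ‖levelDerivSum x - x * deriv ySeries x‖ ≤ C * lam ^ n * ‖x‖ := by
    intro n
    induction n with
    | zero =>
      intro x hx
      refine (norm_sub_le _ _).trans ?_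
      rw [norm_mul, pow_zero, mul_one, add_mul, mul_comm ‖x‖]
      gcongr
      · exact norm_levelDerivSum_le hx
      · exact hM x hx
    | succ n ih =>
      intro x hx
      have hpow := fun i => norm_pow_succ_le hx half_rho_lt_one.le i
      have hs1 := (yReal_mul_norm_tsum_le hx (f := fun i => levelDerivSum (x ^ (i + 1)))
        fun i => (norm_levelDerivSum_le (hpow i)).trans_eq (by rw [norm_pow])).1
      have hs2 := (yReal_mul_norm_tsum_le hx
        (f := fun i => x ^ (i + 1) * deriv ySeries (x ^ (i + 1))) (M := M) fun i => by
          rw [norm_mul, norm_pow, mul_comm]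
          gcongr
          exact hM _ (hpow i)).1
      have h1 : levelDerivSum x - x * deriv ySeries x = ySeries x * ∑' i : ℕ,
          (levelDerivSum (x ^ (i + 1)) - x ^ (i + 1) * deriv ySeries (x ^ (i + 1))) := by
        rw [hs1.tsum_sub hs2, levelDerivSum_eq hx, mul_deriv_ySeries_eq hx]; ring
      rw [h1, norm_mul]
      calc _ ≤ yReal ‖x‖ * _ := mul_le_mul_of_nonneg_right (norm_ySeries_le (conv_of_lt_rho
              (norm_nonneg _) (hx.trans_lt half_rho_lt_rho))) (norm_nonneg _)
        _ ≤ _ := (yReal_mul_norm_tsum_le hx fun i => (ih (hpow i)).trans_eq (by rw [norm_pow])).2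
        _ = _ := by rw [pow_succ]; ring
  have hlim : Tendsto (fun n : ℕ => C * lam ^ n * ‖x‖) atTop (𝓝 0) := by
    simpa using ((tendsto_pow_atTop_nhds_zero_of_lt_one lam_pos.le lam_lt_one).const_mul
      C).mul_const ‖x‖
  have := ge_of_tendsto' hlim fun n => key n hx
  exact sub_eq_zero.1 (norm_le_zero_iff.1 this)

/-! ### The perturbation in the recursion for the level functions -/

/-- The perturbation `∑_{i ≥ 2} w_k(x ^ i, u ^ i) / i`. -/
noncomputable def perturb (Y : ℂ → ℂ) (k : ℕ) (x u : ℂ) : ℂ :=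
  ∑' i : ℕ, wLevel Y k (x ^ (i + 2)) (u ^ (i + 2)) / ((i : ℂ) + 2)

/-- The constant in the bound for the perturbation. -/
noncomputable def pertConst : ℝ := 1 / (2 * (1 - rhoOne))

theorem pertConst_pos : 0 < pertConst := one_div_pos.2 (by linarith [rhoOne_lt_one])

theorem norm_pow_add_two_le {x : ℂ} (hx : ‖x‖ ≤ rhoOne) (i : ℕ) :
    ‖x ^ (i + 2)‖ ≤ rhoOne ^ i * (rho / 2) := by
  rw [norm_pow, ← rhoOne_sq, ← pow_add]
  gcongr

theorem norm_pow_add_two_le_half {x : ℂ} (hx : ‖x‖ ≤ rhoOne) (i : ℕ) :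
    ‖x ^ (i + 2)‖ ≤ rho / 2 :=
  (norm_pow_add_two_le hx i).trans (mul_le_of_le_one_left (by linarith [rho_pos])
    (pow_le_one₀ rhoOne_pos.le rhoOne_lt_one.le))

section Perturb

variable {Y : ℂ → ℂ}

theorem norm_perturb_term_le (hY : ∀ x : ℂ, ‖x‖ < rho → Y x = ySeries x) (k : ℕ) {x u : ℂ}
    (hx : ‖x‖ ≤ rhoOne) (hu : ‖u‖ ≤ 1) (i : ℕ) :
    ‖wLevel Y k (x ^ (i + 2)) (u ^ (i + 2)) / ((i : ℂ) + 2)‖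
      ≤ ‖u - 1‖ * lam ^ k / 2 * rhoOne ^ i := by
  have h1 := norm_wLevel_le hY k (norm_pow_add_two_le_half hx i) (norm_pow_le_one hu (i + 2))
  have h2 := norm_pow_sub_one_le hu (i + 2)
  have h3 := norm_pow_add_two_le hx i
  push_cast at h2
  rw [norm_div, norm_natCast_add_two, div_le_iff₀ (by positivity)]
  refine h1.trans ?_
  have h4 := pow_nonneg lam_pos.le k
  have h5 := rho_pos
  have h6 := rhoOne_pos
  calc _ ≤ (rhoOne ^ i * (rho / 2)) / rho * (((i : ℝ) + 2) * ‖u - 1‖) * lam ^ k := by gcongr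
    _ = _ := by field_simp

theorem norm_perturb_le (hY : ∀ x : ℂ, ‖x‖ < rho → Y x = ySeries x) (k : ℕ) {x u : ℂ}
    (hx : ‖x‖ ≤ rhoOne) (hu : ‖u‖ ≤ 1) : ‖perturb Y k x u‖ ≤ pertConst * ‖u - 1‖ * lam ^ k := by
  have h := tsum_of_norm_bounded ((hasSum_geometric_of_lt_one rhoOne_pos.le
    rhoOne_lt_one).mul_left (‖u - 1‖ * lam ^ k / 2)) (norm_perturb_term_le hY k hx hu)
  refine h.trans_eq ?_
  rw [pertConst]
  have : 1 - rhoOne ≠ 0 := by linarith [rhoOne_lt_one]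
  field_simp

/-- Only the term i = 1 sees the continuation of y; the powers x^i with i ≥ 2 stay in the disc of
convergence. The recursion therefore holds beyond |x| < ρ as long as y e^{-y} = Φ. -/
theorem wLevel_succ (hY : ∀ x : ℂ, ‖x‖ < rho → Y x = ySeries x) (k : ℕ) {x u : ℂ}
    (hx : ‖x‖ ≤ rhoOne) (hu : ‖u‖ ≤ 1) (hYx : Y x * Complex.exp (-Y x) = Phi x) :
    wLevel Y (k + 1) x u = Y x * (Complex.exp (wLevel Y k x u + perturb Y k x u) - 1) := by
  have hs1 : Summable fun i : ℕ => wLevel Y k (x ^ (i + 2)) (u ^ (i + 2)) / ((i : ℂ) + 2) :=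
    Summable.of_norm_bounded ((hasSum_geometric_of_lt_one rhoOne_pos.le
      rhoOne_lt_one).mul_left (‖u - 1‖ * lam ^ k / 2)).summable (norm_perturb_term_le hY k hx hu)
  have hs2 := summable_hSeries (hx.trans_lt rhoOne_lt_one) (conv_sq (norm_nonneg x) hx)
  have h1 : (∑' i : ℕ, yLevel Y k (x ^ (i + 1)) (u ^ (i + 1)) / ((i : ℂ) + 1))
      = yLevel Y k x u + (perturb Y k x u + hSeries x) := by
    have h2 := hs1.hasSum.add hs2.hasSum
    refine HasSum.tsum_eq ((hasSum_nat_add_iff' 1).1 ?_)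
    simp only [Finset.range_one, Finset.sum_singleton, zero_add, pow_one, Nat.cast_zero, div_one,
      add_sub_cancel_left]
    refine h2.congr_fun fun i => ?_
    rw [wLevel, hY _ (norm_pow_add_two_lt hx i)]
    push_cast
    ring
  have h3 : Y x = x * Complex.exp (Y x + hSeries x) := by
    conv_lhs => rw [eq_mul_exp hYx, Phi, mul_assoc, ← Complex.exp_add, add_comm]
  have h4 : Y x * Complex.exp (wLevel Y k x u + perturb Y k x u)
      = x * Complex.exp (yLevel Y k x u + (perturb Y k x u + hSeries x)) := by
    conv_lhs => rw [h3, mul_assoc, ← Complex.exp_add, wLevel]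
    ring_nf
  rw [mul_sub, h4, wLevel, yLevel, h1, mul_one]

/-- The limit is ∑_{i≥2} ρ^i y'(ρ^i) = ρ h'(ρ), which is b²ρ/2 - 1 by the formula for b². -/
theorem tendsto_perturb_div (hY : ∀ x : ℂ, ‖x‖ < rho → Y x = ySeries x) {ι : Type} {l : Filter ι}
    {X U : ι → ℂ} (hX : Tendsto X l (𝓝 rho)) (hU : Tendsto U l (𝓝[≠] 1))
    (hU1 : ∀ᶠ j in l, ‖U j‖ ≤ 1) :
    Tendsto (fun j => (∑' k, perturb Y k (X j) (U j)) / (U j - 1)) l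
      (𝓝 ((bConst ^ 2 * rho / 2 - 1 : ℝ) : ℂ)) := by
  have hXle : ∀ᶠ j in l, ‖X j‖ ≤ rhoOne := by
    have := hX.norm
    rw [norm_rho] at this
    exact this.eventually_le_const rho_lt_rhoOne
  have hUne : ∀ᶠ j in l, U j - 1 ≠ 0 := by
    filter_upwards [hU.eventually self_mem_nhdsWithin] with j hj
    exact sub_ne_zero.2 hj
  have hle : ∀ i : ℕ, ‖(rho : ℂ) ^ (i + 2)‖ < rho / 2 := fun i => by
    rw [norm_pow, norm_rho]
    have : rho ^ (i + 2) ≤ rho ^ 2 := pow_le_pow_of_le_one rho_nonneg rho_lt_one.le (by omega)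
    nlinarith [rho_pos, rho_lt]
  have hk : ∀ k, Tendsto (fun j => perturb Y k (X j) (U j) / (U j - 1)) l
      (𝓝 (∑' i : ℕ, levelDeriv k ((rho : ℂ) ^ (i + 2)))) := fun k => by
    simp_rw [perturb, ← tsum_div_const]
    refine tendsto_tsum_of_dominated_convergence (bound := fun i => lam ^ k / 2 * rhoOne ^ i)
      ((summable_geometric_of_lt_one rhoOne_pos.le rhoOne_lt_one).mul_left _) (fun i => ?_) ?_
    · have h1 : Tendsto (fun j => U j ^ (i + 2)) l (𝓝[≠] 1) := by
        refine tendsto_nhdsWithin_iff.2 ⟨?_, hU.eventually (pow_ne_one_near (i + 1))⟩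
        simpa using (hU.mono_right nhdsWithin_le_nhds).pow (i + 2)
      have h3 := tendsto_wLevel_div hY k (hle i) (hX.pow (i + 2)) h1
        (hU1.mono fun j hj => norm_pow_le_one hj _)
      have h4 := h3.mul ((tendsto_pow_slope (i + 1)).comp hU)
      rw [mul_one] at h4
      refine h4.congr' ?_
      filter_upwards [h1.eventually self_mem_nhdsWithin] with j hj
      have h5 : U j ^ (i + 2) - 1 ≠ 0 := sub_ne_zero.2 hj
      have h6 : ((i + 1 : ℕ) : ℂ) + 1 = (i : ℂ) + 2 := by push_cast; ring
      simp only [Function.comp_apply, h6]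
      field_simp
    · filter_upwards [hU1, hXle, hUne] with j h1 h2 h3 i
      rw [norm_div, div_le_iff₀ (norm_pos_iff.2 h3)]
      exact (norm_perturb_term_le hY k h2 h1 i).trans_eq (by ring)
  have hlim : Tendsto (fun j => (∑' k, perturb Y k (X j) (U j)) / (U j - 1)) l
      (𝓝 (∑' k : ℕ, ∑' i : ℕ, levelDeriv k ((rho : ℂ) ^ (i + 2)))) := by
    simp_rw [← tsum_div_const]
    refine tendsto_tsum_of_dominated_convergence (bound := fun k => pertConst * lam ^ k)
      (summable_lam.mul_left _) hk ?_
    filter_upwards [hU1, hXle, hUne] with j h1 h2 h3 k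
    rw [norm_div, div_le_iff₀ (norm_pos_iff.2 h3)]
    exact (norm_perturb_le hY k h2 h1).trans_eq (by ring)
  convert! hlim using 2
  rw [← Summable.tsum_comm (f := fun (k i : ℕ) => levelDeriv k ((rho : ℂ) ^ (i + 2)))
    (summable_levelDeriv_prod (f := fun i => (rho : ℂ) ^ (i + 2)) rho_nonneg rho_lt_one
      (fun i => ?_) fun i => (hle i).le)]
  · have h1 : ∀ i : ℕ, ∑' k : ℕ, levelDeriv k ((rho : ℂ) ^ (i + 2))
        = (rho : ℂ) * ((rho : ℂ) ^ (i + 1) * deriv ySeries ((rho : ℂ) ^ (i + 2))) := fun i => by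
      have := levelDerivSum_eq_mul_deriv (hle i).le
      rw [levelDerivSum] at this
      rw [this]; ring
    rw [tsum_congr h1, tsum_mul_left,
      (hasSum_deriv_hSeries (by rw [norm_rho]; exact rho_lt_rhoOne)).tsum_eq, deriv_hSeries_rho,
      bConst_sq]
    have := rho_pos.ne'
    rw [← Complex.ofReal_mul]
    congr 1
    field_simp
    ring
  · rw [norm_pow, norm_rho]
    exact pow_le_pow_of_le_one rho_nonneg rho_lt_one.le (by omega)

end Perturb

/-! ### The recursion for the reciprocals -/

theorem norm_pow_sub_pow_le {a b : ℂ} (ha : ‖a‖ ≤ 1) (hb : ‖b‖ ≤ 1) (n : ℕ) :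
    ‖a ^ n - b ^ n‖ ≤ n * ‖a - b‖ := by
  induction n with
  | zero => simp
  | succ n ih =>
    have h : a ^ (n + 1) - b ^ (n + 1) = a ^ n * (a - b) + (a ^ n - b ^ n) * b := by ring
    rw [h]
    refine (norm_add_le _ _).trans ?_
    rw [norm_mul, norm_mul]
    have h1 := mul_le_of_le_one_left (norm_nonneg (a - b)) (norm_pow_le_one ha n)
    have h2 := mul_le_of_le_one_right (norm_nonneg (a ^ n - b ^ n)) hb
    push_cast
    linarith

theorem norm_pow_sub_one_le_exp (a : ℂ) (n : ℕ) : ‖a ^ n - 1‖ ≤ Real.exp (n * ‖a - 1‖) - 1 := by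
  have h0 : ‖a‖ ≤ 1 + ‖a - 1‖ := by
    calc ‖a‖ = ‖1 + (a - 1)‖ := by ring_nf
      _ ≤ _ := (norm_add_le _ _).trans (by simp)
  have h1 : ‖a ^ n - 1‖ ≤ (1 + ‖a - 1‖) ^ n - 1 := by
    induction n with
    | zero => simp
    | succ n ih =>
      have h : a ^ (n + 1) - 1 = a ^ n * (a - 1) + (a ^ n - 1) := by ring
      rw [h]
      refine (norm_add_le _ _).trans ?_
      rw [norm_mul, norm_pow]
      have : ‖a‖ ^ n * ‖a - 1‖ ≤ (1 + ‖a - 1‖) ^ n * ‖a - 1‖ := by gcongr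
      rw [pow_succ]
      linarith
  refine h1.trans (sub_le_sub_right ?_ 1)
  rw [Real.exp_nat_mul]
  gcongr
  linarith [Real.add_one_le_exp ‖a - 1‖]

theorem norm_exp_sub_quadratic_le {v : ℂ} (hv : ‖v‖ ≤ 1) :
    ‖Complex.exp v - 1 - v - v ^ 2 / 2‖ ≤ ‖v‖ ^ 3 := by
  have h := Complex.exp_bound hv (n := 3) (by norm_num)
  simp only [Finset.sum_range_succ, Finset.sum_range_zero, Nat.factorial] at h
  norm_num at h
  have h3 : Complex.exp v - 1 - v - v ^ 2 / 2 = Complex.exp v - (1 + v + v ^ 2 / 2) := by ring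
  rw [h3]
  nlinarith [pow_nonneg (norm_nonneg v) 3]

/-- Here p stands for y^j and q for y^j/v_j; the statement is 1/(e^v - 1) = 1/v - 1/2 + O(v) with an
additional relative error in v'. Writing v' = y v (1 + μ) with μ ≈ v/2 turns q into q/(1 + μ). -/
theorem reciprocal_step {y v v' q p : ℂ} (hy : y ≠ 0) (hv0 : v ≠ 0) (hv : ‖v‖ ≤ 1 / 4)
    (hd : ‖(v' - y * (Complex.exp v - 1)) / (y * v)‖ ≤ 1 / 4) (hq : q * v = p) :
    ∃ q', q' * v' = p * y ∧ ‖q' - (q - p / 2)‖ ≤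
      ‖q‖ * (4 * ‖v‖ ^ 2 + 3 * ‖(v' - y * (Complex.exp v - 1)) / (y * v)‖) := by
  set d := (v' - y * (Complex.exp v - 1)) / (y * v) with hddef
  set d1 := (Complex.exp v - 1 - v - v ^ 2 / 2) / v with hd1
  set μ := v / 2 + (d1 + d) with hμ
  have hd1n : ‖d1‖ ≤ ‖v‖ ^ 2 := by
    rw [hd1, norm_div, div_le_iff₀ (norm_pos_iff.2 hv0)]
    exact (norm_exp_sub_quadratic_le (hv.trans (by norm_num))).trans_eq (by ring)
  have hv' : v' = y * v * (1 + μ) := by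
    rw [hμ, hd1, hddef]
    field_simp
    ring
  have hv2 : ‖v‖ ^ 2 ≤ 1 / 16 := by nlinarith [norm_nonneg v]
  have hδ : ‖d1 + d‖ ≤ ‖v‖ ^ 2 + ‖d‖ := (norm_add_le _ _).trans (by linarith)
  have hμn : ‖μ‖ ≤ ‖v‖ / 2 + ‖d1 + d‖ := by
    refine (norm_add_le _ _).trans ?_
    rw [norm_div]; simp
  have hμ2 : ‖μ‖ ≤ 1 / 2 := by linarith
  have h1μ : 1 / 2 ≤ ‖1 + μ‖ := by
    have := norm_sub_le (1 + μ) μ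
    rw [add_sub_cancel_right, norm_one] at this
    linarith
  have hne : 1 + μ ≠ 0 := fun h => by rw [h, norm_zero] at h1μ; norm_num at h1μ
  refine ⟨q / (1 + μ), ?_, ?_⟩
  · rw [hv', ← hq]; field_simp
  · have h1 : q / (1 + μ) - (q - p / 2) = q * ((-(d1 + d) + μ * v / 2) / (1 + μ)) := by
      rw [← hq]
      field_simp
      rw [hμ]; ring
    rw [h1, norm_mul, norm_div]
    refine mul_le_mul_of_nonneg_left ?_ (norm_nonneg q)
    rw [div_le_iff₀ (by linarith)]
    have h2 : ‖-(d1 + d) + μ * v / 2‖ ≤ ‖d1 + d‖ + ‖μ‖ * ‖v‖ / 2 := by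
      refine (norm_add_le _ _).trans ?_
      rw [norm_neg, norm_div, norm_mul]; simp
    have h3 : ‖μ‖ * ‖v‖ ≤ (‖v‖ / 2 + ‖d1 + d‖) * ‖v‖ :=
      mul_le_mul_of_nonneg_right hμn (norm_nonneg v)
    have h4 : ‖d1 + d‖ * ‖v‖ ≤ ‖d1 + d‖ * (1 / 4) :=
      mul_le_mul_of_nonneg_left hv (norm_nonneg _)
    have h5 : 0 ≤ 4 * ‖v‖ ^ 2 + 3 * ‖d‖ := by positivity
    have h6 : (4 * ‖v‖ ^ 2 + 3 * ‖d‖) * (1 / 2) ≤ (4 * ‖v‖ ^ 2 + 3 * ‖d‖) * ‖1 + μ‖ :=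
      mul_le_mul_of_nonneg_left h1μ h5
    nlinarith [norm_nonneg d]

/-- A bootstrap: while the accumulated error is at most m₁/2, the quotient stays above m₁/2 in
modulus. Then |v_j| ≤ 2/m₁, so `herr` applies and the next error is controlled. -/
theorem reciprocal_recursion {y : ℂ} {v : ℕ → ℂ} {k : ℕ} {m₁ m₂ E r : ℝ} (hy : y ≠ 0)
    (hy1 : ‖y‖ ≤ 1) (hv0 : v 0 ≠ 0) (hr : 0 ≤ r) (hE : 0 ≤ E) (hm₁ : 8 ≤ m₁)
    (hm₂ : m₁ ≤ m₂)
    (hQ : ∀ j ≤ k, m₁ ≤ ‖1 / v 0 - (∑ i ∈ Finset.range j, y ^ i) / 2‖ ∧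
      ‖1 / v 0 - (∑ i ∈ Finset.range j, y ^ i) / 2‖ ≤ m₂)
    (herr : ∀ j < k, ‖v j‖ ≤ 2 / m₁ →
      ‖v (j + 1) - y * (Complex.exp (v j) - 1)‖ ≤ E * r ^ j * ‖y‖ ^ (j + 1))
    (hr1 : r < 1) (hE1 : 2 * m₂ * E ≤ 1 / 4)
    (hB : 8 * k / m₁ + 12 * m₂ ^ 2 * E / (1 - r) ≤ m₁ / 2) {j : ℕ} (hj : j ≤ k) :
    ∃ q, q * v j = y ^ j ∧ ‖q - (1 / v 0 - (∑ i ∈ Finset.range j, y ^ i) / 2)‖ ≤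
      8 * j / m₁ + 12 * m₂ ^ 2 * E * ∑ i ∈ Finset.range j, r ^ i := by
  induction j with
  | zero =>
    refine ⟨1 / v 0, by field_simp, ?_⟩
    simp
  | succ j ih =>
    obtain ⟨q, hq, hqb⟩ := ih (by omega)
    obtain ⟨hQ1, hQ2⟩ := hQ j (by omega)
    set Q := 1 / v 0 - (∑ i ∈ Finset.range j, y ^ i) / 2 with hQdef
    have hm0 : 0 < m₁ := by linarith
    have hm2 : 0 < m₂ := by linarith
    have hgeom : ∑ i ∈ Finset.range j, r ^ i ≤ 1 / (1 - r) := by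
      rw [one_div, ← tsum_geometric_of_lt_one hr hr1]
      exact (summable_geometric_of_lt_one hr hr1).sum_le_tsum _ fun i _ => pow_nonneg hr i
    have hBj : ‖q - Q‖ ≤ m₁ / 2 := by
      refine hqb.trans (le_trans ?_ hB)
      have h1 : (j : ℝ) ≤ k := by exact_mod_cast (by omega : j ≤ k)
      have h2 := mul_le_mul_of_nonneg_left hgeom (by positivity : 0 ≤ 12 * m₂ ^ 2 * E)
      rw [mul_one_div] at h2
      have h3 : 8 * (j : ℝ) / m₁ ≤ 8 * k / m₁ := by gcongr
      linarith
    have hq1 : m₁ / 2 ≤ ‖q‖ := by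
      have := norm_sub_norm_le Q q
      rw [norm_sub_rev Q q] at this
      linarith
    have hq2 : ‖q‖ ≤ 2 * m₂ := by
      have := norm_sub_norm_le q Q
      linarith
    have hqpos : 0 < ‖q‖ := by linarith
    have hvn : ‖q‖ * ‖v j‖ = ‖y‖ ^ j := by rw [← norm_mul, hq, norm_pow]
    have hypos : 0 < ‖y‖ := norm_pos_iff.2 hy
    have hvne : v j ≠ 0 := fun h => by
      rw [h, norm_zero, mul_zero] at hvn
      exact (pow_pos hypos j).ne hvn
    have hvpos : 0 < ‖v j‖ := norm_pos_iff.2 hvne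
    have hyj : ‖y‖ ^ j ≤ 1 := pow_le_one₀ hypos.le hy1
    have hvle : ‖v j‖ ≤ 2 / m₁ := by
      rw [le_div_iff₀ hm0]
      nlinarith
    have hv4 : ‖v j‖ ≤ 1 / 4 := by
      refine hvle.trans ?_
      rw [div_le_div_iff₀ hm0 (by norm_num)]; linarith
    have he := herr j (by omega) hvle
    set e := v (j + 1) - y * (Complex.exp (v j) - 1) with hedef
    have hd : ‖e / (y * v j)‖ ≤ ‖q‖ * (E * r ^ j) := by
      rw [norm_div, norm_mul, div_le_iff₀ (by positivity)]
      calc ‖e‖ ≤ E * r ^ j * ‖y‖ ^ (j + 1) := he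
        _ = _ := by rw [pow_succ, ← hvn]; ring
    have hrj : r ^ j ≤ 1 := pow_le_one₀ hr hr1.le
    have hEr : E * r ^ j ≤ E := mul_le_of_le_one_right hE hrj
    have hd4 : ‖e / (y * v j)‖ ≤ 1 / 4 := by
      refine hd.trans (le_trans ?_ hE1)
      gcongr
    obtain ⟨q', hq', hq'b⟩ := reciprocal_step hy hvne hv4 hd4 hq
    refine ⟨q', by rw [hq', pow_succ], ?_⟩
    have hs : 1 / v 0 - (∑ i ∈ Finset.range (j + 1), y ^ i) / 2 = Q - y ^ j / 2 := by
      rw [Finset.sum_range_succ, hQdef]; ring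
    have ht : q' - (Q - y ^ j / 2) = (q' - (q - y ^ j / 2)) + (q - Q) := by ring
    rw [hs, ht]
    refine (norm_add_le _ _).trans ?_
    -- The two error terms of `reciprocal_step` contribute 4 · 2/m₁ and 3 · (2m₂)² E r^j per step,
    -- hence the constants 8 and 12.
    have h1 : ‖q‖ * ‖v j‖ ^ 2 ≤ 2 / m₁ := by
      calc ‖q‖ * ‖v j‖ ^ 2 = ‖y‖ ^ j * ‖v j‖ := by rw [← hvn]; ring
        _ ≤ 1 * (2 / m₁) := by gcongr
        _ = _ := one_mul _
    have h2 : ‖q‖ * ‖e / (y * v j)‖ ≤ 4 * m₂ ^ 2 * (E * r ^ j) := by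
      calc _ ≤ ‖q‖ * (‖q‖ * (E * r ^ j)) := by gcongr
        _ ≤ (2 * m₂) * ((2 * m₂) * (E * r ^ j)) := by gcongr
        _ = _ := by ring
    rw [Finset.sum_range_succ]
    push_cast
    have h3 : 8 * ((j : ℝ) + 1) / m₁ = 8 * j / m₁ + 4 * (2 / m₁) := by ring
    rw [h3]
    nlinarith

/-! ### Comparison of the powers of `y` with exponentials -/

/-- With ω = cz/n, y agrees with e^{-ω} to second order. The sector condition makes both of modulus
at most 1, so taking j-th powers multiplies the error by at most j. -/
theorem norm_geom_sub_le {c σ M : ℝ} {n : ℝ} {z y : ℂ} (hc : 0 < c) (hσ : 0 < σ) (hM : 0 ≤ M)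
    (hn : 0 < n) (hz : z ≠ 0) (hre : σ * ‖z‖ ≤ z.re) (hy : ‖y - (1 - c * z / n)‖ ≤ M * (‖z‖ / n) ^ 2)
    (h1 : c * (‖z‖ / n) ≤ 1) (h2 : c * (‖z‖ / n) ≤ σ) (h3 : M * (‖z‖ / n) ≤ σ * c / 2)
    (h4 : M * (‖z‖ / n) ≤ c / 2) :
    ‖y‖ ≤ 1 ∧ ‖1 - y‖ ≤ 2 * c * (‖z‖ / n) ∧
    ‖y - Complex.exp (-(c * z / n))‖ ≤ (M + c ^ 2) * (‖z‖ / n) ^ 2 ∧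
    ∀ j : ℕ, ‖∑ i ∈ Finset.range j, y ^ i - (1 - Complex.exp (-(j * (c * z / n)))) / (c * z / n)‖
      ≤ 4 * M / c ^ 2 + (j / n) * (M + c ^ 2) * ‖z‖ / c := by
  set ω : ℂ := c * z / n with hω
  set m := ‖z‖ / n with hm
  have hzpos : 0 < ‖z‖ := norm_pos_iff.2 hz
  have hmpos : 0 < m := div_pos hzpos hn
  have hωn : ‖ω‖ = c * m := by
    rw [hω, norm_div, norm_mul, Complex.norm_real, Complex.norm_real, Real.norm_of_nonneg hc.le,
      Real.norm_of_nonneg hn.le, hm, mul_div_assoc]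
  have hωne : ω ≠ 0 := norm_pos_iff.1 (by rw [hωn]; positivity)
  have hωre : σ * (c * m) ≤ ω.re := by
    have : ω = ((c / n : ℝ) : ℂ) * z := by rw [hω]; push_cast; ring
    rw [this, Complex.re_ofReal_mul, hm]
    calc σ * (c * (‖z‖ / n)) = c / n * (σ * ‖z‖) := by ring
      _ ≤ c / n * z.re := by gcongr
  have hωre0 : 0 ≤ ω.re := le_trans (by positivity) hωre
  have hexp1 : ‖Complex.exp (-ω)‖ ≤ 1 := by
    rw [Complex.norm_exp, Real.exp_le_one_iff, Complex.neg_re]; linarith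
  have hexp2 : ‖Complex.exp (-ω) - (1 - ω)‖ ≤ c ^ 2 * m ^ 2 := by
    have := Complex.norm_exp_sub_one_sub_id_le (x := -ω) (by rw [norm_neg, hωn]; exact h1)
    rw [norm_neg, hωn, mul_pow] at this
    refine le_trans (le_of_eq ?_) this
    congr 1; ring
  have hyexp : ‖y - Complex.exp (-ω)‖ ≤ (M + c ^ 2) * m ^ 2 := by
    have : y - Complex.exp (-ω) = (y - (1 - ω)) - (Complex.exp (-ω) - (1 - ω)) := by ring
    rw [this]
    exact (norm_sub_le _ _).trans (by linarith)
  -- |ω|² ≤ σ|ω| ≤ Re ω, so |1 - ω|² ≤ 1 - σ|ω|.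
  have h1ω : ‖1 - ω‖ ≤ 1 - σ * (c * m) / 2 := by
    have hσ1 : ω.re ≤ c * m := hωn ▸ Complex.re_le_norm ω
    have h5 : 0 ≤ 1 - σ * (c * m) / 2 := by linarith
    rw [← sq_le_sq₀ (norm_nonneg _) h5, Complex.sq_norm, Complex.normSq_apply]
    have h6 : ω.re * ω.re + ω.im * ω.im = (c * m) ^ 2 := by
      rw [← Complex.normSq_apply, ← Complex.sq_norm, hωn]
    simp only [Complex.sub_re, Complex.one_re, Complex.sub_im, Complex.one_im]
    have h7 : (c * m) ^ 2 ≤ σ * (c * m) := by nlinarith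
    nlinarith [sq_nonneg (σ * (c * m) / 2)]
  have hy1 : ‖y‖ ≤ 1 := by
    have h5 : ‖y‖ ≤ ‖1 - ω‖ + ‖y - (1 - ω)‖ := by
      calc ‖y‖ = ‖(1 - ω) + (y - (1 - ω))‖ := by ring_nf
        _ ≤ _ := norm_add_le _ _
    have h6 : M * m ^ 2 ≤ σ * c / 2 * m := by nlinarith
    nlinarith
  have h1y : ‖(1 - y) - ω‖ ≤ M * m ^ 2 := by
    rw [norm_sub_rev]
    refine le_trans (le_of_eq ?_) hy
    congr 1; ring
  have hMm : M * m ^ 2 ≤ c / 2 * m := by nlinarith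
  have h1ylow : c * m / 2 ≤ ‖1 - y‖ := by
    have := norm_sub_norm_le ω (1 - y)
    rw [norm_sub_rev ω, hωn] at this
    linarith
  have h1yup : ‖1 - y‖ ≤ 2 * c * m := by
    have := norm_sub_norm_le (1 - y) ω
    rw [hωn] at this
    nlinarith
  refine ⟨hy1, h1yup, hyexp, fun j => ?_⟩
  have h1yne : 1 - y ≠ 0 := norm_pos_iff.1 (lt_of_lt_of_le (by positivity) h1ylow)
  have hyne : y ≠ 1 := fun h => h1yne (by rw [h, sub_self])
  have hpow : Complex.exp (-(j * ω)) = Complex.exp (-ω) ^ j := by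
    rw [← Complex.exp_nat_mul]; ring_nf
  have hsum : ∑ i ∈ Finset.range j, y ^ i = (1 - y ^ j) / (1 - y) := by
    rw [geom_sum_eq hyne, ← neg_sub (1 : ℂ) y, ← neg_sub (1 : ℂ) (y ^ j), neg_div_neg_eq]
  rw [hsum, hpow]
  -- The first term replaces the denominator 1 - y by ω, the second the powers of y by those of
  -- e^{-ω}.
  have hdecomp : (1 - y ^ j) / (1 - y) - (1 - Complex.exp (-ω) ^ j) / ω
      = (1 - y ^ j) * ((ω - (1 - y)) / ((1 - y) * ω)) - (y ^ j - Complex.exp (-ω) ^ j) / ω := by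
    field_simp
    ring
  rw [hdecomp]
  refine (norm_sub_le _ _).trans (add_le_add ?_ ?_)
  · rw [norm_mul, norm_div, norm_mul, norm_sub_rev ω, hωn]
    have h5 : ‖1 - y ^ j‖ ≤ 2 := (norm_sub_le _ _).trans (by
      rw [norm_one]; linarith [norm_pow_le_one hy1 j])
    calc ‖1 - y ^ j‖ * (‖1 - y - ω‖ / (‖1 - y‖ * (c * m)))
        ≤ 2 * (M * m ^ 2 / (c * m / 2 * (c * m))) := by gcongr
      _ = 4 * M / c ^ 2 := by field_simp; ring
  · rw [norm_div, hωn]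
    calc ‖y ^ j - Complex.exp (-ω) ^ j‖ / (c * m)
        ≤ j * ((M + c ^ 2) * m ^ 2) / (c * m) := by
          gcongr
          exact (norm_pow_sub_pow_le hy1 hexp1 j).trans (by gcongr)
      _ = j * (M + c ^ 2) * m / c := by field_simp
      _ = (j / n) * (M + c ^ 2) * ‖z‖ / c := by rw [hm]; ring

/-! ### The limiting reciprocal -/

/-- The limit of the rescaled reciprocals of the level functions. -/
noncomputable def limRecip (c : ℝ) (a : ℂ) (κ : ℝ) (z : ℂ) : ℂ :=
  1 / a - (1 - Complex.exp (-(κ * (c * z)))) / (2 * (c * z))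

theorem norm_one_sub_exp_neg_le {ζ : ℂ} (h : 0 ≤ ζ.re) : ‖1 - Complex.exp (-ζ)‖ ≤ ‖ζ‖ := by
  have := norm_exp_sub_exp_le (a := 0) (b := -ζ) (M := 0) (by simp) (by simpa using h)
  simpa using this

theorem norm_limRecip_le {c κ K : ℝ} {a z : ℂ} (hc : 0 < c) (h0 : 0 ≤ κ) (hK : κ ≤ K)
    (hz : z ≠ 0) (hre : 0 ≤ z.re) : ‖limRecip c a κ z‖ ≤ 1 / ‖a‖ + K / 2 := by
  have hzpos : 0 < ‖z‖ := norm_pos_iff.2 hz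
  refine (norm_sub_le _ _).trans (add_le_add (by simp) ?_)
  have h1 : ‖1 - Complex.exp (-(κ * (c * z)))‖ ≤ κ * (c * ‖z‖) := by
    refine (norm_one_sub_exp_neg_le ?_).trans_eq ?_
    · rw [Complex.re_ofReal_mul, Complex.re_ofReal_mul]; positivity
    · simp [abs_of_nonneg h0, abs_of_pos hc]
  have h2 : ‖2 * ((c : ℂ) * z)‖ = 2 * (c * ‖z‖) := by simp [abs_of_pos hc]
  rw [norm_div, h2, div_le_iff₀ (by positivity)]
  have : 0 ≤ c * ‖z‖ := by positivity
  nlinarith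

theorem norm_limRecip_sub_le {c κ κ' : ℝ} {a z : ℂ} (hc : 0 < c) (h0 : 0 ≤ κ) (h0' : 0 ≤ κ')
    (hz : z ≠ 0) (hre : 0 ≤ z.re) :
    ‖limRecip c a κ z - limRecip c a κ' z‖ ≤ |κ - κ'| / 2 := by
  have hzpos : 0 < ‖z‖ := norm_pos_iff.2 hz
  have h1 : limRecip c a κ z - limRecip c a κ' z = (Complex.exp (-(κ * (c * z)))
      - Complex.exp (-(κ' * (c * z)))) / (2 * (c * z)) := by
    rw [limRecip, limRecip]; ring
  have hn : ∀ r : ℝ, 0 ≤ r → (-((r : ℂ) * (c * z))).re ≤ 0 := fun r hr => by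
    rw [Complex.neg_re, Complex.re_ofReal_mul, Complex.re_ofReal_mul]
    have : 0 ≤ r * (c * z.re) := by positivity
    linarith
  have h2 := norm_exp_sub_exp_le (hn κ h0) (hn κ' h0')
  have h3 : -((κ : ℂ) * (c * z)) - -((κ' : ℂ) * (c * z)) = -(((κ - κ' : ℝ) : ℂ) * (c * z)) := by
    push_cast; ring
  have h4 : ‖(c : ℂ) * z‖ = c * ‖z‖ := by simp [abs_of_pos hc]
  rw [h3, norm_neg, norm_mul, h4, Real.exp_zero, one_mul, Complex.norm_real, Real.norm_eq_abs] at h2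
  rw [h1, norm_div, norm_mul, h4, div_le_iff₀ (by simp; positivity)]
  refine h2.trans_eq ?_
  simp only [Complex.norm_ofNat]
  ring

/-- The expression extends continuously to z = 0 with value 1/a - κ/2, so compactness gives a bound
on the part of the closed sector with |z| ≤ R. For |z| > R the fraction is at most half of 1/|a|. -/
theorem exists_le_norm_limRecip {c σ K : ℝ} {a : ℂ} (hc : 0 < c) (ha : a ≠ 0)
    (h : ∀ κ : ℝ, 0 ≤ κ → κ ≤ K → ∀ z : ℂ, z ≠ 0 → σ * ‖z‖ ≤ z.re → limRecip c a κ z ≠ 0)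
    (h0 : ∀ κ : ℝ, 0 ≤ κ → κ ≤ K → 1 / a - κ / 2 ≠ 0) (hσ : 0 < σ) :
    ∃ c₁ > 0, ∀ κ : ℝ, 0 ≤ κ → κ ≤ K → ∀ z : ℂ, z ≠ 0 → σ * ‖z‖ ≤ z.re →
      c₁ ≤ ‖limRecip c a κ z‖ := by
  let e : ℂ → ℂ := fun ζ => 1 - Complex.exp (-ζ)
  have he' : HasDerivAt e 1 0 := by
    convert! ((hasDerivAt_id (0 : ℂ)).neg.cexp).const_sub 1 using 1
    simp
  have hec : Continuous (dslope e 0) := by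
    rw [← continuousOn_univ]
    exact (continuousOn_dslope univ_mem).2 ⟨by fun_prop, he'.differentiableAt⟩
  have he0 : dslope e 0 0 = 1 := by rw [dslope_same, he'.deriv]
  have hemul : ∀ ζ, e ζ = ζ * dslope e 0 ζ := fun ζ => by
    have := sub_smul_dslope e 0 ζ
    simp only [sub_zero, smul_eq_mul] at this
    rw [this]; simp [e]
  let G : ℝ × ℂ → ℂ := fun p => 1 / a - p.1 / 2 * dslope e 0 (p.1 * (c * p.2))
  have hG : Continuous G := by
    refine continuous_const.sub (Continuous.mul (by fun_prop) (hec.comp (by fun_prop)))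
  have hGF : ∀ (κ : ℝ) (z : ℂ), z ≠ 0 → G (κ, z) = limRecip c a κ z := fun κ z hz => by
    have h1 : 1 - Complex.exp (-(κ * (c * z))) = κ * (c * z) * dslope e 0 (κ * (c * z)) :=
      hemul _
    have hc' : (c : ℂ) ≠ 0 := by exact_mod_cast hc.ne'
    simp only [G, limRecip, h1]
    field_simp
  have hapos : 0 < ‖a‖ := norm_pos_iff.2 ha
  -- The numerator is at most 2 in modulus, so the fraction is at most 1/(c|z|), and c|z| ≥ 2|a|
  -- beyond R.
  let R := 2 * ‖a‖ / c
  let Z : Set ℂ := {z | σ * ‖z‖ ≤ z.re} ∩ Metric.closedBall 0 R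
  have hZ : IsCompact Z := (isCompact_closedBall (0 : ℂ) R).inter_left
    (isClosed_le (by fun_prop) Complex.continuous_re)
  obtain ⟨c', hc', hmin⟩ := ((isCompact_Icc (a := (0 : ℝ)) (b := K)).prod hZ).exists_forall_le'
    (f := fun p => ‖G p‖) hG.norm.continuousOn (a := 0) (by
      rintro ⟨κ, z⟩ ⟨hκ, hz⟩
      rw [norm_pos_iff]
      rcases eq_or_ne z 0 with rfl | hz0
      · simp only [G, mul_zero, he0, mul_one]
        exact h0 κ hκ.1 hκ.2
      · rw [hGF κ z hz0]
        exact h κ hκ.1 hκ.2 z hz0 hz.1)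
  refine ⟨min c' (1 / (2 * ‖a‖)), lt_min hc' (by positivity), fun κ hκ0 hκK z hz hre => ?_⟩
  rcases le_or_gt ‖z‖ R with hR | hR
  · rw [← hGF κ z hz]
    exact (min_le_left _ _).trans (hmin (κ, z) ⟨⟨hκ0, hκK⟩, hre, by simpa using hR⟩)
  · refine (min_le_right _ _).trans ?_
    have hzpos : 0 < ‖z‖ := norm_pos_iff.2 hz
    have hzre : 0 ≤ z.re := le_trans (by positivity) hre
    have h1 : ‖1 - Complex.exp (-(κ * (c * z)))‖ ≤ 2 := by
      refine (norm_sub_le _ _).trans ?_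
      rw [norm_one, Complex.norm_exp, Complex.neg_re, Complex.re_ofReal_mul, Complex.re_ofReal_mul]
      have : Real.exp (-(κ * (c * z.re))) ≤ 1 := Real.exp_le_one_iff.2 (by
        have : 0 ≤ κ * (c * z.re) := by positivity
        linarith)
      linarith
    have h2 : ‖(1 - Complex.exp (-(κ * (c * z)))) / (2 * (c * z))‖ ≤ 1 / (2 * ‖a‖) := by
      have h3 : ‖2 * ((c : ℂ) * z)‖ = 2 * (c * ‖z‖) := by simp [abs_of_pos hc]
      rw [norm_div, h3, div_le_div_iff₀ (by positivity) (by positivity)]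
      have h4 : 2 * ‖a‖ < c * ‖z‖ := by
        have := (div_lt_iff₀ hc).1 hR
        linarith
      nlinarith
    have h5 := norm_sub_norm_le (1 / a) ((1 - Complex.exp (-(κ * (c * z)))) / (2 * (c * z)))
    rw [← limRecip, norm_div, norm_one] at h5
    have h6 : 1 / ‖a‖ = 1 / (2 * ‖a‖) + 1 / (2 * ‖a‖) := by field_simp; norm_num
    linarith

/-! ### Asymptotics of a perturbed recursion -/

theorem tail_bound {S : ℕ → ℂ} {A q : ℝ} (hq0 : 0 ≤ q) (hq1 : q < 1)
    (hS : ∀ i, ‖S i‖ ≤ A * q ^ i) (i : ℕ) :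
    ‖∑' m, S (i + m)‖ ≤ A / (1 - q) * q ^ i ∧ ∑' m, S (i + m) = S i + ∑' m, S (i + 1 + m) := by
  have hs : Summable S :=
    Summable.of_norm_bounded ((summable_geometric_of_lt_one hq0 hq1).mul_left A) hS
  have hs' : Summable fun m => S (i + m) := by
    simpa [add_comm] using (summable_nat_add_iff i).2 hs
  constructor
  · refine (tsum_of_norm_bounded ((hasSum_geometric_of_lt_one hq0 hq1).mul_left (A * q ^ i))
      fun m => ?_).trans_eq ?_
    · exact (hS _).trans_eq (by rw [pow_add]; ring)
    · rw [div_eq_mul_inv]; ring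
  · rw [hs'.tsum_eq_zero_add]
    simp only [add_zero]
    congr 1
    exact tsum_congr fun m => by congr 1; ring

/-- The derivative of y(e^{v-R} - 1) + R in R is 1 - y e^{v-R}, which is small for y near 1 and v, R
near 0. Moving the perturbations into v therefore gains a factor of order |1 - y| + |v| + |R|. -/
theorem norm_perturbed_step_le {y v R : ℂ} (hy : ‖y‖ ≤ 1) (hv : ‖v‖ ≤ 1) (hR : ‖R‖ ≤ 1) :
    ‖y * (Complex.exp (v - R) - 1) + R - y * (Complex.exp v - 1)‖
      ≤ ‖R‖ * (‖1 - y‖ + 2 * ‖v‖ + 3 * ‖R‖) := by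
  have h1 : y * (Complex.exp (v - R) - 1) + R - y * (Complex.exp v - 1)
      = R * ((1 - y) - y * (Complex.exp v - 1))
        + y * Complex.exp v * (Complex.exp (-R) - 1 - -R) := by
    rw [sub_eq_add_neg v R, Complex.exp_add]; ring
  have h2 := Complex.norm_exp_sub_one_le hv
  have h3 := Complex.norm_exp_sub_one_sub_id_le (x := -R) (by rwa [norm_neg])
  rw [norm_neg] at h3
  have h4 : ‖Complex.exp v‖ ≤ 3 := by
    rw [Complex.norm_exp]
    refine (Real.exp_le_exp.2 ((Complex.re_le_norm v).trans hv)).trans ?_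
    exact Real.exp_one_lt_d9.le.trans (by norm_num)
  have h5 : ‖y * (Complex.exp v - 1)‖ ≤ 2 * ‖v‖ := by
    rw [norm_mul]
    exact (mul_le_of_le_one_left (norm_nonneg _) hy).trans h2
  have h6 : ‖y * Complex.exp v‖ ≤ 3 := by
    rw [norm_mul]
    exact (mul_le_of_le_one_left (norm_nonneg _) hy).trans h4
  rw [h1]
  calc _ ≤ ‖R‖ * (‖1 - y‖ + 2 * ‖v‖) + 3 * ‖R‖ ^ 2 := by
        refine (norm_add_le _ _).trans (add_le_add ?_ ?_)
        · rw [norm_mul]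
          gcongr
          exact (norm_sub_le _ _).trans (by linarith)
        · rw [norm_mul]
          gcongr
    _ = _ := by ring

/-- Comparison of the partial sums with the limiting reciprocal. -/
theorem norm_reciprocal_sub_limRecip_le {y z a v : ℂ} {c M K n ε : ℝ} {j : ℕ} (hc : 0 < c)
    (hM : 0 ≤ M) (hn : 0 < n) (hz : z ≠ 0) (hj : (j : ℝ) / n ≤ K)
    (hgeom : ‖∑ i ∈ Finset.range j, y ^ i - (1 - Complex.exp (-(j * (c * z / n)))) / (c * z / n)‖
      ≤ 4 * M / c ^ 2 + (j / n) * (M + c ^ 2) * ‖z‖ / c)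
    (hε : ‖1 / (v * n) - 1 / a‖ + (4 * M / c ^ 2 + K * (M + c ^ 2) * ‖z‖ / c) / (2 * n) ≤ ε) :
    ‖(1 / v - (∑ i ∈ Finset.range j, y ^ i) / 2) - n * limRecip c a (j / n) z‖ ≤ n * ε := by
  have hnC : (n : ℂ) ≠ 0 := by exact_mod_cast hn.ne'
  have hcC : (c : ℂ) ≠ 0 := by exact_mod_cast hc.ne'
  have e1 : (1 / v - (∑ i ∈ Finset.range j, y ^ i) / 2) - n * limRecip c a (j / n) z
      = n * (1 / (v * n) - 1 / a) - (∑ i ∈ Finset.range j, y ^ i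
        - (1 - Complex.exp (-(j * (c * z / n)))) / (c * z / n)) / 2 := by
    have e2 : (((j : ℝ) / n : ℝ) : ℂ) * (c * z) = j * (c * z / n) := by push_cast; ring
    rw [limRecip, e2]
    field_simp
    ring
  rw [e1]
  refine (norm_sub_le _ _).trans ?_
  rw [norm_mul, norm_div, Complex.norm_real, Real.norm_of_nonneg hn.le, Complex.norm_ofNat]
  refine le_trans ?_ (mul_le_mul_of_nonneg_left hε hn.le)
  rw [mul_add]
  refine add_le_add le_rfl ?_
  have e4 : (j : ℝ) / n * (M + c ^ 2) * ‖z‖ / c ≤ K * (M + c ^ 2) * ‖z‖ / c := by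
    gcongr
  calc _ ≤ (4 * M / c ^ 2 + K * (M + c ^ 2) * ‖z‖ / c) / 2 := by linarith
    _ = _ := by field_simp

/-- The error in the recursion for the smoothed levels. -/
theorem norm_smoothed_step_le {y v v' R : ℂ} {c c₁ D₁ H n q m : ℝ} {j : ℕ} (hD : 0 ≤ D₁)
    (hn : 0 < n) (hc₁ : 0 < c₁) (hq0 : 0 < q) (hq1 : q < 1) (hy1 : ‖y‖ ≤ 1)
    (hy1' : ‖1 - y‖ ≤ 2 * c * (m / n)) (hy2 : 1 / 2 ≤ ‖y‖) (hqy : q ≤ (1 + q) / 2 * ‖y‖)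
    (hn8 : 8 ≤ c₁ / 2 * n) (hDn : D₁ / n ≤ 1)
    (hH : 2 * c * m + 8 / c₁ + 3 * D₁ ≤ H)
    (hv : ‖v‖ ≤ 2 / (c₁ / 2 * n)) (hR : ‖R‖ ≤ D₁ / n * q ^ j)
    (hstep : v' = y * (Complex.exp (v - R) - 1) + R) :
    ‖v' - y * (Complex.exp v - 1)‖
      ≤ 2 * D₁ * H / n ^ 2 * ((1 + q) / 2) ^ j * ‖y‖ ^ (j + 1) := by
  have hRn : ‖R‖ ≤ D₁ / n := hR.trans (mul_le_of_le_one_right (by positivity)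
    (pow_le_one₀ hq0.le hq1.le))
  have hv4 : 2 / (c₁ / 2 * n) = 4 / c₁ / n := by field_simp; norm_num
  have hv1 : ‖v‖ ≤ 1 := by
    refine hv.trans ?_
    rw [div_le_one (by positivity)]; linarith
  rw [hv4] at hv
  rw [hstep]
  refine (norm_perturbed_step_le hy1 hv1 (hRn.trans hDn)).trans ?_
  have e1 : ‖1 - y‖ + 2 * ‖v‖ + 3 * ‖R‖ ≤ H / n := by
    calc _ ≤ 2 * c * (m / n) + 2 * (4 / c₁ / n) + 3 * (D₁ / n) := by linarith
      _ = (2 * c * m + 8 / c₁ + 3 * D₁) / n := by ring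
      _ ≤ _ := by gcongr
  have e2 : q ^ j ≤ 2 * (((1 + q) / 2) ^ j * ‖y‖ ^ (j + 1)) := by
    calc q ^ j ≤ ((1 + q) / 2 * ‖y‖) ^ j := pow_le_pow_left₀ hq0.le hqy j
      _ = ((1 + q) / 2) ^ j * ‖y‖ ^ j * 1 := by rw [mul_pow, mul_one]
      _ ≤ ((1 + q) / 2) ^ j * ‖y‖ ^ j * (2 * ‖y‖) := by gcongr; linarith
      _ = _ := by ring
  have e3 : 0 ≤ H / n := le_trans (by positivity) e1
  calc ‖R‖ * (‖1 - y‖ + 2 * ‖v‖ + 3 * ‖R‖)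
      ≤ (D₁ / n * q ^ j) * (H / n) := by gcongr
    _ ≤ (D₁ / n * (2 * (((1 + q) / 2) ^ j * ‖y‖ ^ (j + 1)))) * (H / n) := by gcongr
    _ = _ := by field_simp

/-- The reciprocals of the smoothed levels, with explicit error bounds. -/
theorem smoothed_reciprocal_bound {w S : ℕ → ℂ} {y z a : ℂ} {c σ M D q K c₁ c₂ n : ℝ} {k : ℕ}
    (hc : 0 < c) (hσ : 0 < σ) (hM : 0 ≤ M) (hD : 0 ≤ D) (hq0 : 0 < q) (hq1 : q < 1)
    (hc₁ : 0 < c₁) (hc₁₂ : c₁ ≤ c₂) (hn : 0 < n) (hkK : (k : ℝ) ≤ K * n)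
    (hz : z ≠ 0) (hre : σ * ‖z‖ ≤ z.re)
    (hy : ‖y - (1 - c * z / n)‖ ≤ M * (‖z‖ / n) ^ 2)
    (hw : ∀ i, w (i + 1) = y * (Complex.exp (w i + S i) - 1))
    (hS : ∀ i, ‖S i‖ ≤ D / n * q ^ i)
    (hF : ∀ κ : ℝ, 0 ≤ κ → κ ≤ K → c₁ ≤ ‖limRecip c a κ z‖ ∧ ‖limRecip c a κ z‖ ≤ c₂)
    (h1 : c * (‖z‖ / n) ≤ 1) (h2 : c * (‖z‖ / n) ≤ σ) (h3 : M * (‖z‖ / n) ≤ σ * c / 2)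
    (h4 : M * (‖z‖ / n) ≤ c / 2) (hy2 : 1 / 2 ≤ ‖y‖) (hqy : q ≤ (1 + q) / 2 * ‖y‖)
    (hv0 : w 0 + ∑' i, S i ≠ 0)
    {ε : ℝ} (hε : ‖1 / ((w 0 + ∑' i, S i) * n) - 1 / a‖
      + (4 * M / c ^ 2 + K * (M + c ^ 2) * ‖z‖ / c) / (2 * n) ≤ ε)
    (hε1 : ε ≤ c₁ / 2) (hn8 : 8 ≤ c₁ / 2 * n) (hDn : D / (1 - q) / n ≤ 1)
    {H : ℝ} (hH : 2 * c * ‖z‖ + 8 / c₁ + 3 * (D / (1 - q)) ≤ H)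
    (hH1 : 8 * c₂ * (D / (1 - q)) * (H / n) ≤ 1 / 4)
    {B : ℝ} (hB : 16 * K / c₁ + 192 * c₂ ^ 2 * (D / (1 - q)) * H / (1 - q) ≤ B)
    (hB1 : B ≤ c₁ / 4 * n) :
    ∃ p, p * (w k + ∑' m, S (k + m)) = y ^ k ∧ ‖p - n * limRecip c a (k / n) z‖ ≤ B + n * ε := by
  obtain ⟨hy1, hy1', hyexp, hgeom⟩ := norm_geom_sub_le hc hσ hM hn hz hre hy h1 h2 h3 h4
  have htail := tail_bound hq0.le hq1 hS
  set D₁ := D / (1 - q) with hD₁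
  have h1q : 0 < 1 - q := by linarith
  have hD₁0 : 0 ≤ D₁ := by positivity
  have hDD : D / n / (1 - q) = D₁ / n := by rw [hD₁]; field_simp
  rw [hDD] at htail
  -- Smoothed levels: all perturbations still to come are added in advance.
  let v : ℕ → ℂ := fun i => w i + ∑' m, S (i + m)
  have hv0' : v 0 = w 0 + ∑' i, S i := by simp [v]
  have hc₂ : 0 < c₂ := by linarith
  have hzpos : 0 < ‖z‖ := norm_pos_iff.2 hz
  have hH0 : 0 ≤ H := le_trans (by positivity) hH
  have hK0 : 0 ≤ K := by
    have : 0 ≤ K * n := le_trans (Nat.cast_nonneg k) hkK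
    exact nonneg_of_mul_nonneg_left this hn
  have hyne : y ≠ 0 := norm_pos_iff.1 (by linarith)
  have hjn : ∀ j ≤ k, (j : ℝ) / n ≤ K := fun j hj => by
    rw [div_le_iff₀ hn]
    exact (by exact_mod_cast hj : (j : ℝ) ≤ k).trans hkK
  have hQF : ∀ j ≤ k, ‖(1 / v 0 - (∑ i ∈ Finset.range j, y ^ i) / 2)
      - n * limRecip c a (j / n) z‖ ≤ n * ε := fun j hj =>
    norm_reciprocal_sub_limRecip_le hc hM hn hz (hjn j hj) (hgeom j) (by rwa [hv0'])
  have hQ : ∀ j ≤ k, c₁ / 2 * n ≤ ‖1 / v 0 - (∑ i ∈ Finset.range j, y ^ i) / 2‖ ∧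
      ‖1 / v 0 - (∑ i ∈ Finset.range j, y ^ i) / 2‖ ≤ 2 * c₂ * n := fun j hj => by
    have e1 := hQF j hj
    obtain ⟨f1, f2⟩ := hF (j / n) (by positivity) (hjn j hj)
    set Q := 1 / v 0 - (∑ i ∈ Finset.range j, y ^ i) / 2
    have e2 : ‖(n : ℂ) * limRecip c a (j / n) z‖ = n * ‖limRecip c a (j / n) z‖ := by
      rw [norm_mul, Complex.norm_real, Real.norm_of_nonneg hn.le]
    have e3 := norm_sub_norm_le Q ((n : ℂ) * limRecip c a (j / n) z)
    have e4 := norm_sub_norm_le ((n : ℂ) * limRecip c a (j / n) z) Q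
    rw [norm_sub_rev _ Q] at e4
    rw [e2] at e3 e4
    have g1 : n * c₁ ≤ n * ‖limRecip c a (j / n) z‖ := mul_le_mul_of_nonneg_left f1 hn.le
    have g2 : n * ‖limRecip c a (j / n) z‖ ≤ n * c₂ := mul_le_mul_of_nonneg_left f2 hn.le
    have g3 : n * ε ≤ n * (c₁ / 2) := mul_le_mul_of_nonneg_left hε1 hn.le
    have g4 : n * c₁ ≤ n * c₂ := mul_le_mul_of_nonneg_left hc₁₂ hn.le
    have g5 : 0 ≤ n * c₁ := by positivity
    constructor <;> linarith
  -- A rate strictly between q and 1: the errors must be measured against |y|^j, and q ≤ r|y| lets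
  -- q^j ≤ r^j |y|^j while r remains below 1.
  set r := (1 + q) / 2 with hr
  have hr0 : 0 < r := by positivity
  have hr1 : r < 1 := by rw [hr]; linarith
  have herr : ∀ j < k, ‖v j‖ ≤ 2 / (c₁ / 2 * n) →
      ‖v (j + 1) - y * (Complex.exp (v j) - 1)‖ ≤ 2 * D₁ * H / n ^ 2 * r ^ j * ‖y‖ ^ (j + 1) := by
    intro j _ hvj
    refine norm_smoothed_step_le (c := c) (m := ‖z‖) (R := ∑' m, S (j + 1 + m)) hD₁0 hn hc₁ hq0 hq1
      hy1 hy1' hy2 hqy hn8 hDn hH hvj ?_ ?_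
    · refine (htail (j + 1)).1.trans ?_
      have : q ^ (j + 1) ≤ q ^ j := pow_le_pow_of_le_one hq0.le hq1.le (Nat.le_succ j)
      gcongr
    · have hvv : w j + S j = v j - ∑' m, S (j + 1 + m) := by
        simp only [v, (htail j).2]; ring
      rw [← hvv, ← hw j]
  have h1r : 1 - r = (1 - q) / 2 := by rw [hr]; ring
  have hBm : 8 * (k : ℝ) / (c₁ / 2 * n) + 12 * (2 * c₂ * n) ^ 2 * (2 * D₁ * H / n ^ 2) / (1 - r)
      ≤ B := by
    refine le_trans (add_le_add ?_ (le_of_eq ?_)) hB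
    · calc 8 * (k : ℝ) / (c₁ / 2 * n) ≤ 8 * (K * n) / (c₁ / 2 * n) := by gcongr
        _ = 16 * K / c₁ := by field_simp; ring
    · rw [h1r]; field_simp; ring
  have hm : c₁ / 2 * n ≤ 2 * c₂ * n := by
    have : c₁ * n ≤ c₂ * n := mul_le_mul_of_nonneg_right hc₁₂ hn.le
    linarith [mul_pos hc₁ hn]
  obtain ⟨p, hp, hpb⟩ := reciprocal_recursion (v := v) (k := k) (m₁ := c₁ / 2 * n)
    (m₂ := 2 * c₂ * n) (E := 2 * D₁ * H / n ^ 2) (r := r) hyne hy1 (by rwa [hv0']) hr0.le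
    (by positivity) hn8 hm hQ herr hr1
    (by refine le_trans (le_of_eq ?_) hH1
        field_simp; ring) (hBm.trans (by linarith)) le_rfl
  refine ⟨p, hp, ?_⟩
  have hgeo : ∑ i ∈ Finset.range k, r ^ i ≤ 1 / (1 - r) := by
    rw [one_div, ← tsum_geometric_of_lt_one hr0.le hr1]
    exact (summable_geometric_of_lt_one hr0.le hr1).sum_le_tsum _ fun i _ => pow_nonneg hr0.le i
  have e1 : p - n * limRecip c a (k / n) z = (p - (1 / v 0 - (∑ i ∈ Finset.range k, y ^ i) / 2))
      + ((1 / v 0 - (∑ i ∈ Finset.range k, y ^ i) / 2) - n * limRecip c a (k / n) z) := by ring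
  rw [e1]
  refine (norm_add_le _ _).trans (add_le_add (hpb.trans (le_trans ?_ hBm)) (hQF k le_rfl))
  refine add_le_add le_rfl ?_
  rw [← mul_one_div (12 * (2 * c₂ * n) ^ 2 * (2 * D₁ * H / n ^ 2))]
  gcongr

/-- The powers of a factor that decays like `exp (-c z / N)`. -/
theorem tendsto_pow_mul_exp {ι : Type} {l : Filter ι} {N κ : ι → ℝ} {k : ι → ℕ} {y z : ι → ℂ}
    {c A K : ℝ} (hc : 0 < c) (hN : Tendsto N l atTop)
    (hkκ : ∀ᶠ j in l, (k j : ℝ) ≤ κ j * N j ∧ κ j * N j ≤ k j + 1) (hκ : ∀ᶠ j in l, κ j ≤ K)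
    (hzN : Tendsto (fun j => ‖z j‖ / N j) l (𝓝 0))
    (hz2N : Tendsto (fun j => ‖z j‖ ^ 2 / N j) l (𝓝 0))
    (hy : ∀ᶠ j in l, ‖y j - Complex.exp (-(c * z j / N j))‖ ≤ A * (‖z j‖ / N j) ^ 2) :
    Tendsto (fun j => y j ^ k j * Complex.exp (κ j * (c * z j))) l (𝓝 1) := by
  have hω : Tendsto (fun j => c * z j / (N j : ℂ)) l (𝓝 0) := by
    rw [tendsto_zero_iff_norm_tendsto_zero]
    have h0 := hzN.const_mul c
    rw [mul_zero] at h0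
    refine h0.congr' ?_
    filter_upwards [hN.eventually_gt_atTop 0] with j hj
    simp [abs_of_pos hc, abs_of_pos hj, mul_div_assoc]
  -- Raising to the power k ≤ KN costs at most a constant times N(|z|/N)² = |z|²/N, which tends to
  -- 0; for z = √(-s) this is |s|/√n.
  have h1 : Tendsto (fun j => (y j * Complex.exp (c * z j / N j)) ^ k j) l (𝓝 1) := by
    rw [tendsto_iff_norm_sub_tendsto_zero]
    have hb : Tendsto (fun j => Real.exp (‖Complex.exp (c * z j / N j)‖ * (A * K)
        * (‖z j‖ ^ 2 / N j)) - 1) l (𝓝 0) := by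
      have := ((((Complex.continuous_exp.tendsto 0).comp hω).norm.mul_const (A * K)).mul hz2N)
      have := ((Real.continuous_exp.tendsto _).comp this).sub_const 1
      simpa using this
    refine squeeze_zero' (Eventually.of_forall fun _ => norm_nonneg _) ?_ hb
    filter_upwards [hkκ, hκ, hy, hN.eventually_gt_atTop 0] with j hj hκj hyj hNj
    refine (norm_pow_sub_one_le_exp _ _).trans (sub_le_sub_right (Real.exp_le_exp.2 ?_) _)
    have e1 : y j * Complex.exp (c * z j / N j) - 1
        = Complex.exp (c * z j / N j) * (y j - Complex.exp (-(c * z j / N j))) := by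
      rw [mul_sub, ← Complex.exp_add]; simp [mul_comm]
    rw [e1, norm_mul]
    have e2 : (k j : ℝ) ≤ K * N j := hj.1.trans (by gcongr)
    have e3 : 0 ≤ A * (‖z j‖ / N j) ^ 2 := (norm_nonneg _).trans hyj
    calc (k j : ℝ) * (‖Complex.exp (c * z j / N j)‖ * ‖y j - Complex.exp (-(c * z j / N j))‖)
        ≤ (K * N j) * (‖Complex.exp (c * z j / N j)‖ * (A * (‖z j‖ / N j) ^ 2)) := by
          gcongr
          exact (Nat.cast_nonneg _).trans e2
      _ = _ := by field_simp
  -- Rounding κN down to k changes the exponent by at most |cz/N|.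
  have h2 : Tendsto (fun j => Complex.exp ((κ j * N j - k j : ℝ) * (c * z j / N j))) l (𝓝 1) := by
    rw [← Complex.exp_zero]
    refine (Complex.continuous_exp.tendsto 0).comp ?_
    rw [tendsto_zero_iff_norm_tendsto_zero] at hω ⊢
    refine squeeze_zero' (Eventually.of_forall fun _ => norm_nonneg _) ?_ hω
    filter_upwards [hkκ] with j hj
    rw [norm_mul, Complex.norm_real, Real.norm_eq_abs]
    refine mul_le_of_le_one_left (norm_nonneg _) ?_
    rw [abs_le]; constructor <;> linarith [hj.1, hj.2]
  have h3 := h1.mul h2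
  rw [mul_one] at h3
  refine h3.congr' ?_
  filter_upwards [hN.eventually_gt_atTop 0] with j hj
  have hjC : (N j : ℂ) ≠ 0 := by exact_mod_cast hj.ne'
  rw [mul_pow, ← Complex.exp_nat_mul, mul_assoc, ← Complex.exp_add]
  congr 2
  push_cast
  field_simp
  ring

/-- The asymptotics of a recursion `w (i + 1) = y (exp (w i + S i) - 1)` with `y` close to `1` and
exponentially decaying perturbations `S i`. -/
theorem tendsto_level_ratio {ι : Type} {l : Filter ι} {N κ : ι → ℝ} {k : ι → ℕ} {y z : ι → ℂ}
    {w S : ι → ℕ → ℂ} {a : ℂ} {c σ M D q K c₁ c₂ : ℝ}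
    (hc : 0 < c) (hσ : 0 < σ) (hM : 0 ≤ M) (hD : 0 ≤ D) (hq0 : 0 < q) (hq1 : q < 1)
    (hc₁ : 0 < c₁) (hc₁₂ : c₁ ≤ c₂) (ha : a ≠ 0)
    (hN : Tendsto N l atTop) (hk : Tendsto k l atTop)
    (hkκ : ∀ᶠ j in l, (k j : ℝ) ≤ κ j * N j ∧ κ j * N j ≤ k j + 1)
    (hκ : ∀ᶠ j in l, 0 ≤ κ j ∧ κ j ≤ K)
    (hz : ∀ᶠ j in l, z j ≠ 0 ∧ σ * ‖z j‖ ≤ (z j).re)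
    (hz2N : Tendsto (fun j => ‖z j‖ ^ 2 / N j) l (𝓝 0))
    (hy : ∀ᶠ j in l, ‖y j - (1 - c * z j / N j)‖ ≤ M * (‖z j‖ / N j) ^ 2)
    (hw : ∀ᶠ j in l, ∀ i, w j (i + 1) = y j * (Complex.exp (w j i + S j i) - 1))
    (hS : ∀ᶠ j in l, ∀ i, ‖S j i‖ ≤ D / N j * q ^ i)
    (hv : Tendsto (fun j => (w j 0 + ∑' i, S j i) * N j) l (𝓝 a))
    (hF : ∀ κ : ℝ, 0 ≤ κ → κ ≤ K → ∀ z : ℂ, z ≠ 0 → σ * ‖z‖ ≤ z.re →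
      c₁ ≤ ‖limRecip c a κ z‖ ∧ ‖limRecip c a κ z‖ ≤ c₂) :
    Tendsto (fun j => w j (k j) * N j * limRecip c a (κ j) (z j)
      * Complex.exp (κ j * (c * z j))) l (𝓝 1) := by
  have hNpos := hN.eventually_gt_atTop 0
  have hNinv : Tendsto (fun j => (N j)⁻¹) l (𝓝 0) := tendsto_inv_atTop_zero.comp hN
  have hzN : Tendsto (fun j => ‖z j‖ / N j) l (𝓝 0) := by
    have hb := hNinv.add hz2N
    rw [add_zero] at hb
    refine squeeze_zero' ?_ ?_ hb
    · filter_upwards [hNpos] with j hj using by positivity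
    · filter_upwards [hNpos] with j hj
      rw [inv_eq_one_div, ← add_div]
      gcongr
      nlinarith [sq_nonneg (‖z j‖ - 1)]
  have h1q : 0 < 1 - q := by linarith
  set r := (1 + q) / 2 with hr
  set D₁ := D / (1 - q) with hD₁
  have hD₁0 : 0 ≤ D₁ := by positivity
  have small : ∀ {f : ι → ℝ}, Tendsto f l (𝓝 0) → ∀ δ > 0, ∀ᶠ j in l, f j ≤ δ :=
    fun hf δ hδ => (hf.eventually_lt_const hδ).mono fun _ h => h.le
  have hyone : Tendsto (fun j => ‖y j‖) l (𝓝 1) := by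
    have hb : Tendsto (fun j => M * (‖z j‖ / N j) ^ 2 + c * (‖z j‖ / N j)) l (𝓝 0) := by
      simpa using ((hzN.pow 2).const_mul M).add (hzN.const_mul c)
    have : Tendsto y l (𝓝 1) := by
      rw [tendsto_iff_norm_sub_tendsto_zero]
      refine squeeze_zero' (Eventually.of_forall fun _ => norm_nonneg _) ?_ hb
      filter_upwards [hy, hNpos] with j hj hNj
      have e : y j - 1 = (y j - (1 - c * z j / N j)) - c * z j / N j := by ring
      rw [e]
      refine (norm_sub_le _ _).trans (add_le_add hj (le_of_eq ?_))
      simp [abs_of_pos hc, abs_of_pos hNj, mul_div_assoc]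
    simpa using this.norm
  let H : ι → ℝ := fun j => 2 * c * ‖z j‖ + 8 / c₁ + 3 * D₁
  have hHN : Tendsto (fun j => H j / N j) l (𝓝 0) := by
    have h := (hzN.const_mul (2 * c)).add (hNinv.const_mul (8 / c₁ + 3 * D₁))
    simp only [mul_zero, add_zero] at h
    exact h.congr fun j => by simp only [H]; ring
  let B : ι → ℝ := fun j => 16 * K / c₁ + 192 * c₂ ^ 2 * D₁ * H j / (1 - q)
  have hBN : Tendsto (fun j => B j / N j) l (𝓝 0) := by
    have h := (hNinv.const_mul (16 * K / c₁)).add (hHN.const_mul (192 * c₂ ^ 2 * D₁ / (1 - q)))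
    simp only [mul_zero, add_zero] at h
    exact h.congr fun j => by simp only [B]; ring
  let ε : ι → ℝ := fun j => ‖1 / ((w j 0 + ∑' i, S j i) * N j) - 1 / a‖
      + (4 * M / c ^ 2 + K * (M + c ^ 2) * ‖z j‖ / c) / (2 * N j)
  have hε : Tendsto ε l (𝓝 0) := by
    have h1 : Tendsto (fun j => ‖1 / ((w j 0 + ∑' i, S j i) * N j) - 1 / a‖) l (𝓝 0) := by
      rw [← tendsto_iff_norm_sub_tendsto_zero]
      exact tendsto_const_nhds.div hv ha
    have h2 := (hNinv.const_mul (2 * M / c ^ 2)).add (hzN.const_mul (K * (M + c ^ 2) / (2 * c)))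
    have h3 := h1.add h2
    simp only [mul_zero, add_zero] at h3
    refine h3.congr' ?_
    filter_upwards [hNpos] with j hj
    simp only [ε]
    congr 1
    field_simp
    ring
  have hsmall : ∀ᶠ j in l, c * (‖z j‖ / N j) ≤ 1 ∧ c * (‖z j‖ / N j) ≤ σ ∧
      M * (‖z j‖ / N j) ≤ σ * c / 2 ∧ M * (‖z j‖ / N j) ≤ c / 2 := by
    have hcz : Tendsto (fun j => c * (‖z j‖ / N j)) l (𝓝 0) := by simpa using hzN.const_mul c
    have hMz : Tendsto (fun j => M * (‖z j‖ / N j)) l (𝓝 0) := by simpa using hzN.const_mul M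
    filter_upwards [small hcz 1 one_pos, small hcz σ hσ, small hMz (σ * c / 2) (by positivity),
      small hMz (c / 2) (by positivity)] with j h1 h2 h3 h4 using ⟨h1, h2, h3, h4⟩
  have hylow : ∀ᶠ j in l, 1 / 2 ≤ ‖y j‖ ∧ q ≤ r * ‖y j‖ := by
    have h1 := hyone.eventually_const_lt (by norm_num : (1 / 2 : ℝ) < 1)
    have h2 : ∀ᶠ j in l, q < r * ‖y j‖ :=
      (hyone.const_mul r).eventually_const_lt (by rw [hr]; linarith)
    filter_upwards [h1, h2] with j h1 h2 using ⟨h1.le, h2.le⟩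
  have hkK : ∀ᶠ j in l, (k j : ℝ) ≤ K * N j := by
    filter_upwards [hkκ, hκ, hNpos] with j hj hκj hNj
    exact hj.1.trans (by gcongr; exact hκj.2)
  have hmain : ∀ᶠ j in l, ∃ p, p * (w j (k j) + ∑' m, S j (k j + m)) = y j ^ k j ∧
      ‖p - N j * limRecip c a (k j / N j) (z j)‖ ≤ B j + N j * ε j := by
    have hDn : Tendsto (fun j => D₁ / N j) l (𝓝 0) := by
      simpa [div_eq_mul_inv] using hNinv.const_mul D₁
    have hH1 : Tendsto (fun j => 8 * c₂ * D₁ * (H j / N j)) l (𝓝 0) := by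
      simpa using hHN.const_mul (8 * c₂ * D₁)
    have hv0 : ∀ᶠ j in l, (w j 0 + ∑' i, S j i) * N j ≠ 0 := hv.eventually_ne ha
    filter_upwards [hNpos, hkK, hz, hy, hw, hS, hsmall, hylow, hv0, small hε (c₁ / 2) (by positivity),
      hN.eventually_ge_atTop (16 / c₁), small hDn 1 one_pos, small hH1 (1 / 4) (by norm_num),
      small hBN (c₁ / 4) (by positivity)]
      with j hn hkK hz hy hw hS hs hyl hv0 hε1 hn8 hDn hH1 hB1
    refine smoothed_reciprocal_bound hc hσ hM hD hq0 hq1 hc₁ hc₁₂ hn hkK hz.1 hz.2 hy hw hS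
      (fun κ h0 h1 => hF κ h0 h1 _ hz.1 hz.2) hs.1 hs.2.1 hs.2.2.1 hs.2.2.2 hyl.1 hyl.2
      (left_ne_zero_of_mul hv0) le_rfl hε1 ?_ hDn le_rfl hH1 le_rfl ?_
    · rw [div_le_iff₀ hc₁] at hn8; linarith
    · rwa [div_le_iff₀ hn] at hB1
  have hexp : ∀ᶠ j in l, ‖y j - Complex.exp (-(c * z j / N j))‖ ≤ (M + c ^ 2) * (‖z j‖ / N j) ^ 2 := by
    filter_upwards [hNpos, hz, hy, hsmall] with j hn hz hy hs
    exact (norm_geom_sub_le hc hσ hM hn hz.1 hz.2 hy hs.1 hs.2.1 hs.2.2.1 hs.2.2.2).2.2.1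
  have hpow := tendsto_pow_mul_exp hc hN hkκ (hκ.mono fun _ h => h.2) hzN hz2N hexp
  choose! p hp hpb using fun j (h : ∃ p, p * (w j (k j) + ∑' m, S j (k j + m)) = y j ^ k j ∧
      ‖p - N j * limRecip c a (k j / N j) (z j)‖ ≤ B j + N j * ε j) => h
  have hratio : Tendsto (fun j => p j / (N j * limRecip c a (κ j) (z j))) l (𝓝 1) := by
    rw [tendsto_iff_norm_sub_tendsto_zero]
    have hb := ((hBN.add hε).add (hNinv.div_const 2)).div_const c₁
    simp only [zero_div, add_zero] at hb
    refine squeeze_zero' (Eventually.of_forall fun _ => norm_nonneg _) ?_ hb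
    filter_upwards [hmain, hNpos, hκ, hz, hkκ] with j hm hn hκ hz hkκ
    have hb := hpb j hm
    obtain ⟨hF1, -⟩ := hF _ hκ.1 hκ.2 _ hz.1 hz.2
    have hFpos : 0 < ‖limRecip c a (κ j) (z j)‖ := hc₁.trans_le hF1
    have hnC : (N j : ℂ) ≠ 0 := by exact_mod_cast hn.ne'
    have e1 : p j / (N j * limRecip c a (κ j) (z j)) - 1
        = ((p j - N j * limRecip c a (k j / N j) (z j)) + N j * (limRecip c a (k j / N j) (z j)
          - limRecip c a (κ j) (z j))) / (N j * limRecip c a (κ j) (z j)) := by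
      have := norm_pos_iff.1 hFpos
      field_simp
      ring
    have e2 : ‖limRecip c a (k j / N j) (z j) - limRecip c a (κ j) (z j)‖ ≤ (N j)⁻¹ / 2 := by
      refine (norm_limRecip_sub_le hc (by positivity) hκ.1 hz.1
        (le_trans (by positivity) hz.2)).trans ?_
      gcongr
      have : (k j : ℝ) / N j - κ j = -((κ j * N j - k j) / N j) := by field_simp; ring
      rw [this, abs_neg, abs_div, abs_of_pos hn, abs_of_nonneg (by linarith [hkκ.1]), inv_eq_one_div]
      gcongr
      linarith [hkκ.2]
    rw [e1, norm_div, norm_mul, Complex.norm_real, Real.norm_of_nonneg hn.le]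
    calc _ ≤ (B j + N j * ε j + N j * ((N j)⁻¹ / 2)) / (N j * c₁) := by
          have h0 : 0 ≤ B j + N j * ε j := (norm_nonneg _).trans hb
          have e3 : ‖(p j - N j * limRecip c a (k j / N j) (z j)) + N j * (limRecip c a (k j / N j)
              (z j) - limRecip c a (κ j) (z j))‖ ≤ B j + N j * ε j + N j * ((N j)⁻¹ / 2) := by
            refine (norm_add_le _ _).trans (add_le_add hb ?_)
            rw [norm_mul, Complex.norm_real, Real.norm_of_nonneg hn.le]
            gcongr
          gcongr
      _ = _ := by field_simp
  -- Passing from v_k back to w_k: relative to the main term the tail is O(r^k), because q^k ≤ r^k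
  -- |y|^k. This is where k → ∞ enters.
  have htail : Tendsto (fun j => (∑' m, S j (k j + m)) * N j * limRecip c a (κ j) (z j)
      * Complex.exp (κ j * (c * z j))) l (𝓝 0) := by
    have hr1 : r < 1 := by rw [hr]; linarith
    have hb := ((((tendsto_pow_atTop_nhds_zero_of_lt_one (by positivity : 0 ≤ r) hr1).comp hk).const_mul
      (D₁ * c₂)).mul hpow.norm)
    rw [mul_zero, zero_mul] at hb
    refine squeeze_zero_norm' ?_ hb
    filter_upwards [hS, hNpos, hκ, hz, hylow] with j hS hn hκ hz hyl
    have hT := (tail_bound hq0.le hq1 hS (k j)).1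
    obtain ⟨-, hF2⟩ := hF _ hκ.1 hκ.2 _ hz.1 hz.2
    rw [norm_mul, norm_mul, norm_mul, Complex.norm_real, Real.norm_of_nonneg hn.le, norm_mul, norm_pow]
    have e1 : q ^ k j ≤ r ^ k j * ‖y j‖ ^ k j := by
      rw [← mul_pow]; exact pow_le_pow_left₀ hq0.le hyl.2 _
    have hc₂ : 0 ≤ c₂ := by linarith
    calc _ ≤ D / N j / (1 - q) * (r ^ k j * ‖y j‖ ^ k j) * N j * c₂
          * ‖Complex.exp (κ j * (c * z j))‖ := by
          gcongr
          exact hT.trans (by gcongr)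
      _ = _ := by
          simp only [Function.comp, hD₁]
          field_simp
  have hlim := (hpow.div hratio one_ne_zero).sub htail
  simp only [div_one, sub_zero] at hlim
  refine hlim.congr' ?_
  have hp0 : ∀ᶠ j in l, p j / (N j * limRecip c a (κ j) (z j)) ≠ 0 :=
    hratio.eventually_ne one_ne_zero
  filter_upwards [hmain, hp0] with j hm hp0
  have h := hp j hm
  have hpj : p j ≠ 0 := fun h => by simp [h] at hp0
  have hNF : (N j * limRecip c a (κ j) (z j)) ≠ 0 := fun h => by simp [h] at hp0
  have hwj : w j (k j) = y j ^ k j / p j - ∑' m, S j (k j + m) := by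
    rw [← h]; field_simp; ring
  rw [hwj]
  have hNj := left_ne_zero_of_mul hNF
  have hFj := right_ne_zero_of_mul hNF
  simp only [Pi.div_apply]
  field_simp

/-! ### The limiting expression -/

theorem abs_arg_neg {w : ℂ} (hw : w ≠ 0) : |(-w).arg| = Real.pi - |w.arg| := by
  rcases lt_trichotomy w.im 0 with h | h | h
  · rw [Complex.arg_neg_eq_arg_add_pi_of_im_neg h, abs_of_neg (Complex.arg_neg_iff.2 h),
      abs_of_nonneg (by linarith [Complex.neg_pi_lt_arg w])]
    ring
  · have hre : w.re ≠ 0 := fun h' => hw (Complex.ext h' h)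
    rcases lt_or_gt_of_ne hre with h' | h'
    · rw [Complex.arg_eq_pi_iff.2 ⟨h', h⟩, abs_of_pos Real.pi_pos,
        Complex.arg_eq_zero_iff.2 ⟨by simpa using h'.le, by simpa using h⟩]
      simp
    · rw [Complex.arg_eq_pi_iff.2 ⟨by simpa using h', by simpa using h⟩, abs_of_pos Real.pi_pos,
        Complex.arg_eq_zero_iff.2 ⟨h'.le, h⟩]
      simp
  · have h1 := (Complex.arg_nonneg_iff (z := w)).2 h.le
    rw [Complex.arg_neg_eq_arg_sub_pi_of_im_pos h, abs_of_nonneg h1,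
      abs_of_nonpos (by linarith [Complex.arg_le_pi w])]
    ring

theorem ne_zero_of_le_abs_arg {θ : ℝ} {s : ℂ} (hθ : 0 < θ) (hs : θ ≤ |s.arg|) : s ≠ 0 := by
  rintro rfl
  simp at hs
  linarith

/-- The image of the complement of a sector under `s ↦ √(-s)`. -/
theorem csqrt_neg_mem_sector {θ : ℝ} {s : ℂ} (hθ : 0 < θ) (hs : θ ≤ |s.arg|) :
    csqrt (-s) ≠ 0 ∧ Real.sin (θ / 2) * ‖csqrt (-s)‖ ≤ (csqrt (-s)).re := by
  have hs0 := ne_zero_of_le_abs_arg hθ hs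
  refine ⟨csqrt_ne_zero (neg_ne_zero.2 hs0), ?_⟩
  rw [norm_csqrt, re_csqrt, mul_comm]
  refine mul_le_mul_of_nonneg_left ?_ (Real.sqrt_nonneg _)
  have h := abs_arg_neg hs0
  have hpi := Complex.abs_arg_le_pi s
  rw [← Real.cos_abs, abs_div, abs_two, h, sub_div, Real.cos_pi_div_two_sub]
  exact Real.sin_le_sin_of_le_of_le_pi_div_two (by linarith) (by linarith) (by linarith)

/-- Every point of the sector is of the form `√(-s)`. -/
theorem exists_csqrt_neg_eq {θ : ℝ} {z : ℂ} (hθ : 0 < θ) (hθ' : θ ≤ Real.pi) (hz : z ≠ 0)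
    (hre : Real.sin (θ / 2) * ‖z‖ ≤ z.re) : ∃ s : ℂ, θ ≤ |s.arg| ∧ csqrt (-s) = z := by
  have hzpos : 0 < ‖z‖ := norm_pos_iff.2 hz
  have h1 : Real.sin (θ / 2) ≤ Real.cos |z.arg| := by
    rw [Real.cos_abs, Complex.cos_arg hz, le_div_iff₀ hzpos]
    exact hre
  have h2 : |z.arg| ≤ Real.pi / 2 - θ / 2 := by
    by_contra! h
    have := Real.cos_lt_cos_of_nonneg_of_le_pi (by linarith) (Complex.abs_arg_le_pi z) h
    rw [Real.cos_pi_div_two_sub] at this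
    linarith
  rw [abs_le] at h2
  have harg : (z ^ 2).arg = 2 * z.arg := by
    have := Complex.arg_mul_eq_add_arg_iff hz hz
    rw [sq, two_mul]
    exact this.2 ⟨by linarith, by linarith⟩
  refine ⟨-z ^ 2, ?_, ?_⟩
  · rw [abs_arg_neg (pow_ne_zero 2 hz), harg, abs_mul, abs_two]
    have : |z.arg| ≤ Real.pi / 2 - θ / 2 := abs_le.2 h2
    linarith
  · rw [neg_neg, csqrt]
    have h := Complex.pow_cpow_nat_inv (x := z) (n := 2) two_ne_zero (by push_cast; linarith)
      (by push_cast; linarith)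
    convert h using 2
    norm_num

theorem sin_half_pos {θ : ℝ} (hθ : 0 < θ) (hθ' : θ ≤ Real.pi) : 0 < Real.sin (θ / 2) :=
  Real.sin_pos_of_pos_of_lt_pi (by linarith) (by linarith)

/-- The limit of `v_0 √n`. -/
noncomputable def initLim (b t : ℝ) : ℂ := Complex.I * t * ((b * √rho : ℝ) : ℂ) ^ 2 / 2

theorem csqrt_neg_rho_mul (s : ℂ) : csqrt (-(rho * s)) = (√rho : ℝ) * csqrt (-s) := by
  rw [← csqrt_ofReal_mul rho_nonneg, mul_neg]

theorem initLim_ne_zero {b t : ℝ} (hb : 0 < b) (ht : t ≠ 0) : initLim b t ≠ 0 := by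
  have h : (((b * √rho : ℝ) : ℂ)) ≠ 0 := by
    exact_mod_cast (mul_pos hb (Real.sqrt_pos.2 rho_pos)).ne'
  have ht' : (t : ℂ) ≠ 0 := by exact_mod_cast ht
  simp [initLim, ht', Complex.I_ne_zero] at h ⊢
  exact h

theorem locDen_eq (b t κ : ℝ) (s : ℂ) : locDen b t κ s = csqrt (-s)
    - Complex.I * t * ((b * √rho : ℝ) : ℂ) / 4
      * (1 - Complex.exp (-(κ * (((b * √rho : ℝ) : ℂ) * csqrt (-s))))) := by
  rw [locDen, csqrt_neg_rho_mul]
  push_cast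
  ring_nf

theorem locDen_eq_limRecip {b t : ℝ} (hb : 0 < b) (ht : t ≠ 0) (κ : ℝ) {s : ℂ}
    (hs : csqrt (-s) ≠ 0) : locDen b t κ s
      = initLim b t * csqrt (-s) * limRecip (b * √rho) (initLim b t) κ (csqrt (-s)) := by
  have h := initLim_ne_zero hb ht
  have hc : (((b * √rho : ℝ) : ℂ)) ≠ 0 := by
    exact_mod_cast (mul_pos hb (Real.sqrt_pos.2 rho_pos)).ne'
  rw [locDen_eq, limRecip]
  set z := csqrt (-s)
  set c : ℂ := ((b * √rho : ℝ) : ℂ)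
  have e : initLim b t * z * (1 / initLim b t - (1 - Complex.exp (-(κ * (c * z)))) / (2 * (c * z)))
      = z - initLim b t * ((1 - Complex.exp (-(κ * (c * z)))) / (2 * c)) := by
    field_simp
  rw [e, initLim]
  field_simp
  ring

theorem locRep_eq (b t κ : ℝ) (n : ℕ) (s : ℂ) : locRep b t κ n s =
    ((b * √rho : ℝ) : ℂ) ^ 2 / (2 * (√(n : ℝ) : ℝ)) * (Complex.I * t * csqrt (-s)
      * Complex.exp (-(κ * (((b * √rho : ℝ) : ℂ) * csqrt (-s)))) / locDen b t κ s) := by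
  have h : (b : ℂ) ^ 2 * rho = ((b * √rho : ℝ) : ℂ) ^ 2 := by
    norm_cast
    rw [mul_pow, Real.sq_sqrt rho_nonneg]
  rw [locRep, h, csqrt_neg_rho_mul]
  push_cast
  ring_nf

theorem locRep_eq_limRecip {b t : ℝ} (hb : 0 < b) (ht : t ≠ 0) (κ : ℝ) (n : ℕ) {s : ℂ}
    (hs : csqrt (-s) ≠ 0) : locRep b t κ n s
      = Complex.exp (-(κ * (((b * √rho : ℝ) : ℂ) * csqrt (-s))))
        / ((√(n : ℝ) : ℝ) * limRecip (b * √rho) (initLim b t) κ (csqrt (-s))) := by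
  have h := initLim_ne_zero hb ht
  have e : ((b * √rho : ℝ) : ℂ) ^ 2 * (Complex.I * t) = 2 * initLim b t := by
    rw [initLim]; ring
  rw [locRep_eq, locDen_eq_limRecip hb ht κ hs]
  set z := csqrt (-s)
  set c : ℂ := ((b * √rho : ℝ) : ℂ)
  set E := Complex.exp (-(κ * (c * z)))
  set F := limRecip (b * √rho) (initLim b t) κ z
  calc c ^ 2 / (2 * ((√(n : ℝ) : ℝ) : ℂ)) * (Complex.I * t * z * E / (initLim b t * z * F))
      = (c ^ 2 * (Complex.I * t)) / (2 * initLim b t) * (z / z) * (E / ((√(n : ℝ) : ℝ) * F)) := by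
        simp only [div_eq_mul_inv, mul_inv]; ring
    _ = _ := by rw [e, div_self (mul_ne_zero two_ne_zero h), div_self hs]; ring

/-- The two forms of the limiting expression agree. -/
theorem locRep_eq_Psi (b t κ : ℝ) (n : ℕ) (s : ℂ) : locRep b t κ n s =
    (b : ℂ) * (√(2 * rho) : ℝ) / (√(n : ℝ) : ℝ) * Psi (κ * b * √rho / (2 * √2)) s
      (Complex.I * t * b * (√rho : ℝ) / (2 * √2 : ℝ)) := by
  have h2 : ((√2 : ℝ) : ℂ) ≠ 0 := by exact_mod_cast (Real.sqrt_pos.2 two_pos).ne'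
  have h22 : ((√2 : ℝ) : ℂ) ^ 2 = 2 := by
    exact_mod_cast Real.sq_sqrt (zero_le_two (α := ℝ))
  have e1 : csqrt (-2 * s) = (√2 : ℝ) * csqrt (-s) := by
    rw [← csqrt_ofReal_mul zero_le_two]; push_cast; ring_nf
  have e2 : ((√(2 * rho) : ℝ) : ℂ) = (√2 : ℝ) * (√rho : ℝ) := by
    rw [Real.sqrt_mul zero_le_two]; push_cast; rfl
  rw [locRep_eq, locDen_eq, Psi, e1, e2]
  set z := csqrt (-s)
  set c : ℂ := ((b * √rho : ℝ) : ℂ) with hc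
  -- Half the exponent: multiplying numerator and denominator by e^h turns 1 - e^{-2h} into 2 sinh
  -- h.
  set h : ℂ := κ * (c * z) / 2 with hh
  have hc' : c = b * (√rho : ℝ) := by rw [hc]; push_cast; rfl
  have e3 : ((κ * b * √rho / (2 * √2) : ℝ) : ℂ) * ((√2 : ℝ) * z) = h := by
    rw [hh, hc']; push_cast; field_simp
  have e4 : Complex.I * t * b * (√rho : ℝ) / (2 * √2 : ℝ) = Complex.I * t * c / (2 * (√2 : ℝ)) := by
    rw [hc']; push_cast; ring
  have e5 : (κ : ℂ) * (c * z) = h + h := by rw [hh]; ring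
  rw [e3, e4, e5, neg_add, Complex.exp_add, Complex.sinh]
  have hE : Complex.exp h * Complex.exp (-h) = 1 := by rw [← Complex.exp_add]; simp
  have hE0 : Complex.exp h ≠ 0 := Complex.exp_ne_zero h
  have hden : z * Complex.exp h - Complex.I * t * c / (2 * (√2 : ℝ)) * (√2 : ℝ)
      * ((Complex.exp h - Complex.exp (-h)) / 2) = Complex.exp h * (z - Complex.I * t * c / 4
        * (1 - Complex.exp (-h) * Complex.exp (-h))) := by
    have e6 : Complex.I * t * c / (2 * (√2 : ℝ)) * (√2 : ℝ) = Complex.I * t * c / 2 := by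
      field_simp
    rw [e6]
    linear_combination (-(Complex.I * t * c / 4) * Complex.exp (-h)) * hE
  rw [hden, ← mul_div_mul_left (Complex.I * t * z * (Complex.exp (-h) * Complex.exp (-h))) _ hE0]
  have hnum : Complex.exp h * (Complex.I * t * z * (Complex.exp (-h) * Complex.exp (-h)))
      = Complex.I * t * z * Complex.exp (-h) := by
    linear_combination (Complex.I * t * z * Complex.exp (-h)) * hE
  rw [hnum, hc']
  have e7 : (b : ℂ) * ((√2 : ℝ) * (√rho : ℝ)) / (√(n : ℝ) : ℝ) = (b * (√rho : ℝ)) / (√(n : ℝ) : ℝ)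
      * (√2 : ℝ) := by ring
  rw [e7, ← mul_div_assoc, ← mul_div_assoc]
  congr 1
  have e8 : ∀ x : ℂ, x / (2 * ((√2 : ℝ) : ℂ)) = (√2 : ℝ) * x / 4 := fun x => by
    rw [div_eq_div_iff (mul_ne_zero two_ne_zero h2) (by norm_num)]
    linear_combination (-2 * x) * h22
  rw [e8]
  simp only [div_eq_mul_inv, mul_inv]
  linear_combination (-(1 / 4) * Complex.I * t * z * Complex.exp (-h) * (b * (√rho : ℝ)) ^ 2
    * ((√(n : ℝ) : ℝ) : ℂ)⁻¹) * h22

-- Sufficient conditions for the absence of poles.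

/-- A fixed point equation without solutions. -/
theorem false_of_fixed_point {p q T : ℝ} (hp : 0 < p) (hpq : 0.414 * |q| ≤ p)
    (h1 : p = -(T * (Real.exp (-p) * Real.sin q)))
    (h2 : q = T * (1 - Real.exp (-p) * Real.cos q)) : False := by
  -- Complex conjugation of ζ = p + iq exchanges T and -T.
  wlog hT : 0 ≤ T generalizing T q
  · refine this (q := -q) (T := -T) (by rwa [abs_neg]) ?_ ?_ (by linarith)
    · rw [Real.sin_neg]; linarith
    · rw [Real.cos_neg]; linarith
  have he0 := Real.exp_pos (-p)
  have he1 : Real.exp (-p) < 1 := by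
    rw [← Real.exp_zero]; exact Real.exp_lt_exp.2 (by linarith)
  have hT0 : 0 < T := by
    rcases hT.eq_or_lt with h | h
    · rw [← h] at h1; simp at h1; linarith
    · exact h
  have hcos : Real.exp (-p) * Real.cos q ≤ Real.exp (-p) :=
    mul_le_of_le_one_right he0.le (Real.cos_le_one q)
  have hq : T * (1 - Real.exp (-p)) ≤ q := by
    conv_rhs => rw [h2]
    exact mul_le_mul_of_nonneg_left (by linarith) hT
  have hq0 : 0 < q := lt_of_lt_of_le (mul_pos hT0 (by linarith)) hq
  have hsin : Real.sin q < 0 := by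
    by_contra! h
    have : 0 ≤ T * (Real.exp (-p) * Real.sin q) := by positivity
    linarith
  -- q is positive with negative sine, so it lies beyond π; this makes p large and e^{-p} small.
  have hqpi : Real.pi < q := by
    by_contra! h
    exact absurd (Real.sin_nonneg_of_nonneg_of_le_pi hq0.le h) (by linarith)
  rw [abs_of_pos hq0] at hpq
  have hpT : p ≤ T * Real.exp (-p) := by
    have h3 : -1 ≤ Real.sin q := Real.neg_one_le_sin q
    have h4 : 0 < T * Real.exp (-p) := by positivity
    nlinarith
  -- Combines q ≥ T(1 - e^{-p}) with 0.414 q ≤ p ≤ T e^{-p}. The margin is thin: this needs e^{-p} ≥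
  -- 0.2927, while p ≥ 1.299 gives e^{-p} ≤ 1/3.42 < 0.2925.
  have h5 : 0.414 * (1 - Real.exp (-p)) ≤ Real.exp (-p) := by
    have : 0.414 * (T * (1 - Real.exp (-p))) ≤ T * Real.exp (-p) := by linarith
    nlinarith
  have hp3 : 1.299 ≤ p := by linarith [Real.pi_gt_d2]
  have h6 : Real.exp (-p) * Real.exp p = 1 := by rw [← Real.exp_add]; simp
  have h7 : 3.42 ≤ Real.exp p := by
    have h := Real.sum_le_exp_of_nonneg hp.le 4
    simp only [Finset.sum_range_succ, Finset.sum_range_zero] at h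
    norm_num [Nat.factorial] at h
    have h8 : (1.299 : ℝ) ^ 2 ≤ p ^ 2 := by gcongr
    have h9 : (1.299 : ℝ) ^ 3 ≤ p ^ 3 := by gcongr
    norm_num at h8 h9
    linarith
  have h8 : 3.42 * Real.exp (-p) ≤ 1 := by nlinarith
  linarith

/-- A pole gives ζ = κcz with ζ = iT(1 - e^{-ζ}) and T = tκc²/4. For |arg s| ≥ π/4, |arg ζ| ≤ 3π/8,
so Re ζ ≥ tan(π/8)|Im ζ| with tan(π/8) = √2 - 1 > 0.414. -/
theorem poleFree_of_pi_div_four_le {b θ : ℝ} (hb : 0 < b) (hθ : Real.pi / 4 ≤ θ) (t K : ℝ) :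
    PoleFree b θ t K := by
  intro κ h0 _ s hs hden
  obtain ⟨hz, hre⟩ := csqrt_neg_mem_sector (θ := Real.pi / 4) (by positivity) (hθ.trans hs)
  rw [locDen_eq] at hden
  have hc : 0 < b * √rho := mul_pos hb (Real.sqrt_pos.2 rho_pos)
  set c := b * √rho
  set z := csqrt (-s)
  rcases h0.eq_or_lt with hκ | hκ
  · rw [← hκ] at hden
    simp at hden
    exact hz hden
  have hzpos : 0 < ‖z‖ := norm_pos_iff.2 hz
  have hsin : Real.sin (Real.pi / 4 / 2) ^ 2 = (2 - √2) / 4 := by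
    rw [div_div, show (4 * 2 : ℝ) = 8 by norm_num, Real.sin_pi_div_eight, div_pow, Real.sq_sqrt]
    · norm_num
    · have : √2 ≤ 2 := by rw [Real.sqrt_le_left (by norm_num)]; norm_num
      linarith
  have hs0 : 0 < Real.sin (Real.pi / 4 / 2) := sin_half_pos (by positivity) (by linarith [Real.pi_pos])
  have hre0 : 0 < z.re := lt_of_lt_of_le (by positivity) hre
  have hsq : Real.sin (Real.pi / 4 / 2) ^ 2 * (z.re ^ 2 + z.im ^ 2) ≤ z.re ^ 2 := by
    have h := pow_le_pow_left₀ (by positivity) hre 2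
    rw [mul_pow, ← Complex.normSq_eq_norm_sq, Complex.normSq_apply] at h
    linarith
  have hsq2 : √2 ≤ 1.4143 := by rw [Real.sqrt_le_left (by norm_num)]; norm_num
  have him : 0.414 * |z.im| ≤ z.re := by
    refine abs_le_of_sq_le_sq' ?_ hre0.le |>.2
    rw [mul_pow, sq_abs]
    rw [hsin] at hsq
    nlinarith [sq_nonneg z.re, sq_nonneg z.im]
  have hζ : (κ : ℂ) * (c * z) = ((κ * c * z.re : ℝ) : ℂ) + ((κ * c * z.im : ℝ) : ℂ) * Complex.I := by
    conv_lhs => rw [← Complex.re_add_im z]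
    push_cast; ring
  have hfix : (κ : ℂ) * (c * z)
      = ((t * κ * c ^ 2 / 4 : ℝ) : ℂ) * Complex.I * (1 - Complex.exp (-(κ * (c * z)))) := by
    rw [sub_eq_zero] at hden
    conv_lhs => rw [hden]
    push_cast; ring
  have hexp : Complex.exp (-(κ * (c * z)))
      = ((Real.exp (-(κ * c * z.re)) * Real.cos (κ * c * z.im) : ℝ) : ℂ)
        + ((-(Real.exp (-(κ * c * z.re)) * Real.sin (κ * c * z.im)) : ℝ) : ℂ) * Complex.I := by
    rw [hζ]
    apply Complex.ext <;> simp [Complex.exp_re, Complex.exp_im, -Complex.ofReal_exp,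
      -Complex.ofReal_mul, -Complex.ofReal_neg, -Complex.ofReal_cos, -Complex.ofReal_sin]
  rw [hexp, hζ] at hfix
  have h1 := congrArg Complex.re hfix
  have h2 := congrArg Complex.im hfix
  simp [-Complex.ofReal_exp, -Complex.ofReal_mul, -Complex.ofReal_neg, -Complex.ofReal_cos,
    -Complex.ofReal_sin, -Complex.ofReal_div] at h1 h2
  refine false_of_fixed_point (p := κ * c * z.re) (q := κ * c * z.im) (T := t * κ * c ^ 2 / 4)
    (by positivity) ?_ h1 h2
  rw [abs_mul, abs_of_pos (mul_pos hκ hc)]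
  have := mul_le_mul_of_nonneg_left him (mul_pos hκ hc).le
  linarith

/-- Since |1 - e^{-ζ}| ≤ |ζ| for Re ζ ≥ 0, a pole would give |z| ≤ (|t|κc²/4)|z| < |z|. -/
theorem poleFree_of_mul_lt {b θ t K : ℝ} (hb : 0 < b) (hθ : 0 < θ)
    (h : |t| * K * (b ^ 2 * rho) < 4) : PoleFree b θ t K := by
  intro κ h0 hκ s hs hden
  have hπ : θ ≤ Real.pi := hs.trans (Complex.abs_arg_le_pi s)
  obtain ⟨hz, hre⟩ := csqrt_neg_mem_sector hθ hs
  rw [locDen_eq, sub_eq_zero] at hden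
  have hc : 0 < b * √rho := mul_pos hb (Real.sqrt_pos.2 rho_pos)
  have hc2 : (b * √rho) ^ 2 = b ^ 2 * rho := by rw [mul_pow, Real.sq_sqrt rho_nonneg]
  rw [← hc2] at h
  set c := b * √rho
  set z := csqrt (-s)
  have hzpos : 0 < ‖z‖ := norm_pos_iff.2 hz
  have hre0 : 0 < z.re := lt_of_lt_of_le (mul_pos (sin_half_pos hθ hπ) hzpos) hre
  have h1 : ‖1 - Complex.exp (-(κ * (c * z)))‖ ≤ κ * (c * ‖z‖) := by
    refine (norm_one_sub_exp_neg_le ?_).trans_eq ?_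
    · rw [Complex.re_ofReal_mul, Complex.re_ofReal_mul]; positivity
    · simp [abs_of_nonneg h0, abs_of_pos hc]
  have h2 := congrArg norm hden
  rw [norm_mul, norm_div, norm_mul, norm_mul, Complex.norm_I, Complex.norm_real, Complex.norm_real,
    Real.norm_of_nonneg hc.le, Complex.norm_ofNat, Real.norm_eq_abs, one_mul] at h2
  have h3 : ‖z‖ ≤ |t| * c / 4 * (κ * (c * ‖z‖)) := by
    conv_lhs => rw [h2]
    gcongr
  have h4 : |t| * κ * c ^ 2 ≤ |t| * K * c ^ 2 := by gcongr
  have h5 : (|t| * κ * c ^ 2) * ‖z‖ < 4 * ‖z‖ := by gcongr; linarith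
  linarith

/-! ### The local representation -/

theorem neg_mem_slitPlane {θ : ℝ} {s : ℂ} (hθ : 0 < θ) (hs : θ ≤ |s.arg|) :
    -s ∈ Complex.slitPlane := by
  have hs0 := ne_zero_of_le_abs_arg hθ hs
  refine Complex.mem_slitPlane_iff_arg.2 ⟨fun h => ?_, neg_ne_zero.2 hs0⟩
  have := abs_arg_neg hs0
  rw [h, abs_of_pos Real.pi_pos] at this
  linarith

theorem rho_sub_mul (s : ℂ) (n : ℕ) :
    (rho : ℂ) - rho * (1 + s / n) = ((rho / n : ℝ) : ℂ) * (-s) := by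
  push_cast; ring

theorem tendsto_sq_log_div_sqrt {ι : Type} {l : Filter ι} {n : ι → ℕ} (hn : Tendsto n l atTop) :
    Tendsto (fun j => Real.log (n j) ^ 2 / √(n j : ℝ)) l (𝓝 0) := by
  have hN : Tendsto (fun j => √(n j : ℝ)) l atTop :=
    Real.tendsto_sqrt_atTop.comp (tendsto_natCast_atTop_atTop.comp hn)
  have h := ((Real.isLittleO_pow_log_id_atTop (n := 2)).tendsto_div_nhds_zero.comp hN).const_mul 4
  rw [mul_zero] at h
  refine h.congr fun j => ?_
  simp only [Function.comp, id]
  rw [Real.log_sqrt (Nat.cast_nonneg _)]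
  ring

theorem tendsto_div_sqrt {ι : Type} {l : Filter ι} {n : ι → ℕ} {s : ι → ℂ} {C : ℝ}
    (hn : Tendsto n l atTop) (hs : ∀ᶠ j in l, ‖s j‖ ≤ C * Real.log (n j) ^ 2) :
    Tendsto (fun j => ‖s j‖ / √(n j : ℝ)) l (𝓝 0) := by
  have h := (tendsto_sq_log_div_sqrt hn).const_mul C
  rw [mul_zero] at h
  refine squeeze_zero' (Eventually.of_forall fun j => by positivity) ?_ h
  filter_upwards [hs] with j hj
  rw [← mul_div_assoc]
  gcongr

theorem tendsto_slitDisc {ι : Type} {l : Filter ι} {n : ι → ℕ} {s : ι → ℂ} {C θ η : ℝ}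
    (hη : 0 < η) (hθ : 0 < θ) (hn : Tendsto n l atTop)
    (hs : ∀ᶠ j in l, θ ≤ |(s j).arg| ∧ ‖s j‖ ≤ C * Real.log (n j) ^ 2) :
    Tendsto (fun j => (rho : ℂ) * (1 + s j / n j)) l (𝓝[slitDisc η] (rho : ℂ)) := by
  have hN : Tendsto (fun j => √(n j : ℝ)) l atTop :=
    Real.tendsto_sqrt_atTop.comp (tendsto_natCast_atTop_atTop.comp hn)
  have hsn : Tendsto (fun j => s j / (n j : ℂ)) l (𝓝 0) := by
    rw [tendsto_zero_iff_norm_tendsto_zero]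
    have h := (tendsto_div_sqrt hn (hs.mono fun _ h => h.2)).mul (tendsto_inv_atTop_zero.comp hN)
    rw [mul_zero] at h
    refine h.congr fun j => ?_
    have : ((n j : ℝ)) = √(n j : ℝ) * √(n j : ℝ) := (Real.mul_self_sqrt (Nat.cast_nonneg _)).symm
    rw [norm_div, Complex.norm_natCast]
    conv_rhs => rw [this]
    simp only [Function.comp, div_eq_mul_inv, mul_inv]
    ring
  have hX : Tendsto (fun j => (rho : ℂ) * (1 + s j / n j)) l (𝓝 (rho : ℂ)) := by
    simpa using (hsn.const_add 1).const_mul (rho : ℂ)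
  refine tendsto_nhdsWithin_iff.2 ⟨hX, ?_⟩
  have hlt : ∀ᶠ j in l, ‖(rho : ℂ) * (1 + s j / n j)‖ < rho + η :=
    hX.norm.eventually_lt_const (by rw [norm_rho]; linarith)
  filter_upwards [hlt, hs, hn.eventually_gt_atTop 0] with j h1 h2 h3
  refine mem_slitDisc.2 ⟨h1, ?_⟩
  have hpos : 0 < rho / (n j : ℝ) := div_pos rho_pos (by exact_mod_cast h3)
  have h4 := neg_mem_slitPlane hθ h2.1
  rw [Complex.mem_slitPlane_iff_arg] at h4 ⊢
  rw [rho_sub_mul, Complex.arg_real_mul _ hpos]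
  exact ⟨h4.1, mul_ne_zero (by exact_mod_cast hpos.ne') h4.2⟩

theorem csqrt_rho_sub (s : ℂ) (n : ℕ) : csqrt ((rho : ℂ) - rho * (1 + s / n))
    = (√rho : ℝ) * csqrt (-s) / (√(n : ℝ) : ℝ) := by
  rw [rho_sub_mul, csqrt_ofReal_mul (div_nonneg rho_nonneg (Nat.cast_nonneg _)),
    Real.sqrt_div rho_nonneg]
  push_cast
  ring

/-- Needed for t = 0, where the limiting expression vanishes and no ratio can be formed. -/
theorem wLevel_one_eq_zero {Y : ℂ → ℂ} (hY : ∀ x : ℂ, ‖x‖ < rho → Y x = ySeries x) {x : ℂ}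
    (hx : ‖x‖ ≤ rhoOne) (hYx : Y x * Complex.exp (-Y x) = Phi x) (k : ℕ) : wLevel Y k x 1 = 0 := by
  induction k with
  | zero => simp [wLevel, yLevel]
  | succ k ih =>
    have h : perturb Y k x 1 = 0 := by
      simpa using norm_perturb_le hY k hx (u := 1) (by simp)
    rw [wLevel_succ hY k hx (by simp) hYx, ih, h]
    simp

theorem norm_exp_I_mul_div (t N : ℝ) : ‖Complex.exp (Complex.I * t / N)‖ = 1 := by
  rw [Complex.norm_exp]
  have : (Complex.I * t / N).re = 0 := by
    rw [mul_div_assoc, ← Complex.ofReal_div, Complex.re_mul_ofReal]; simp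
  rw [this, Real.exp_zero]

theorem norm_exp_I_mul_div_sub_one_le {t N : ℝ} (hN : 0 < N) :
    ‖Complex.exp (Complex.I * t / N) - 1‖ ≤ |t| / N := by
  have : (Complex.I * t / N).re = 0 := by
    rw [mul_div_assoc, ← Complex.ofReal_div, Complex.re_mul_ofReal]; simp
  have h := norm_exp_sub_exp_le (a := Complex.I * t / N) (b := 0) (M := 0) this.le (by simp)
  simpa [abs_of_pos hN] using h

theorem tendsto_exp_sub_one_mul {ι : Type} {l : Filter ι} {N : ι → ℝ} (hN : Tendsto N l atTop)
    {t : ℝ} (ht : t ≠ 0) :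
    Tendsto (fun j => (Complex.exp (Complex.I * t / N j) - 1) * N j) l (𝓝 (Complex.I * t)) := by
  have hIt : Complex.I * (t : ℂ) ≠ 0 := mul_ne_zero Complex.I_ne_zero (by exact_mod_cast ht)
  have hδ : Tendsto (fun j => Complex.I * (t : ℂ) / N j) l (𝓝[≠] 0) := by
    refine tendsto_nhdsWithin_iff.2 ⟨?_, ?_⟩
    · have h : Tendsto (fun j => ((N j)⁻¹ : ℝ)) l (𝓝 0) := tendsto_inv_atTop_zero.comp hN
      have h2 := ((Complex.continuous_ofReal.tendsto 0).comp h).const_mul (Complex.I * (t : ℂ))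
      simpa [Function.comp_def, div_eq_mul_inv] using h2
    · filter_upwards [hN.eventually_gt_atTop 0] with j hj
      exact div_ne_zero hIt (by exact_mod_cast hj.ne')
  have h := ((Complex.hasDerivAt_exp 0).tendsto_slope_zero.comp hδ).mul_const (Complex.I * (t : ℂ))
  simp only [Complex.exp_zero, one_mul] at h
  refine h.congr' ?_
  filter_upwards [hN.eventually_gt_atTop 0] with j hj
  have hjC : (N j : ℂ) ≠ 0 := by exact_mod_cast hj.ne'
  have htC : (t : ℂ) ≠ 0 := by exact_mod_cast ht
  simp only [Function.comp, zero_add, smul_eq_mul, inv_div]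
  field_simp

theorem tendsto_continuation {η : ℝ} {Y : ℂ → ℂ}
    (hO : (fun x : ℂ => Y x - (1 - (bConst : ℂ) * csqrt ((rho : ℂ) - x)))
      =O[𝓝[slitDisc η] (rho : ℂ)] fun x : ℂ => (rho : ℂ) - x) :
    Tendsto Y (𝓝[slitDisc η] (rho : ℂ)) (𝓝 1) := by
  have h1 : Tendsto (fun x : ℂ => (rho : ℂ) - x) (𝓝[slitDisc η] (rho : ℂ)) (𝓝 0) := by
    have : Tendsto (fun x : ℂ => (rho : ℂ) - x) (𝓝 (rho : ℂ)) (𝓝 ((rho : ℂ) - rho)) :=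
      tendsto_const_nhds.sub tendsto_id
    rw [sub_self] at this
    exact this.mono_left nhdsWithin_le_nhds
  have h2 := hO.trans_tendsto h1
  have h3 := (tendsto_csqrt_zero.comp h1).const_mul (bConst : ℂ)
  have h4 := h2.add (h3.const_sub 1)
  simp only [mul_zero, sub_zero, zero_add] at h4
  exact h4.congr fun x => by simp

/-- `initLim` is purely imaginary and κ/2 is real. The expression is the value of `limRecip` at z =
0, a point that (*) does not cover. -/
theorem one_div_initLim_sub_ne_zero {b t : ℝ} (hb : 0 < b) (ht : t ≠ 0) (κ : ℝ) :
    1 / initLim b t - κ / 2 ≠ 0 := by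
  intro h
  have ha := initLim_ne_zero hb ht
  have h1 : ((κ / 2 : ℝ) : ℂ) * initLim b t = 1 := by
    rw [sub_eq_zero] at h
    push_cast
    rw [← h]
    field_simp
  have h2 : initLim b t = ((t * (b * √rho) ^ 2 / 2 : ℝ) : ℂ) * Complex.I := by
    rw [initLim]; push_cast; ring
  have h3 := congrArg Complex.re h1
  rw [h2, Complex.re_ofReal_mul, Complex.re_ofReal_mul] at h3
  simp at h3

/-- Two-sided bounds for the reciprocal of the limiting expression. -/
theorem exists_limRecip_bounds {b θ t K : ℝ} (hb : 0 < b) (ht : t ≠ 0) (hθ : 0 < θ)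
    (hθ' : θ ≤ Real.pi) (hp : PoleFree b θ t K) :
    ∃ c₁ c₂ : ℝ, 0 < c₁ ∧ c₁ ≤ c₂ ∧ ∀ κ : ℝ, 0 ≤ κ → κ ≤ K → ∀ z : ℂ, z ≠ 0 →
      Real.sin (θ / 2) * ‖z‖ ≤ z.re →
      c₁ ≤ ‖limRecip (b * √rho) (initLim b t) κ z‖ ∧
      ‖limRecip (b * √rho) (initLim b t) κ z‖ ≤ c₂ := by
  have hc : 0 < b * √rho := mul_pos hb (Real.sqrt_pos.2 rho_pos)
  have hσ := sin_half_pos hθ hθ'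
  obtain ⟨c₁, hc₁, h⟩ := exists_le_norm_limRecip (K := K) hc (initLim_ne_zero hb ht)
    (fun κ h0 h1 z hz hre hF => by
      obtain ⟨s, hs, rfl⟩ := exists_csqrt_neg_eq hθ hθ' hz hre
      refine hp κ h0 h1 s hs ?_
      rw [locDen_eq_limRecip hb ht κ hz, hF, mul_zero])
    (fun κ _ _ => one_div_initLim_sub_ne_zero hb ht κ) hσ
  refine ⟨c₁, max c₁ (1 / ‖initLim b t‖ + K / 2), hc₁, le_max_left _ _, fun κ h0 h1 z hz hre =>
    ⟨h κ h0 h1 z hz hre, ?_⟩⟩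
  exact (norm_limRecip_le hc h0 h1 hz (le_trans (by positivity) hre)).trans (le_max_right _ _)

/-- The asymptotics of the level functions along any filter. -/
theorem tendsto_wLevel_div_locRep {η : ℝ} {Y : ℂ → ℂ} (hη : 0 < η) (hη1 : rho + η ≤ rhoOne)
    (hY : ∀ x : ℂ, ‖x‖ < rho → Y x = ySeries x)
    (heq : ∀ x ∈ slitDisc η, Y x * Complex.exp (-Y x) = Phi x)
    (hO : (fun x : ℂ => Y x - (1 - (bConst : ℂ) * csqrt ((rho : ℂ) - x)))
      =O[𝓝[slitDisc η] (rho : ℂ)] fun x : ℂ => (rho : ℂ) - x)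
    {θ t K C : ℝ} (hθ : 0 < θ) (hθ' : θ ≤ Real.pi) (ht : t ≠ 0) (hp : PoleFree bConst θ t K)
    {ι : Type} {l : Filter ι} {n : ι → ℕ} {κ : ι → ℝ} {s : ι → ℂ} (hn : Tendsto n l atTop)
    (hk : Tendsto (fun j => ⌊κ j * √(n j : ℝ)⌋₊) l atTop)
    (hκ : ∀ᶠ j in l, 0 ≤ κ j ∧ κ j ≤ K)
    (hs : ∀ᶠ j in l, θ ≤ |(s j).arg| ∧ ‖s j‖ ≤ C * Real.log (n j) ^ 2) :
    Tendsto (fun j => wLevel Y ⌊κ j * √(n j : ℝ)⌋₊ ((rho : ℂ) * (1 + s j / n j))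
      (Complex.exp (Complex.I * t / (√(n j : ℝ) : ℝ))) / locRep bConst t (κ j) (n j) (s j))
      l (𝓝 1) := by
  have hc : 0 < bConst * √rho := mul_pos bConst_pos (Real.sqrt_pos.2 rho_pos)
  have hσ := sin_half_pos hθ hθ'
  obtain ⟨c₁, c₂, hc₁, hc₁₂, hF⟩ := exists_limRecip_bounds bConst_pos ht hθ hθ' hp
  have hN : Tendsto (fun j => √(n j : ℝ)) l atTop :=
    Real.tendsto_sqrt_atTop.comp (tendsto_natCast_atTop_atTop.comp hn)
  have hX := tendsto_slitDisc hη hθ hn hs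
  have hXn := hX.mono_right nhdsWithin_le_nhds
  have hXmem : ∀ᶠ j in l, (rho : ℂ) * (1 + s j / n j) ∈ slitDisc η :=
    (tendsto_nhdsWithin_iff.1 hX).2
  have hXle : ∀ᶠ j in l, ‖(rho : ℂ) * (1 + s j / n j)‖ ≤ rhoOne := by
    filter_upwards [hXmem] with j hj
    exact ((mem_slitDisc.1 hj).1.trans_le hη1).le
  have hU1 : ∀ j, ‖Complex.exp (Complex.I * t / (√(n j : ℝ) : ℝ))‖ ≤ 1 :=
    fun j => (norm_exp_I_mul_div _ _).le
  have hUN := tendsto_exp_sub_one_mul hN ht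
  have hIt : Complex.I * (t : ℂ) ≠ 0 := mul_ne_zero Complex.I_ne_zero (by exact_mod_cast ht)
  have hUne : ∀ᶠ j in l, Complex.exp (Complex.I * t / (√(n j : ℝ) : ℝ)) - 1 ≠ 0 := by
    filter_upwards [hUN.eventually_ne hIt] with j hj using left_ne_zero_of_mul hj
  have hU : Tendsto (fun j => Complex.exp (Complex.I * t / (√(n j : ℝ) : ℝ))) l (𝓝[≠] 1) := by
    refine tendsto_nhdsWithin_iff.2 ⟨?_, hUne.mono fun _ h => sub_ne_zero.1 h⟩
    rw [tendsto_iff_norm_sub_tendsto_zero]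
    have hb := (tendsto_inv_atTop_zero.comp hN).const_mul |t|
    rw [mul_zero] at hb
    refine squeeze_zero' (Eventually.of_forall fun _ => norm_nonneg _) ?_ hb
    filter_upwards [hN.eventually_gt_atTop 0] with j hj
    exact norm_exp_I_mul_div_sub_one_le hj
  have hv : Tendsto (fun j => (wLevel Y 0 ((rho : ℂ) * (1 + s j / n j))
      (Complex.exp (Complex.I * t / (√(n j : ℝ) : ℝ)))
      + ∑' i, perturb Y i ((rho : ℂ) * (1 + s j / n j))
        (Complex.exp (Complex.I * t / (√(n j : ℝ) : ℝ)))) * ((√(n j : ℝ) : ℝ) : ℂ)) l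
      (𝓝 (initLim bConst t)) := by
    have h := hUN.mul (((tendsto_continuation hO).comp hX).add
      (tendsto_perturb_div hY hXn hU (Eventually.of_forall hU1)))
    -- The summand 1 is y(ρ), coming from w_0 = (u - 1)y; the other is the sum of all perturbations.
    have e : Complex.I * (t : ℂ) * (1 + ((bConst ^ 2 * rho / 2 - 1 : ℝ) : ℂ)) = initLim bConst t := by
      have : ((bConst * √rho : ℝ) : ℂ) ^ 2 = (bConst : ℂ) ^ 2 * rho := by
        norm_cast
        rw [mul_pow, Real.sq_sqrt rho_nonneg]
      rw [initLim, this]; push_cast; ring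
    rw [e] at h
    refine h.congr' ?_
    filter_upwards [hUne] with j hj
    simp only [Function.comp, wLevel, yLevel]
    field_simp
  obtain ⟨M, hM, hMO⟩ := hO.exists_pos
  have hy := hX.eventually hMO.bound
  have hmain := tendsto_level_ratio (N := fun j => √(n j : ℝ)) (κ := κ)
    (k := fun j => ⌊κ j * √(n j : ℝ)⌋₊) (y := fun j => Y ((rho : ℂ) * (1 + s j / n j)))
    (z := fun j => csqrt (-s j))
    (w := fun j i => wLevel Y i ((rho : ℂ) * (1 + s j / n j))
      (Complex.exp (Complex.I * t / (√(n j : ℝ) : ℝ))))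
    (S := fun j i => perturb Y i ((rho : ℂ) * (1 + s j / n j))
      (Complex.exp (Complex.I * t / (√(n j : ℝ) : ℝ))))
    -- |ρ - x| = ρ(|z|/√n)² yields the factor ρ, and |u - 1| ≤ |t|/√n yields |t|.
    (M := M * rho) (D := pertConst * |t|) (K := K) hc hσ (mul_nonneg hM.le rho_nonneg)
    (mul_nonneg pertConst_pos.le (abs_nonneg _)) lam_pos lam_lt_one hc₁ hc₁₂
    (initLim_ne_zero bConst_pos ht) hN hk
    (hκ.mono fun j hj => ⟨Nat.floor_le (mul_nonneg hj.1 (Real.sqrt_nonneg _)),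
      (Nat.lt_floor_add_one _).le⟩) hκ
    (hs.mono fun j hj => csqrt_neg_mem_sector hθ hj.1)
    ((tendsto_div_sqrt hn (hs.mono fun _ h => h.2)).congr fun j => by
      rw [norm_csqrt_sq, norm_neg])
    (by
      filter_upwards [hy, hN.eventually_gt_atTop 0] with j hj hNj
      rw [csqrt_rho_sub, rho_sub_mul] at hj
      refine le_trans (le_of_eq ?_) (hj.trans (le_of_eq ?_))
      · push_cast; ring_nf
      · rw [norm_mul, norm_neg, Complex.norm_real, div_pow, norm_csqrt_sq, norm_neg,
          Real.sq_sqrt (Nat.cast_nonneg _),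
          Real.norm_of_nonneg (div_nonneg rho_nonneg (Nat.cast_nonneg _))]
        ring)
    (by
      filter_upwards [hXmem, hXle] with j h1 h2 i
      exact wLevel_succ hY i h2 (hU1 j) (heq _ h1))
    (by
      filter_upwards [hXle, hN.eventually_gt_atTop 0] with j h2 hNj i
      refine (norm_perturb_le hY i h2 (hU1 j)).trans ?_
      rw [mul_div_assoc pertConst]
      exact mul_le_mul_of_nonneg_right (mul_le_mul_of_nonneg_left
        (norm_exp_I_mul_div_sub_one_le hNj) pertConst_pos.le) (pow_nonneg lam_pos.le _))
    hv hF
  refine hmain.congr' ?_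
  filter_upwards [hs] with j hj
  rw [locRep_eq_limRecip bConst_pos ht _ _ (csqrt_neg_mem_sector hθ hj.1).1, Complex.exp_neg]
  field_simp

theorem locRep_zero (b κ : ℝ) (n : ℕ) (s : ℂ) : locRep b 0 κ n s = 0 := by
  simp [locRep]

/-- For L = 0 the quotient is 0 by convention, at distance exactly 1 from 1; the strict inequality
thus excludes this case. -/
theorem norm_sub_le_of_norm_div_sub_one_le {w L : ℂ} {ε : ℝ} (h : ‖w / L - 1‖ ≤ ε)
    (h1 : ‖w / L - 1‖ < 1) : ‖w - L‖ ≤ ε * ‖L‖ := by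
  have hL : L ≠ 0 := by
    rintro rfl
    simp at h1
  have e : w - L = (w / L - 1) * L := by field_simp
  rw [e, norm_mul]
  gcongr

/-- If uniformity failed, each N would supply offending parameters; these form sequences with n, k →
∞, contrary to the limit of the ratio. The existence of some s also yields θ ≤ π. -/
theorem exists_forall_norm_wLevel_sub_le {η : ℝ} {Y : ℂ → ℂ} (hη : 0 < η) (hη1 : rho + η ≤ rhoOne)
    (hY : ∀ x : ℂ, ‖x‖ < rho → Y x = ySeries x)
    (heq : ∀ x ∈ slitDisc η, Y x * Complex.exp (-Y x) = Phi x)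
    (hO : (fun x : ℂ => Y x - (1 - (bConst : ℂ) * csqrt ((rho : ℂ) - x)))
      =O[𝓝[slitDisc η] (rho : ℂ)] fun x : ℂ => (rho : ℂ) - x)
    {θ t K C : ℝ} (hθ : 0 < θ) (hp : PoleFree bConst θ t K) {ε : ℝ} (hε : 0 < ε) :
    ∃ N : ℕ, ∀ n : ℕ, N ≤ n → ∀ κ : ℝ, 0 ≤ κ → κ ≤ K → N ≤ ⌊κ * √(n : ℝ)⌋₊ →
      ∀ s : ℂ, θ ≤ |Complex.arg s| → ‖s‖ ≤ C * Real.log n ^ 2 →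
        ‖wLevel Y ⌊κ * √(n : ℝ)⌋₊ ((rho : ℂ) * (1 + s / n))
          (Complex.exp (Complex.I * t / (√(n : ℝ) : ℝ))) - locRep bConst t κ n s‖
          ≤ ε * ‖locRep bConst t κ n s‖ := by
  by_contra! hcon
  choose n hn κ h0 h1 hk s hs hsC hlt using hcon
  have hn' : Tendsto n atTop atTop := tendsto_atTop_mono hn tendsto_id
  have hk' : Tendsto (fun j => ⌊κ j * √(n j : ℝ)⌋₊) atTop atTop := tendsto_atTop_mono hk tendsto_id
  have hss : ∀ᶠ j in atTop, θ ≤ |(s j).arg| ∧ ‖s j‖ ≤ C * Real.log (n j) ^ 2 :=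
    Eventually.of_forall fun j => ⟨hs j, hsC j⟩
  have hθ' : θ ≤ Real.pi := (hs 0).trans (Complex.abs_arg_le_pi _)
  rcases eq_or_ne t 0 with rfl | ht
  · have hmem := (tendsto_nhdsWithin_iff.1 (tendsto_slitDisc hη hθ hn' hss)).2
    obtain ⟨j, hj⟩ := hmem.exists
    have h := hlt j
    rw [locRep_zero] at h
    simp only [Complex.ofReal_zero, mul_zero, zero_div, Complex.exp_zero] at h
    rw [wLevel_one_eq_zero hY ((mem_slitDisc.1 hj).1.trans_le hη1).le (heq _ hj)] at h
    simp at h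
  · have h := tendsto_iff_norm_sub_tendsto_zero.1 (tendsto_wLevel_div_locRep hη hη1 hY heq hO hθ hθ'
      ht hp hn' hk' (Eventually.of_forall fun j => ⟨h0 j, h1 j⟩) hss)
    obtain ⟨j, hj1, hj2⟩ := ((h.eventually_lt_const hε).and (h.eventually_lt_const one_pos)).exists
    exact absurd (norm_sub_le_of_norm_div_sub_one_le hj1.le hj2) (not_le.2 (hlt j))

end PolyaTrees

theorem mainTheorem6 :
    ∃ (b η : ℝ) (Y : ℂ → ℂ), 0 < b ∧ 0 < η ∧
      PolyaTrees.IsContinuation η Y ∧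
      -- `b` is the constant in `y(x) = 1 - b √(ρ - x) + O(ρ - x)`
      (fun x : ℂ => Y x - (1 - (b : ℂ) * PolyaTrees.csqrt ((PolyaTrees.rho : ℂ) - x)))
        =O[nhdsWithin (PolyaTrees.rho : ℂ) (PolyaTrees.slitDisc η)]
          (fun x : ℂ => (PolyaTrees.rho : ℂ) - x) ∧
      -- sufficient conditions for the absence of poles
      (∀ θ t K : ℝ, Real.pi / 4 ≤ θ → PolyaTrees.PoleFree b θ t K) ∧
      (∀ θ t K : ℝ, 0 < θ → |t| * K * (b ^ 2 * PolyaTrees.rho) < 4 →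
        PolyaTrees.PoleFree b θ t K) ∧
      -- the local representation
      ∀ θ t K C : ℝ, 0 < θ → PolyaTrees.PoleFree b θ t K →
        ∀ ε : ℝ, 0 < ε → ∃ N : ℕ, ∀ n : ℕ, N ≤ n →
          ∀ κ : ℝ, 0 ≤ κ → κ ≤ K → N ≤ ⌊κ * √(n : ℝ)⌋₊ →
          ∀ s : ℂ, θ ≤ |Complex.arg s| → ‖s‖ ≤ C * Real.log n ^ 2 →
            ‖PolyaTrees.wLevel Y ⌊κ * √(n : ℝ)⌋₊
                ((PolyaTrees.rho : ℂ) * (1 + s / n))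
                (Complex.exp (Complex.I * t / (√(n : ℝ) : ℝ)))
              - PolyaTrees.locRep b t κ n s‖ ≤ ε * ‖PolyaTrees.locRep b t κ n s‖ ∧
            PolyaTrees.locRep b t κ n s =
              (b : ℂ) * (√(2 * PolyaTrees.rho) : ℝ) / (√(n : ℝ) : ℝ) *
                PolyaTrees.Psi (κ * b * √PolyaTrees.rho / (2 * √2)) s
                  (Complex.I * t * b * (√PolyaTrees.rho : ℝ) / (2 * √2 : ℝ)) := by
  obtain ⟨η, Y, hη, hη1, hY, heq, hO⟩ := PolyaTrees.exists_continuation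
  refine ⟨PolyaTrees.bConst, η, Y, PolyaTrees.bConst_pos, hη, hY, hO,
    fun θ t K hθ => PolyaTrees.poleFree_of_pi_div_four_le PolyaTrees.bConst_pos hθ t K,
    fun θ t K hθ h => PolyaTrees.poleFree_of_mul_lt PolyaTrees.bConst_pos hθ h,
    fun θ t K C hθ hp ε hε => ?_⟩
  obtain ⟨N, hN⟩ := PolyaTrees.exists_forall_norm_wLevel_sub_le (C := C) hη hη1 hY.2 heq hO hθ hp hε
  exact ⟨N, fun n hn κ h0 h1 hk s hs hsC =>
    ⟨hN n hn κ h0 h1 hk s hs hsC, PolyaTrees.locRep_eq_Psi _ t κ n s⟩⟩
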